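/- **Compression cost.** For a string $u$ over a finite alphabet $\Sigma$ let $n_c$ be the number of occurrences of $c$ in $u$. Its zeroth order empirical entropy is $H_0(u)=\frac1{|u|}\sum_{c\in\Sigma} n_c\log_2\frac{|u|}{n_c}$ (terms with $n_c=0$ are $0$), and its zeroth order adaptive entropy is $H_0^a(u)=\frac1{|u|}\bigl(\log_2(|u|!)-\sum_{c\in\Sigma}\log_2(n_c!)\bigr)$; both are $0$ for the empty string. For a string $x\in\Sigma^k$ let $x_u$ be the string of the symbols following the occurrences of $x$ in $u$, from left to right, and put $H_k(u)=\frac1{|u|}\sum_{x\in\Sigma^k}|x_u|\,H_0(x_u)$ and $H_k^a(u)=\frac1{|u|}\sum_{x\in\Sigma^k}|x_u|\,H_0^a(x_u)$. Fix $\lambda>0$ and an overhead function $f$ that is nonnegative and nondecreasing in both arguments on $\{(m,s): 1\le s\le m\}$. The compressed size of a nonempty string $u$ with $\sigma_u$ distinct symbols is estimated by $\lambda|u|H_k(u)+f(|u|,\sigma_u)$ for a $k$-th order compressor, and by $\lambda|u|H^a_k(u)+f(|u|,\sigma_u)$ for a $k$-th order adaptive compressor. The cost of a partition of a text $T$ into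 nonempty contiguous substrings is the sum of the estimates of its parts, and a partition is $(1+\epsilon)$-optimal if its cost is at most $1+\epsilon$ times the cost of every partition of $T$. **Machine.** A unit-cost random access machine. Its integer cells hold words of $w$ bits, with addition, multiplication, truncated subtraction, division, remainder and comparison of words. Its real cells hold exact real numbers, with $+,-,\times,/$, comparison, conversion of words to reals and $\log_2$ of words, but no conversion of reals to words. One evaluation of $f$ at two words is also a unit-cost operation. Space is the number of cells. **Theorem.** In each of the two cases (plain and adaptive), and for every polynomial $p$ with coefficients in $\mathbb N$, there is a program such that for every $\epsilon_0>0$ there is a constant $C$ with the following property. Let $T[1,n]$, $n\ge 2$, be a text over an alphabet $\{0,\dots,\sigma-1\}$ of size $\sigma\le p(n)$, let the word length $w$ satisfy $2^w\ge C n^C$ (so that $w=\Theta(\log n)$ suffices), let $k\ge 0$ be an order that fits into a word ($k<2^w$), let $\lambda$ and $f$ be as above, and let $0<\epsilon\le\epsilon_0$. Given $T$, $n$, $k$, $\lambda$ and $\epsilon$, and the operation $f$, the program outputs the list of lengths of the parts of a $(1+\epsilon)$-optimal partition of $T$ with respect to the $k$-th order (respectively $k$-th order adaptive) compressor. It does so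 in at most $C\,n\log_{1+\epsilon}n$ time and $O(n)$ space: each of the finitely many arrays named by the program has $Cn$ cells, and $C$ does not depend on $T$, $k$, $\lambda$, $f$, $w$ or on $\epsilon\le\epsilon_0$. -/

import Mathlib

/-! ### Entropies -/

/-- Zeroth order empirical entropy, in bits per symbol:
`(1/|T|) * ∑_c n_c * log₂ (|T| / n_c)`, with `n_c` the number of occurrences of `c` in `T`. -/
noncomputable def empiricalEntropy {α : Type*} [Fintype α] [DecidableEq α] (T : List α) : ℝ :=
  (1 / (T.length : ℝ)) *
    ∑ c : α, (T.count c : ℝ) * Real.logb 2 ((T.length : ℝ) / (T.count c : ℝ))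

/-- Zeroth order adaptive empirical entropy:
`(1/|T|) * (log₂ (|T|!) - ∑_c log₂ (n_c!))`. -/
noncomputable def adaptiveEntropy {α : Type*} [Fintype α] [DecidableEq α] (T : List α) : ℝ :=
  (1 / (T.length : ℝ)) *
    (Real.logb 2 (T.length.factorial : ℝ) - ∑ c : α, Real.logb 2 ((T.count c).factorial : ℝ))

/-- The zeroth order entropy in use: adaptive or plain. -/
noncomputable def zerothEntropy {α : Type*} [Fintype α] [DecidableEq α]
    (adaptive : Bool) (T : List α) : ℝ :=
  if adaptive then adaptiveEntropy T else empiricalEntropy T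

/-- The string `u_T` of the single symbols that follow the occurrences of `u` in `T`,
taken from left to right. -/
def followers {α : Type*} [DecidableEq α] (u T : List α) : List α :=
  T.tails.filterMap (fun t => if u <+: t then t[u.length]? else none)

/-- Entropy of order `k` (plain or adaptive):
`(1/|T|) * ∑_{u ∈ Σ^k} |u_T| * H(u_T)` with `H` the entropy of order zero. -/
noncomputable def entropy {α : Type*} [Fintype α] [DecidableEq α]
    (adaptive : Bool) (k : ℕ) (T : List α) : ℝ :=
  (1 / (T.length : ℝ)) *
    ∑ u : Fin k → α, ((followers (List.ofFn u) T).length : ℝ) *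
      zerothEntropy adaptive (followers (List.ofFn u) T)

/-! ### Compression cost and partitions -/

/-- The entropy bound `lam * |u| * H_k(u) + f(|u|, σ_u)` on the compressed size of a string `u`
with `σ_u` distinct symbols. -/
noncomputable def compressedSize {α : Type*} [Fintype α] [DecidableEq α]
    (adaptive : Bool) (k : ℕ) (lam : ℝ) (f : ℕ → ℕ → ℝ) (u : List α) : ℝ :=
  lam * ((u.length : ℝ) * entropy adaptive k u) + f u.length u.toFinset.card

/-- The overhead `f(m, s)` of a compressor, for strings of length `m` with `s` distinct symbols
(so that `1 ≤ s ≤ m`), is nonnegative and nondecreasing in both arguments. -/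
def IsOverhead (f : ℕ → ℕ → ℝ) : Prop :=
  (∀ m s : ℕ, 1 ≤ s → s ≤ m → 0 ≤ f m s) ∧
  ∀ m s m' s' : ℕ, 1 ≤ s → s ≤ m → s' ≤ m' → m ≤ m' → s ≤ s' → f m s ≤ f m' s'

/-- `Q` is a partition of the text `T` into nonempty contiguous substrings. -/
def IsPartition {α : Type*} (T : List α) (Q : List (List α)) : Prop :=
  Q.flatten = T ∧ ∀ u ∈ Q, u ≠ []

/-- Cost of a partition: the sum of the compressed sizes of its parts. -/
noncomputable def partitionCost {α : Type*} [Fintype α] [DecidableEq α]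
    (adaptive : Bool) (k : ℕ) (lam : ℝ) (f : ℕ → ℕ → ℝ) (Q : List (List α)) : ℝ :=
  (Q.map (compressedSize adaptive k lam f)).sum

/-- `Q` is a partition of `T` whose cost is at most `1 + ε` times that of every partition. -/
def IsApproxOptimal {α : Type*} [Fintype α] [DecidableEq α]
    (adaptive : Bool) (k : ℕ) (lam : ℝ) (f : ℕ → ℕ → ℝ) (ε : ℝ)
    (T : List α) (Q : List (List α)) : Prop :=
  IsPartition T Q ∧ ∀ Q' : List (List α), IsPartition T Q' →
    partitionCost adaptive k lam f Q ≤ (1 + ε) * partitionCost adaptive k lam f Q'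

/-! ### The machine

A unit-cost random access machine. Integer cells hold words of `wordBits` bits; real cells hold
exact real numbers and admit arithmetic, comparison, conversion from words and logarithms of words,
but no conversion back to words. Evaluating the overhead function `f` on two words is one operation.
A program names finitely many scalar variables and finitely many arrays; each array has `cells`
cells, and a program that addresses a cell outside has no execution. Hence a program that runs with
`cells = O(n)` uses `O(n)` memory cells. -/

/-- Parameters of the machine. -/
structure Machine where
  wordBits : ℕ
  cells : ℕ
  f : ℕ → ℕ → ℝ

/-- Memory contents: word variables, word arrays, real variables, real arrays. -/
structure Store where
  wvar : ℕ → ℕ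
  warr : ℕ → ℕ → ℕ
  rvar : ℕ → ℝ
  rarr : ℕ → ℕ → ℝ

/-- Word expressions. -/
inductive WExp where
  | lit (m : ℕ)
  | var (x : ℕ)
  | arr (a : ℕ) (i : WExp)
  | add (e₁ e₂ : WExp)
  | sub (e₁ e₂ : WExp)
  | mul (e₁ e₂ : WExp)
  | div (e₁ e₂ : WExp)
  | mod (e₁ e₂ : WExp)

/-- Value of a word expression; results are reduced modulo `2 ^ wordBits`
(subtraction is truncated at `0`, and `x / 0 = 0`, `x % 0 = x`). -/
def WExp.eval (M : Machine) (s : Store) : WExp → ℕ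
  | .lit m => m % 2 ^ M.wordBits
  | .var x => s.wvar x
  | .arr a i => s.warr a (i.eval M s)
  | .add e₁ e₂ => (e₁.eval M s + e₂.eval M s) % 2 ^ M.wordBits
  | .sub e₁ e₂ => e₁.eval M s - e₂.eval M s
  | .mul e₁ e₂ => (e₁.eval M s * e₂.eval M s) % 2 ^ M.wordBits
  | .div e₁ e₂ => e₁.eval M s / e₂.eval M s
  | .mod e₁ e₂ => e₁.eval M s % e₂.eval M s

/-- All array accesses in the expression are within the memory. -/
def WExp.ok (M : Machine) (s : Store) : WExp → Prop
  | .lit _ => True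
  | .var _ => True
  | .arr _ i => i.ok M s ∧ i.eval M s < M.cells
  | .add e₁ e₂ => e₁.ok M s ∧ e₂.ok M s
  | .sub e₁ e₂ => e₁.ok M s ∧ e₂.ok M s
  | .mul e₁ e₂ => e₁.ok M s ∧ e₂.ok M s
  | .div e₁ e₂ => e₁.ok M s ∧ e₂.ok M s
  | .mod e₁ e₂ => e₁.ok M s ∧ e₂.ok M s

/-- Number of unit-cost operations in the expression. -/
def WExp.cost : WExp → ℕ
  | .lit _ => 1
  | .var _ => 1
  | .arr _ i => i.cost + 1
  | .add e₁ e₂ => e₁.cost + e₂.cost + 1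
  | .sub e₁ e₂ => e₁.cost + e₂.cost + 1
  | .mul e₁ e₂ => e₁.cost + e₂.cost + 1
  | .div e₁ e₂ => e₁.cost + e₂.cost + 1
  | .mod e₁ e₂ => e₁.cost + e₂.cost + 1

/-- Real expressions; `log₂ e` is the binary logarithm of a word, and `overhead e₁ e₂` is the value
of the overhead function at two words. -/
inductive RExp where
  | ofWord (e : WExp)
  | var (x : ℕ)
  | arr (a : ℕ) (i : WExp)
  | add (e₁ e₂ : RExp)
  | sub (e₁ e₂ : RExp)
  | mul (e₁ e₂ : RExp)
  | div (e₁ e₂ : RExp)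
  | log₂ (e : WExp)
  | overhead (e₁ e₂ : WExp)

/-- Value of a real expression. -/
noncomputable def RExp.eval (M : Machine) (s : Store) : RExp → ℝ
  | .ofWord e => (e.eval M s : ℝ)
  | .var x => s.rvar x
  | .arr a i => s.rarr a (i.eval M s)
  | .add e₁ e₂ => e₁.eval M s + e₂.eval M s
  | .sub e₁ e₂ => e₁.eval M s - e₂.eval M s
  | .mul e₁ e₂ => e₁.eval M s * e₂.eval M s
  | .div e₁ e₂ => e₁.eval M s / e₂.eval M s
  | .log₂ e => Real.logb 2 (e.eval M s : ℝ)
  | .overhead e₁ e₂ => M.f (e₁.eval M s) (e₂.eval M s)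

/-- All array accesses in the expression are within the memory. -/
def RExp.ok (M : Machine) (s : Store) : RExp → Prop
  | .ofWord e => e.ok M s
  | .var _ => True
  | .arr _ i => i.ok M s ∧ i.eval M s < M.cells
  | .add e₁ e₂ => e₁.ok M s ∧ e₂.ok M s
  | .sub e₁ e₂ => e₁.ok M s ∧ e₂.ok M s
  | .mul e₁ e₂ => e₁.ok M s ∧ e₂.ok M s
  | .div e₁ e₂ => e₁.ok M s ∧ e₂.ok M s
  | .log₂ e => e.ok M s
  | .overhead e₁ e₂ => e₁.ok M s ∧ e₂.ok M s

/-- Number of unit-cost operations in the expression. -/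
def RExp.cost : RExp → ℕ
  | .ofWord e => e.cost + 1
  | .var _ => 1
  | .arr _ i => i.cost + 1
  | .add e₁ e₂ => e₁.cost + e₂.cost + 1
  | .sub e₁ e₂ => e₁.cost + e₂.cost + 1
  | .mul e₁ e₂ => e₁.cost + e₂.cost + 1
  | .div e₁ e₂ => e₁.cost + e₂.cost + 1
  | .log₂ e => e.cost + 1
  | .overhead e₁ e₂ => e₁.cost + e₂.cost + 1

/-- Tests. -/
inductive BExp where
  | wlt (e₁ e₂ : WExp)
  | weq (e₁ e₂ : WExp)
  | rle (e₁ e₂ : RExp)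
  | neg (b : BExp)
  | conj (b₁ b₂ : BExp)

/-- Truth of a test. -/
def BExp.holds (M : Machine) (s : Store) : BExp → Prop
  | .wlt e₁ e₂ => e₁.eval M s < e₂.eval M s
  | .weq e₁ e₂ => e₁.eval M s = e₂.eval M s
  | .rle e₁ e₂ => e₁.eval M s ≤ e₂.eval M s
  | .neg b => ¬ b.holds M s
  | .conj b₁ b₂ => b₁.holds M s ∧ b₂.holds M s

/-- All array accesses in the test are within the memory. -/
def BExp.ok (M : Machine) (s : Store) : BExp → Prop
  | .wlt e₁ e₂ => e₁.ok M s ∧ e₂.ok M s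
  | .weq e₁ e₂ => e₁.ok M s ∧ e₂.ok M s
  | .rle e₁ e₂ => e₁.ok M s ∧ e₂.ok M s
  | .neg b => b.ok M s
  | .conj b₁ b₂ => b₁.ok M s ∧ b₂.ok M s

/-- Number of unit-cost operations in the test. -/
def BExp.cost : BExp → ℕ
  | .wlt e₁ e₂ => e₁.cost + e₂.cost + 1
  | .weq e₁ e₂ => e₁.cost + e₂.cost + 1
  | .rle e₁ e₂ => e₁.cost + e₂.cost + 1
  | .neg b => b.cost + 1
  | .conj b₁ b₂ => b₁.cost + b₂.cost + 1

/-- Programs. -/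
inductive Prog where
  | skip
  | setW (x : ℕ) (e : WExp)
  | setR (x : ℕ) (e : RExp)
  | storeW (a : ℕ) (i e : WExp)
  | storeR (a : ℕ) (i : WExp) (e : RExp)
  | seq (P₁ P₂ : Prog)
  | ite (b : BExp) (P₁ P₂ : Prog)
  | loop (b : BExp) (P : Prog)

/-- `Exec M P s t s'`: on machine `M`, program `P` started with memory `s` never leaves the memory,
halts after exactly `t` unit-cost operations, and leaves the memory `s'`. The command `loop b P`
repeats `P` as long as `b` holds. -/
inductive Exec (M : Machine) : Prog → Store → ℕ → Store → Prop where
  | skip (s : Store) : Exec M .skip s 1 s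
  | setW (s : Store) (x : ℕ) (e : WExp) (he : e.ok M s) :
      Exec M (.setW x e) s (e.cost + 1)
        { s with wvar := Function.update s.wvar x (e.eval M s) }
  | setR (s : Store) (x : ℕ) (e : RExp) (he : e.ok M s) :
      Exec M (.setR x e) s (e.cost + 1)
        { s with rvar := Function.update s.rvar x (e.eval M s) }
  | storeW (s : Store) (a : ℕ) (i e : WExp) (hi : i.ok M s) (he : e.ok M s)
      (hlt : i.eval M s < M.cells) :
      Exec M (.storeW a i e) s (i.cost + e.cost + 1)
        { s with warr :=
            Function.update s.warr a (Function.update (s.warr a) (i.eval M s) (e.eval M s)) }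
  | storeR (s : Store) (a : ℕ) (i : WExp) (e : RExp) (hi : i.ok M s) (he : e.ok M s)
      (hlt : i.eval M s < M.cells) :
      Exec M (.storeR a i e) s (i.cost + e.cost + 1)
        { s with rarr :=
            Function.update s.rarr a (Function.update (s.rarr a) (i.eval M s) (e.eval M s)) }
  | seq {P₁ P₂ : Prog} {s s₁ s₂ : Store} {t₁ t₂ : ℕ}
      (h₁ : Exec M P₁ s t₁ s₁) (h₂ : Exec M P₂ s₁ t₂ s₂) :
      Exec M (.seq P₁ P₂) s (t₁ + t₂) s₂
  | iteTrue {b : BExp} {P₁ P₂ : Prog} {s s₁ : Store} {t : ℕ} (hok : b.ok M s)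
      (hb : b.holds M s) (h : Exec M P₁ s t s₁) :
      Exec M (.ite b P₁ P₂) s (b.cost + t + 1) s₁
  | iteFalse {b : BExp} {P₁ P₂ : Prog} {s s₁ : Store} {t : ℕ} (hok : b.ok M s)
      (hb : ¬ b.holds M s) (h : Exec M P₂ s t s₁) :
      Exec M (.ite b P₁ P₂) s (b.cost + t + 1) s₁
  | loopTrue {b : BExp} {P : Prog} {s s₁ s₂ : Store} {t₁ t₂ : ℕ} (hok : b.ok M s)
      (hb : b.holds M s) (h₁ : Exec M P s t₁ s₁) (h₂ : Exec M (.loop b P) s₁ t₂ s₂) :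
      Exec M (.loop b P) s (b.cost + t₁ + t₂ + 1) s₂
  | loopFalse {b : BExp} {P : Prog} {s : Store} (hok : b.ok M s) (hb : ¬ b.holds M s) :
      Exec M (.loop b P) s (b.cost + 1) s

/-- Initial memory: the symbols of `T` are in word array `0`, its length in word variable `0`,
the order `k` in word variable `1`, and `lam`, `ε` in real variables `0`, `1`.
All other cells are `0`. -/
def inputStore {σ : ℕ} (T : List (Fin σ)) (k : ℕ) (lam ε : ℝ) : Store where
  wvar := fun x => if x = 0 then T.length else if x = 1 then k else 0
  warr := fun a i => if a = 0 then ((T[i]?).map Fin.val).getD 0 else 0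
  rvar := fun x => if x = 0 then lam else if x = 1 then ε else 0
  rarr := fun _ _ => 0

/-- The list written by a program: its length is in word variable `0`,
its entries are in word array `1`. -/
def Store.output (s : Store) : List ℕ := (List.range (s.wvar 0)).map (s.warr 1)

/-! Regard the positions 0, …, n as vertices and give the edge (i, j) the cost c(i, j) of the
substring [i, j); partitions are the paths from 0 to n. Two facts replace the quadratically many
edges by few. First, c is monotone under inclusion of windows (`edgeCost_mono`): up to the factor λ
its entropy part is ∑ g(count of a k-string) − ∑ g(count of a (k+1)-string), where g(t) is t log₂ t
or log₂ t!; g is convex, and the (k+1)-strings refine the k-strings (`windowSum_sub_mono`). Second,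
every edge costs at least u = f(1, 1), and the partition into single symbols costs n u. Hence only
costs from u to n u matter, and the thresholds u (1 + ε)^r for r = 0, …, R with R ≤ log_{1+ε} n + 1
cover them.

For each i and r it is enough to keep the longest edge from i of cost at most the r-th threshold,
with the threshold as its weight. An edge of a given path is replaced by the kept edge of the least
threshold that is not below its cost. This loses at most the factor 1 + ε and ends no earlier. Since
cutting a part off on the left does not raise its cost, the approximate path can stay ahead of the
given one (`dist_le_add_partitionCost`).

For fixed r the end of the kept edge only moves to the right as i grows, so there are O(n R)
extensions and shortenings of windows altogether. Each must take constant time, and linear space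
forbids separate counters for every level. If a position p enters on the right, the count of its
name in [i, p) is its rank among all occurrences minus a counter of the occurrences before i that
all levels share (`addPosition_runs`). If i leaves on the left, the count is a difference of the
ranks of i and of the last occurrence of its name before the end (`WalkAt.cnt_eq`). These last
occurrences are found for all levels in one walk: the ends of the windows cut the occurrences of a
name into runs whose first and last positions are linked, so that one jump per level suffices
(`WalkAt.move`). Moving an end by one position changes a bounded number of links (`RunLinks.split`,
`RunLinks.merge`).

The strings of length k and k + 1 are replaced by names of at most n, by doubling the length and
renaming pairs in linear time without sorting (`pairNames_runs`). This takes O(n log n) time, and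
log₂ n is O(log_{1+ε} n) because ε ≤ ε₀. If ε is so small that n thresholds do not reach n u, then n
< log_{1+ε} n, and relaxing all edges exactly in O(n²) time (`allEdges_runs`) is within the bound.
The cap on the number of thresholds also keeps the space linear. -/

/-! ### A program logic for the machine -/

/-- Number of words. -/
def Machine.words (M : Machine) : ℕ := 2 ^ M.wordBits

/-- Value of a word expression without reduction modulo the word size. -/
@[simp] def WExp.val (s : Store) : WExp → ℕ
  | .lit m => m
  | .var x => s.wvar x
  | .arr a i => s.warr a (i.val s)
  | .add e₁ e₂ => e₁.val s + e₂.val s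
  | .sub e₁ e₂ => e₁.val s - e₂.val s
  | .mul e₁ e₂ => e₁.val s * e₂.val s
  | .div e₁ e₂ => e₁.val s / e₂.val s
  | .mod e₁ e₂ => e₁.val s % e₂.val s

/-- All accesses are within the memory and there is no overflow. -/
@[simp] def WExp.good (M : Machine) (s : Store) : WExp → Prop
  | .lit m => m < M.words
  | .var _ => True
  | .arr _ i => i.good M s ∧ i.val s < M.cells
  | .add e₁ e₂ => e₁.good M s ∧ e₂.good M s ∧ e₁.val s + e₂.val s < M.words
  | .sub e₁ e₂ => e₁.good M s ∧ e₂.good M s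
  | .mul e₁ e₂ => e₁.good M s ∧ e₂.good M s ∧ e₁.val s * e₂.val s < M.words
  | .div e₁ e₂ => e₁.good M s ∧ e₂.good M s
  | .mod e₁ e₂ => e₁.good M s ∧ e₂.good M s

/-- With no wrap-around at any subexpression, evaluation modulo the word size is arithmetic of
natural numbers. All later reasoning uses `val` and `good`, which unfold to linear goals. -/
theorem WExp.good.spec {M : Machine} {s : Store} {e : WExp} (h : e.good M s) :
    e.ok M s ∧ e.eval M s = e.val s := by
  induction e with
  | lit m => exact ⟨trivial, Nat.mod_eq_of_lt h⟩
  | var x => exact ⟨trivial, rfl⟩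
  | arr a i ih =>
    obtain ⟨h₁, h₂⟩ := ih h.1
    exact ⟨⟨h₁, h₂ ▸ h.2⟩, by simp [WExp.eval, h₂]⟩
  | add e₁ e₂ ih₁ ih₂ =>
    obtain ⟨h₁, h₂⟩ := ih₁ h.1
    obtain ⟨h₃, h₄⟩ := ih₂ h.2.1
    exact ⟨⟨h₁, h₃⟩, by simp only [WExp.eval, h₂, h₄, WExp.val]; exact Nat.mod_eq_of_lt h.2.2⟩
  | mul e₁ e₂ ih₁ ih₂ =>
    obtain ⟨h₁, h₂⟩ := ih₁ h.1
    obtain ⟨h₃, h₄⟩ := ih₂ h.2.1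
    exact ⟨⟨h₁, h₃⟩, by simp only [WExp.eval, h₂, h₄, WExp.val]; exact Nat.mod_eq_of_lt h.2.2⟩
  | sub e₁ e₂ ih₁ ih₂ =>
    exact ⟨⟨(ih₁ h.1).1, (ih₂ h.2).1⟩, by simp [WExp.eval, (ih₁ h.1).2, (ih₂ h.2).2]⟩
  | div e₁ e₂ ih₁ ih₂ =>
    exact ⟨⟨(ih₁ h.1).1, (ih₂ h.2).1⟩, by simp [WExp.eval, (ih₁ h.1).2, (ih₂ h.2).2]⟩
  | mod e₁ e₂ ih₁ ih₂ =>
    exact ⟨⟨(ih₁ h.1).1, (ih₂ h.2).1⟩, by simp [WExp.eval, (ih₁ h.1).2, (ih₂ h.2).2]⟩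

/-- Value of a real expression whose word expressions do not overflow. -/
@[simp] noncomputable def RExp.val (M : Machine) (s : Store) : RExp → ℝ
  | .ofWord e => (e.val s : ℝ)
  | .var x => s.rvar x
  | .arr a i => s.rarr a (i.val s)
  | .add e₁ e₂ => e₁.val M s + e₂.val M s
  | .sub e₁ e₂ => e₁.val M s - e₂.val M s
  | .mul e₁ e₂ => e₁.val M s * e₂.val M s
  | .div e₁ e₂ => e₁.val M s / e₂.val M s
  | .log₂ e => Real.logb 2 (e.val s : ℝ)
  | .overhead e₁ e₂ => M.f (e₁.val s) (e₂.val s)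

/-- All accesses are within the memory and there is no overflow. -/
@[simp] def RExp.good (M : Machine) (s : Store) : RExp → Prop
  | .ofWord e => e.good M s
  | .var _ => True
  | .arr _ i => i.good M s ∧ i.val s < M.cells
  | .add e₁ e₂ => e₁.good M s ∧ e₂.good M s
  | .sub e₁ e₂ => e₁.good M s ∧ e₂.good M s
  | .mul e₁ e₂ => e₁.good M s ∧ e₂.good M s
  | .div e₁ e₂ => e₁.good M s ∧ e₂.good M s
  | .log₂ e => e.good M s
  | .overhead e₁ e₂ => e₁.good M s ∧ e₂.good M s

theorem RExp.good.spec {M : Machine} {s : Store} {e : RExp} (h : e.good M s) :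
    e.ok M s ∧ e.eval M s = e.val M s := by
  induction e with
  | ofWord e => exact ⟨(WExp.good.spec h).1, by simp [RExp.eval, (WExp.good.spec h).2]⟩
  | var x => exact ⟨trivial, rfl⟩
  | arr a i =>
    obtain ⟨h₁, h₂⟩ := WExp.good.spec h.1
    exact ⟨⟨h₁, h₂ ▸ h.2⟩, by simp [RExp.eval, h₂]⟩
  | log₂ e => exact ⟨(WExp.good.spec h).1, by simp [RExp.eval, (WExp.good.spec h).2]⟩
  | overhead e₁ e₂ =>
    obtain ⟨h₁, h₂⟩ := WExp.good.spec h.1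
    obtain ⟨h₃, h₄⟩ := WExp.good.spec h.2
    exact ⟨⟨h₁, h₃⟩, by simp [RExp.eval, h₂, h₄]⟩
  | add e₁ e₂ ih₁ ih₂ =>
    exact ⟨⟨(ih₁ h.1).1, (ih₂ h.2).1⟩, by simp [RExp.eval, (ih₁ h.1).2, (ih₂ h.2).2]⟩
  | mul e₁ e₂ ih₁ ih₂ =>
    exact ⟨⟨(ih₁ h.1).1, (ih₂ h.2).1⟩, by simp [RExp.eval, (ih₁ h.1).2, (ih₂ h.2).2]⟩
  | sub e₁ e₂ ih₁ ih₂ =>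
    exact ⟨⟨(ih₁ h.1).1, (ih₂ h.2).1⟩, by simp [RExp.eval, (ih₁ h.1).2, (ih₂ h.2).2]⟩
  | div e₁ e₂ ih₁ ih₂ =>
    exact ⟨⟨(ih₁ h.1).1, (ih₂ h.2).1⟩, by simp [RExp.eval, (ih₁ h.1).2, (ih₂ h.2).2]⟩

/-- Truth of a test whose word expressions do not overflow. -/
@[simp] def BExp.val (M : Machine) (s : Store) : BExp → Prop
  | .wlt e₁ e₂ => e₁.val s < e₂.val s
  | .weq e₁ e₂ => e₁.val s = e₂.val s
  | .rle e₁ e₂ => e₁.val M s ≤ e₂.val M s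
  | .neg b => ¬ b.val M s
  | .conj b₁ b₂ => b₁.val M s ∧ b₂.val M s

/-- All accesses are within the memory and there is no overflow. -/
@[simp] def BExp.good (M : Machine) (s : Store) : BExp → Prop
  | .wlt e₁ e₂ => e₁.good M s ∧ e₂.good M s
  | .weq e₁ e₂ => e₁.good M s ∧ e₂.good M s
  | .rle e₁ e₂ => e₁.good M s ∧ e₂.good M s
  | .neg b => b.good M s
  | .conj b₁ b₂ => b₁.good M s ∧ b₂.good M s

theorem BExp.good.spec {M : Machine} {s : Store} {b : BExp} (h : b.good M s) :
    b.ok M s ∧ (b.holds M s ↔ b.val M s) := by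
  induction b with
  | wlt e₁ e₂ =>
    exact ⟨⟨h.1.spec.1, h.2.spec.1⟩, by simp [BExp.holds, h.1.spec.2, h.2.spec.2]⟩
  | weq e₁ e₂ =>
    exact ⟨⟨h.1.spec.1, h.2.spec.1⟩, by simp [BExp.holds, h.1.spec.2, h.2.spec.2]⟩
  | rle e₁ e₂ =>
    exact ⟨⟨h.1.spec.1, h.2.spec.1⟩, by simp [BExp.holds, h.1.spec.2, h.2.spec.2]⟩
  | neg b ih => exact ⟨(ih h).1, not_congr (ih h).2⟩
  | conj b₁ b₂ ih₁ ih₂ =>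
    exact ⟨⟨(ih₁ h.1).1, (ih₂ h.2).1⟩, and_congr (ih₁ h.1).2 (ih₂ h.2).2⟩

/-- `Runs M P s Q`: the program halts from `s`, and `Q` holds of the time used and the memory
left. -/
def Runs (M : Machine) (P : Prog) (s : Store) (Q : ℕ → Store → Prop) : Prop :=
  ∃ t s', Exec M P s t s' ∧ Q t s'

theorem Runs.mono {M : Machine} {P : Prog} {s : Store} {Q Q' : ℕ → Store → Prop}
    (h : Runs M P s Q) (hQ : ∀ t s', Q t s' → Q' t s') : Runs M P s Q' := by
  obtain ⟨t, s', he, hq⟩ := h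
  exact ⟨t, s', he, hQ t s' hq⟩

theorem Runs.seq {M : Machine} {P₁ P₂ : Prog} {s : Store} {Q : ℕ → Store → Prop}
    (h : Runs M P₁ s fun t₁ s₁ => Runs M P₂ s₁ fun t₂ s₂ => Q (t₁ + t₂) s₂) :
    Runs M (.seq P₁ P₂) s Q := by
  obtain ⟨t₁, s₁, h₁, t₂, s₂, h₂, hq⟩ := h
  exact ⟨_, s₂, .seq h₁ h₂, hq⟩

theorem Runs.ite {M : Machine} {b : BExp} {P₁ P₂ : Prog} {s : Store} {Q : ℕ → Store → Prop}
    (hb : b.good M s)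
    (h₁ : b.val M s → Runs M P₁ s fun t s' => Q (b.cost + t + 1) s')
    (h₂ : ¬ b.val M s → Runs M P₂ s fun t s' => Q (b.cost + t + 1) s') :
    Runs M (.ite b P₁ P₂) s Q := by
  by_cases h : b.val M s
  · obtain ⟨t, s', he, hq⟩ := h₁ h
    exact ⟨_, s', .iteTrue hb.spec.1 (hb.spec.2.2 h) he, hq⟩
  · obtain ⟨t, s', he, hq⟩ := h₂ h
    exact ⟨_, s', .iteFalse hb.spec.1 (mt hb.spec.2.1 h) he, hq⟩

/-- Weakest precondition of a program without loops. -/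
@[simp] def Prog.wp (M : Machine) : Prog → (Store → Prop) → Store → Prop
  | .skip, Q, s => Q s
  | .setW x e, Q, s => e.good M s ∧ Q { s with wvar := Function.update s.wvar x (e.val s) }
  | .setR x e, Q, s => e.good M s ∧ Q { s with rvar := Function.update s.rvar x (e.val M s) }
  | .storeW a i e, Q, s => i.good M s ∧ e.good M s ∧ i.val s < M.cells ∧
      Q { s with warr :=
            Function.update s.warr a (Function.update (s.warr a) (i.val s) (e.val s)) }
  | .storeR a i e, Q, s => i.good M s ∧ e.good M s ∧ i.val s < M.cells ∧
      Q { s with rarr :=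
            Function.update s.rarr a (Function.update (s.rarr a) (i.val s) (e.val M s)) }
  | .seq P₁ P₂, Q, s => P₁.wp M (P₂.wp M Q) s
  | .ite b P₁ P₂, Q, s =>
      b.good M s ∧ (b.val M s → P₁.wp M Q s) ∧ (¬ b.val M s → P₂.wp M Q s)
  | .loop _ _, _, _ => False

/-- Bound on the time of a program without loops. -/
def Prog.bound : Prog → ℕ
  | .skip => 1
  | .setW _ e => e.cost + 1
  | .setR _ e => e.cost + 1
  | .storeW _ i e => i.cost + e.cost + 1
  | .storeR _ i e => i.cost + e.cost + 1
  | .seq P₁ P₂ => P₁.bound + P₂.bound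
  | .ite b P₁ P₂ => b.cost + (P₁.bound + P₂.bound) + 1
  | .loop _ _ => 0

/-- The time is bounded by the syntax alone: a conditional is charged for both branches, so no
bookkeeping of the path taken is needed. -/
theorem Prog.wp.runs {M : Machine} {P : Prog} {Q : Store → Prop} {s : Store} (h : P.wp M Q s) :
    Runs M P s fun t s' => t ≤ P.bound ∧ Q s' := by
  induction P generalizing Q s with
  | skip => exact ⟨_, _, .skip s, le_rfl, h⟩
  | setW x e =>
    refine ⟨_, _, .setW s x e h.1.spec.1, le_rfl, ?_⟩
    rw [h.1.spec.2]; exact h.2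
  | setR x e =>
    refine ⟨_, _, .setR s x e h.1.spec.1, le_rfl, ?_⟩
    rw [h.1.spec.2]; exact h.2
  | storeW a i e =>
    obtain ⟨h₁, h₂, h₃, h₄⟩ := h
    refine ⟨_, _, .storeW s a i e h₁.spec.1 h₂.spec.1 (h₁.spec.2 ▸ h₃), le_rfl, ?_⟩
    rw [h₁.spec.2, h₂.spec.2]; exact h₄
  | storeR a i e =>
    obtain ⟨h₁, h₂, h₃, h₄⟩ := h
    refine ⟨_, _, .storeR s a i e h₁.spec.1 h₂.spec.1 (h₁.spec.2 ▸ h₃), le_rfl, ?_⟩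
    rw [h₁.spec.2, h₂.spec.2]; exact h₄
  | seq P₁ P₂ ih₁ ih₂ =>
    refine Runs.seq ((ih₁ h).mono fun t s' hq => (ih₂ hq.2).mono fun t' s'' hq' => ?_)
    exact ⟨Nat.add_le_add hq.1 hq'.1, hq'.2⟩
  | ite b P₁ P₂ ih₁ ih₂ =>
    refine Runs.ite h.1 (fun hb => (ih₁ (h.2.1 hb)).mono fun t s' hq => ?_)
      (fun hb => (ih₂ (h.2.2 hb)).mono fun t s' hq => ?_)
    · exact ⟨by have := hq.1; simp only [Prog.bound]; omega, hq.2⟩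
    · exact ⟨by have := hq.1; simp only [Prog.bound]; omega, hq.2⟩
  | loop b P => exact h.elim

/-- Rule for loops: `I` is an invariant and `μ` bounds the remaining time. -/
theorem Runs.loop {M : Machine} {b : BExp} {P : Prog} (I : Store → Prop) (μ : Store → ℕ)
    (hb : ∀ s, I s → b.good M s)
    (hP : ∀ s, I s → b.val M s →
      Runs M P s fun t s' => I s' ∧ μ s' + t + (b.cost + 1) ≤ μ s)
    {s : Store} (hs : I s) :
    Runs M (.loop b P) s fun t s' => I s' ∧ ¬ b.val M s' ∧ t + μ s' ≤ μ s + (b.cost + 1) := by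
  -- Every round costs at least `b.cost + 1`, so the hypothesis on `μ` makes it strictly decrease;
  -- one inequality gives both termination and the time.
  induction hm : μ s using Nat.strong_induction_on generalizing s with
  | _ m ih =>
    subst hm
    by_cases h : b.val M s
    · obtain ⟨t₁, s₁, h₁, hI, ht⟩ := hP s hs h
      obtain ⟨t₂, s₂, h₂, hI₂, hn, ht₂⟩ := ih (μ s₁) (by omega) hI rfl
      refine ⟨_, s₂, .loopTrue (hb s hs).spec.1 ((hb s hs).spec.2.2 h) h₁ h₂, hI₂, hn, by omega⟩
    · exact ⟨_, s, .loopFalse (hb s hs).spec.1 (mt (hb s hs).spec.2.1 h), hs, h, by omega⟩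

/-- Rule for loops that count a variable up: `I p` is the invariant after `p` rounds. -/
theorem Runs.count {M : Machine} {b : BExp} {P : Prog} (I : ℕ → Store → Prop) (N c : ℕ)
    (hb : ∀ p s, p ≤ N → I p s → b.good M s ∧ (b.val M s ↔ p < N))
    (hP : ∀ p s, p < N → I p s → Runs M P s fun t s' => I (p + 1) s' ∧ t ≤ c)
    {s : Store} {p : ℕ} (hp : p ≤ N) (hs : I p s) :
    Runs M (.loop b P) s fun t s' => I N s' ∧ t ≤ (N - p + 1) * (c + b.cost + 1) := by
  induction hm : N - p generalizing s p with
  | zero =>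
    obtain rfl : p = N := by omega
    obtain ⟨h₁, h₂⟩ := hb p s hp hs
    exact ⟨_, s, .loopFalse h₁.spec.1 (by rw [h₁.spec.2, h₂]; omega), hs, by omega⟩
  | succ m ih =>
    obtain ⟨h₁, h₂⟩ := hb p s hp hs
    obtain ⟨t₁, s₁, e₁, hI, ht⟩ := hP p s (by omega) hs
    obtain ⟨t₂, s₂, e₂, hI₂, ht₂⟩ := ih (by omega) hI (by omega)
    exact ⟨_, s₂, .loopTrue h₁.spec.1 (by rw [h₁.spec.2, h₂]; omega) e₁ e₂, hI₂, by linarith⟩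

/-- Parts of the memory. -/
inductive Loc where
  | wvar (x : ℕ)
  | warr (a : ℕ)
  | rvar (x : ℕ)
  | rarr (a : ℕ)

/-- The program contains no assignment to the given part of the memory. -/
@[simp] def Prog.Keeps (l : Loc) : Prog → Prop
  | .skip => True
  | .setW x _ => l ≠ .wvar x
  | .setR x _ => l ≠ .rvar x
  | .storeW a _ _ => l ≠ .warr a
  | .storeR a _ _ => l ≠ .rarr a
  | .seq P₁ P₂ => P₁.Keeps l ∧ P₂.Keeps l
  | .ite _ P₁ P₂ => P₁.Keeps l ∧ P₂.Keeps l
  | .loop _ P => P.Keeps l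

/-- The two memories agree on the given part. -/
def Loc.Same (s s' : Store) : Loc → Prop
  | .wvar x => s'.wvar x = s.wvar x
  | .warr a => s'.warr a = s.warr a
  | .rvar x => s'.rvar x = s.rvar x
  | .rarr a => s'.rarr a = s.rarr a

theorem Loc.Same.trans {s s' s'' : Store} {l : Loc} (h : l.Same s s') (h' : l.Same s' s'') :
    l.Same s s'' := by
  cases l <;> exact Eq.trans h' h

/-- A frame rule read off the syntax: invariants need to mention only the cells that a program
assigns to. -/
theorem Exec.same {M : Machine} {P : Prog} {s s' : Store} {t : ℕ} (h : Exec M P s t s') {l : Loc}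
    (hl : P.Keeps l) : l.Same s s' := by
  induction h with
  | skip s => cases l <;> rfl
  | setW s x e he =>
    cases l <;> simp_all [Loc.Same]
  | setR s x e he =>
    cases l <;> simp_all [Loc.Same]
  | storeW s a i e =>
    cases l <;> simp_all [Loc.Same]
  | storeR s a i e =>
    cases l <;> simp_all [Loc.Same]
  | seq _ _ ih₁ ih₂ => exact (ih₁ hl.1).trans (ih₂ hl.2)
  | iteTrue _ _ _ ih => exact ih hl.1
  | iteFalse _ _ _ ih => exact ih hl.2
  | loopTrue _ _ _ _ ih₁ ih₂ => exact (ih₁ hl).trans (ih₂ hl)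
  | loopFalse => cases l <;> rfl

/-- `Frame P s s'`: the memory `s'` agrees with `s` on everything that `P` does not assign. -/
def Frame (P : Prog) (s s' : Store) : Prop := ∀ l, P.Keeps l → l.Same s s'

theorem Frame.wvar {P : Prog} {s s' : Store} (h : Frame P s s') (x : ℕ)
    (hx : P.Keeps (.wvar x)) : s'.wvar x = s.wvar x := h _ hx

theorem Frame.warr {P : Prog} {s s' : Store} (h : Frame P s s') (x : ℕ)
    (hx : P.Keeps (.warr x)) : s'.warr x = s.warr x := h _ hx

theorem Frame.rvar {P : Prog} {s s' : Store} (h : Frame P s s') (x : ℕ)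
    (hx : P.Keeps (.rvar x)) : s'.rvar x = s.rvar x := h _ hx

theorem Frame.rarr {P : Prog} {s s' : Store} (h : Frame P s s') (x : ℕ)
    (hx : P.Keeps (.rarr x)) : s'.rarr x = s.rarr x := h _ hx

theorem Runs.frame {M : Machine} {P : Prog} {s : Store} {Q : ℕ → Store → Prop}
    (h : Runs M P s Q) : Runs M P s fun t s' => Q t s' ∧ Frame P s s' := by
  obtain ⟨t, s', he, hq⟩ := h
  exact ⟨t, s', he, hq, fun _ hl => he.same hl⟩

/-! ### Counting in windows -/

section Windows

variable {β γ : Type*} [DecidableEq β] [DecidableEq γ]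

/-- Number of positions in `[l, r)` with the value `v`. -/
def cnt (a : ℕ → β) (l r : ℕ) (v : β) : ℕ := ((Finset.Ico l r).filter (a · = v)).card

theorem cnt_of_le {a : ℕ → β} {l r : ℕ} (h : r ≤ l) (v : β) : cnt a l r v = 0 := by
  simp [cnt, Finset.Ico_eq_empty_of_le h]

theorem cnt_succ_right {a : ℕ → β} {l r : ℕ} (h : l ≤ r) (v : β) :
    cnt a l (r + 1) v = cnt a l r v + if a r = v then 1 else 0 := by
  unfold cnt
  rw [← Finset.insert_Ico_right_eq_Ico_add_one h, Finset.filter_insert]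
  split_ifs
  · rw [Finset.card_insert_of_notMem (by simp)]
  · rfl

theorem cnt_succ_left {a : ℕ → β} {l r : ℕ} (h : l < r) (v : β) :
    cnt a l r v = cnt a (l + 1) r v + if a l = v then 1 else 0 := by
  unfold cnt
  rw [← Finset.insert_Ico_add_one_left_eq_Ico h, Finset.filter_insert]
  split_ifs
  · rw [Finset.card_insert_of_notMem (by simp)]
  · rfl

theorem cnt_add {a : ℕ → β} {l m r : ℕ} (h : l ≤ m) (h' : m ≤ r) (v : β) :
    cnt a l r v = cnt a l m v + cnt a m r v := by
  induction r, h' using Nat.le_induction with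
  | base => simp [cnt_of_le le_rfl]
  | succ r hr ih => rw [cnt_succ_right (h.trans hr), cnt_succ_right hr, ih]; ring

theorem cnt_congr {a : ℕ → β} {a' : ℕ → γ} {l r : ℕ} {v : β} {v' : γ}
    (h : ∀ p, l ≤ p → p < r → (a p = v ↔ a' p = v')) : cnt a l r v = cnt a' l r v' := by
  unfold cnt
  congr 1
  refine Finset.filter_congr fun p hp => ?_
  rw [Finset.mem_Ico] at hp
  exact h p hp.1 hp.2

theorem cnt_le_cnt {a : ℕ → β} {a' : ℕ → γ} {l r : ℕ} {v : β} {v' : γ}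
    (h : ∀ p, l ≤ p → p < r → a p = v → a' p = v') : cnt a l r v ≤ cnt a' l r v' := by
  refine Finset.card_le_card fun p hp => ?_
  simp only [Finset.mem_filter, Finset.mem_Ico] at hp ⊢
  exact ⟨hp.1, h p hp.1.1 hp.1.2 hp.2⟩

theorem cnt_le (a : ℕ → β) (l r : ℕ) (v : β) : cnt a l r v ≤ r - l :=
  (Finset.card_filter_le _ _).trans (by simp)

theorem cnt_eq_zero {a : ℕ → β} {l r : ℕ} {v : β} :
    cnt a l r v = 0 ↔ ∀ p, l ≤ p → p < r → a p ≠ v := by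
  simp [cnt, Finset.filter_eq_empty_iff]

/-- `∑_v g (n_v)` for the numbers `n_v` of occurrences in `[l, r)`, if `g 0 = 0`. -/
noncomputable def windowSum (g : ℕ → ℝ) (a : ℕ → β) (l r : ℕ) : ℝ :=
  ∑ p ∈ Finset.Ico l r, (g (cnt a l p (a p) + 1) - g (cnt a l p (a p)))

theorem windowSum_of_le (g : ℕ → ℝ) (a : ℕ → β) {l r : ℕ} (h : r ≤ l) :
    windowSum g a l r = 0 := by
  simp [windowSum, Finset.Ico_eq_empty_of_le h]

theorem windowSum_succ_right (g : ℕ → ℝ) (a : ℕ → β) {l r : ℕ} (h : l ≤ r) :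
    windowSum g a l (r + 1) =
      windowSum g a l r + (g (cnt a l r (a r) + 1) - g (cnt a l r (a r))) :=
  Finset.sum_Ico_succ_top h _

/-- The sum is built from left to right, but depends only on the final counts, so it can be peeled
from the left as well. In the induction the positions `l` and `r` interact only if their values
agree, and then their increments trade places. -/
theorem windowSum_succ_left (g : ℕ → ℝ) (a : ℕ → β) {l r : ℕ} (h : l < r) :
    windowSum g a l r =
      windowSum g a (l + 1) r + (g (cnt a (l + 1) r (a l) + 1) - g (cnt a (l + 1) r (a l))) := by
  induction r, Nat.succ_le_of_lt h using Nat.le_induction with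
  | base =>
    rw [windowSum_succ_right _ _ le_rfl, windowSum_of_le _ _ le_rfl, windowSum_of_le _ _ le_rfl,
      cnt_of_le le_rfl, cnt_of_le le_rfl]
  | succ r hr ih =>
    have hlr : l < r := hr
    rw [windowSum_succ_right _ _ hlr.le, windowSum_succ_right _ _ hr, ih hlr,
      cnt_succ_left hlr, cnt_succ_right (l := l + 1) hr]
    by_cases he : a l = a r
    · simp only [he, if_true]
    · simp only [he, Ne.symm he, if_false, add_zero]; ring

/-- Only the pattern of equalities matters; this allows integer names in place of strings. -/
theorem windowSum_congr (g : ℕ → ℝ) {a : ℕ → β} {a' : ℕ → γ} {l r : ℕ}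
    (h : ∀ p q, p < r → q < r → (a p = a q ↔ a' p = a' q)) :
    windowSum g a l r = windowSum g a' l r := by
  refine Finset.sum_congr rfl fun p hp => ?_
  rw [Finset.mem_Ico] at hp
  rw [cnt_congr (v := a p) (v' := a' p) fun q _ hq => h q p (by omega) hp.2]

/-- The increments telescope separately for every value; `g 0 = 0` silences the values that do not
occur. -/
theorem sum_cnt_eq_windowSum {ι : Type*} [Fintype ι] {φ : ι → β}
    (hφ : Function.Injective φ) {g : ℕ → ℝ} (hg : g 0 = 0) {a : ℕ → β} {l r : ℕ}
    (ha : ∀ p, l ≤ p → p < r → a p ∈ Set.range φ) :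
    ∑ v : ι, g (cnt a l r (φ v)) = windowSum g a l r := by
  classical
  rcases le_total r l with h | h
  · simp [windowSum_of_le g a h, cnt_of_le h, hg]
  induction r, h using Nat.le_induction with
  | base => simp [windowSum_of_le, cnt_of_le, hg]
  | succ r hr ih =>
    rw [windowSum_succ_right g a hr, ← ih fun p h₁ h₂ => ha p h₁ (by omega)]
    obtain ⟨w, hw⟩ := ha r hr (by omega)
    rw [← Finset.add_sum_erase _ _ (Finset.mem_univ w),
      ← Finset.add_sum_erase (a := w) _ (fun v => g (cnt a l r (φ v))) (Finset.mem_univ w),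
      cnt_succ_right hr, if_pos hw.symm, hw]
    have : ∀ v ∈ Finset.univ.erase w, g (cnt a l (r + 1) (φ v)) = g (cnt a l r (φ v)) := by
      intro v hv
      rw [cnt_succ_right hr, if_neg, add_zero]
      rw [← hw]
      exact fun h => Finset.ne_of_mem_erase hv (hφ h.symm)
    rw [Finset.sum_congr rfl this]
    ring

/-- Number of distinct values in `[l, r)`. -/
def distinct (a : ℕ → β) (l r : ℕ) : ℕ := ((Finset.Ico l r).image a).card

theorem distinct_le (a : ℕ → β) (l r : ℕ) : distinct a l r ≤ r - l :=
  Finset.card_image_le.trans (by simp)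

theorem distinct_pos (a : ℕ → β) {l r : ℕ} (h : l < r) : 1 ≤ distinct a l r :=
  Finset.card_pos.2 ((Finset.nonempty_Ico.2 h).image a)

theorem distinct_mono (a : ℕ → β) {l r l' r' : ℕ} (h : l' ≤ l) (h' : r ≤ r') :
    distinct a l r ≤ distinct a l' r' :=
  Finset.card_le_card (Finset.image_subset_image (Finset.Ico_subset_Ico h h'))

theorem distinct_of_le (a : ℕ → β) {l r : ℕ} (h : r ≤ l) : distinct a l r = 0 := by
  simp [distinct, Finset.Ico_eq_empty_of_le h]

theorem distinct_succ_right (a : ℕ → β) {l r : ℕ} (h : l ≤ r) :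
    distinct a l (r + 1) = distinct a l r + if cnt a l r (a r) = 0 then 1 else 0 := by
  unfold distinct
  rw [← Finset.insert_Ico_right_eq_Ico_add_one h, Finset.image_insert, Finset.card_insert_eq_ite]
  have : a r ∈ (Finset.Ico l r).image a ↔ ¬ cnt a l r (a r) = 0 := by
    rw [cnt_eq_zero]; simp; tauto
  by_cases hc : cnt a l r (a r) = 0
  · simp [this, hc]
  · simp [this, hc]

theorem distinct_succ_left (a : ℕ → β) {l r : ℕ} (h : l < r) :
    distinct a l r = distinct a (l + 1) r + if cnt a (l + 1) r (a l) = 0 then 1 else 0 := by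
  unfold distinct
  rw [← Finset.insert_Ico_add_one_left_eq_Ico h, Finset.image_insert, Finset.card_insert_eq_ite]
  have : a l ∈ (Finset.Ico (l + 1) r).image a ↔ ¬ cnt a (l + 1) r (a l) = 0 := by
    rw [cnt_eq_zero]
    simp only [Finset.mem_image, Finset.mem_Ico]
    push Not
    simp only [and_assoc]
  by_cases hc : cnt a (l + 1) r (a l) = 0
  · simp only [this, hc]; simp
  · simp only [this, hc]; simp

theorem distinct_congr {a : ℕ → β} {a' : ℕ → γ} {l r : ℕ}
    (h : ∀ p q, p < r → q < r → (a p = a q ↔ a' p = a' q)) : distinct a l r = distinct a' l r := by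
  rcases le_total r l with hlr | hlr
  · rw [distinct_of_le a hlr, distinct_of_le a' hlr]
  induction r, hlr using Nat.le_induction with
  | base => rw [distinct_of_le a le_rfl, distinct_of_le a' le_rfl]
  | succ r hr ih =>
    rw [distinct_succ_right a hr, distinct_succ_right a' hr,
      ih fun p q hp hq => h p q (by omega) (by omega),
      cnt_congr (v := a r) (v' := a' r) fun q _ hq => h q r (by omega) (by omega)]

end Windows

/-- `t log₂ t` or `log₂ t!`. -/
noncomputable def weight (adaptive : Bool) (t : ℕ) : ℝ :=
  if adaptive then Real.logb 2 (t.factorial : ℝ) else (t : ℝ) * Real.logb 2 (t : ℝ)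

theorem weight_zero (adaptive : Bool) : weight adaptive 0 = 0 := by
  cases adaptive <;> simp [weight]

theorem weight_true_succ (t : ℕ) :
    weight true (t + 1) = weight true t + Real.logb 2 ((t + 1 : ℕ) : ℝ) := by
  simp only [weight, if_true, Nat.factorial_succ]
  push_cast
  rw [Real.logb_mul (by positivity) (by positivity), add_comm]

theorem weight_false (t : ℕ) : weight false t = (t : ℝ) * Real.logb 2 (t : ℝ) := by
  simp [weight]

/-- Convexity of the weight. In the plain case it is convexity of `t log t` at the midpoint `t + 1`
of `t` and `t + 2`; in the adaptive case the increment is `log₂ (t + 1)`. -/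
theorem weight_increment_mono (adaptive : Bool) :
    Monotone fun t => weight adaptive (t + 1) - weight adaptive t := by
  refine monotone_nat_of_le_succ fun t => ?_
  cases adaptive
  · simp only [weight_false]
    have h := Real.convexOn_mul_log.2 (show (t : ℝ) ∈ Set.Ici 0 by simp)
      (show (t + 2 : ℝ) ∈ Set.Ici 0 by simp only [Set.mem_Ici]; positivity)
      (show (0 : ℝ) ≤ 1 / 2 by norm_num) (show (0 : ℝ) ≤ 1 / 2 by norm_num) (by norm_num)
    have he : (1 / 2 : ℝ) • (t : ℝ) + (1 / 2 : ℝ) • (t + 2 : ℝ) = t + 1 := by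
      simp only [smul_eq_mul]; ring
    rw [he] at h
    simp only [smul_eq_mul] at h
    have hl : 0 < Real.log 2 := Real.log_pos (by norm_num)
    simp only [Real.logb, ← mul_div_assoc, div_sub_div_same]
    push_cast
    refine div_le_div_of_nonneg_right ?_ hl.le
    rw [show (t : ℝ) + 1 + 1 = t + 2 by ring]
    linarith
  · simp only [weight_true_succ]
    have : Real.logb 2 ((t + 1 : ℕ) : ℝ) ≤ Real.logb 2 ((t + 1 + 1 : ℕ) : ℝ) :=
      Real.logb_le_logb_of_le (by norm_num) (by positivity) (by push_cast; linarith)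
    linarith

/-! ### Monotonicity of the cost of a window -/

section EdgeCost

variable {β γ δ : Type*} [DecidableEq β] [DecidableEq γ] [DecidableEq δ]

/-- Cost of the substring `[i, j)`, where `x` names the strings of length `k`, `y` those of length
`k + 1`, and `z` the symbols. -/
noncomputable def edgeCost (g : ℕ → ℝ) (k : ℕ) (lam : ℝ) (f : ℕ → ℕ → ℝ)
    (x : ℕ → β) (y : ℕ → γ) (z : ℕ → δ) (i j : ℕ) : ℝ :=
  lam * (windowSum g x i (j - k) - windowSum g y i (j - k)) + f (j - i) (distinct z i j)

/-- A new position raises the two sums by the increments of `g` at the counts of its `x`-value and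
of its `y`-value. Since `y` refines `x`, the latter count is not larger, and by convexity the
difference does not fall. The argument is the same at either end of the window. -/
theorem windowSum_sub_mono {g : ℕ → ℝ} (hg : Monotone fun t => g (t + 1) - g t)
    {x : ℕ → β} {y : ℕ → γ} (hxy : ∀ p q, y p = y q → x p = x q) {l r l' r' : ℕ}
    (hl : l' ≤ l) (hr : r ≤ r') :
    windowSum g x l r - windowSum g y l r ≤ windowSum g x l' r' - windowSum g y l' r' := by
  have h₁ : ∀ l r, windowSum g x l r - windowSum g y l r ≤
      windowSum g x l (r + 1) - windowSum g y l (r + 1) := by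
    intro l r
    rcases le_or_gt l r with h | h
    · rw [windowSum_succ_right g x h, windowSum_succ_right g y h]
      have := hg (cnt_le_cnt (a := y) (a' := x) (l := l) (r := r) (v := y r) (v' := x r)
        fun p _ _ => hxy p r)
      simp only at this
      linarith
    · simp [windowSum_of_le g _ h.le, windowSum_of_le g _ (Nat.succ_le_of_lt h)]
  have h₂ : ∀ l r, windowSum g x (l + 1) r - windowSum g y (l + 1) r ≤
      windowSum g x l r - windowSum g y l r := by
    intro l r
    rcases lt_or_ge l r with h | h
    · rw [windowSum_succ_left g x h, windowSum_succ_left g y h]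
      have := hg (cnt_le_cnt (a := y) (a' := x) (l := l + 1) (r := r) (v := y l) (v' := x l)
        fun p _ _ => hxy p l)
      simp only at this
      linarith
    · simp [windowSum_of_le g _ h, windowSum_of_le g _ (h.trans (Nat.le_succ l))]
  have h₃ : Monotone fun r => windowSum g x l r - windowSum g y l r :=
    monotone_nat_of_le_succ (h₁ l)
  have h₄ : Antitone fun l => windowSum g x l r' - windowSum g y l r' :=
    antitone_nat_of_succ_le fun l => h₂ l r'
  exact (h₃ hr).trans (h₄ hl)

variable {g : ℕ → ℝ} {k : ℕ} {lam : ℝ} {f : ℕ → ℕ → ℝ} {x : ℕ → β} {y : ℕ → γ} {z : ℕ → δ}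

/-- The property on which the whole method rests. The smaller window must be nonempty, because `f`
is controlled only for `1 ≤ s ≤ m`. -/
theorem edgeCost_mono (hg : Monotone fun t => g (t + 1) - g t) (hlam : 0 ≤ lam)
    (hf : IsOverhead f) (hxy : ∀ p q, y p = y q → x p = x q) {i j i' j' : ℕ}
    (hi : i' ≤ i) (hij : i < j) (hj : j ≤ j') :
    edgeCost g k lam f x y z i j ≤ edgeCost g k lam f x y z i' j' :=
  add_le_add
    (mul_le_mul_of_nonneg_left (windowSum_sub_mono hg hxy hi (Nat.sub_le_sub_right hj k)) hlam)
    (hf.2 _ _ _ _ (distinct_pos z hij) (distinct_le z i j) (distinct_le z i' j') (by omega)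
      (distinct_mono z hi hj))

/-- A single symbol has no entropy: for `k = 0` both sums run over one position and cancel, and for
`k > 0` both are empty. -/
theorem edgeCost_succ (i : ℕ) : edgeCost g k lam f x y z i (i + 1) = f 1 1 := by
  have hd : distinct z i (i + 1) = 1 := by simp [distinct]
  have hw : windowSum g x i (i + 1 - k) - windowSum g y i (i + 1 - k) = 0 := by
    rcases Nat.eq_zero_or_pos k with rfl | hk
    · simp [windowSum, cnt_of_le]
    · rw [windowSum_of_le g x (by omega), windowSum_of_le g y (by omega), sub_zero]
  rw [edgeCost, hd, hw, mul_zero, zero_add, Nat.add_sub_cancel_left]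

theorem edgeCost_congr {β' γ' δ' : Type*} [DecidableEq β'] [DecidableEq γ'] [DecidableEq δ']
    {x' : ℕ → β'} {y' : ℕ → γ'} {z' : ℕ → δ'} {n : ℕ}
    (hx : ∀ p q, p < n - k → q < n - k → (x p = x q ↔ x' p = x' q))
    (hy : ∀ p q, p < n - k → q < n - k → (y p = y q ↔ y' p = y' q))
    (hz : ∀ p q, p < n → q < n → (z p = z q ↔ z' p = z' q)) {i j : ℕ} (hj : j ≤ n) :
    edgeCost g k lam f x y z i j = edgeCost g k lam f x' y' z' i j := by
  unfold edgeCost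
  rw [windowSum_congr g fun p q hp hq => hx p q (by omega) (by omega),
    windowSum_congr g fun p q hp hq => hy p q (by omega) (by omega),
    distinct_congr fun p q hp hq => hz p q (by omega) (by omega)]

end EdgeCost

/-! ### The compression cost as a window function -/

section Bridge

variable {α : Type*}

/-- The substring `[i, j)`. -/
def piece (T : List α) (i j : ℕ) : List α := (T.drop i).take (j - i)

theorem piece_length {T : List α} {i j : ℕ} (hj : j ≤ T.length) :
    (piece T i j).length = j - i := by
  simp [piece]; omega

theorem piece_cons {T : List α} {i j : ℕ} (hij : i < j) (hj : j ≤ T.length) :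
    piece T i j = T[i] :: piece T (i + 1) j := by
  unfold piece
  rw [List.drop_eq_getElem_cons (by omega), show j - i = (j - (i + 1)) + 1 by omega,
    List.take_succ_cons]

variable [DecidableEq α]

/-- The common shape of the two entropies. In the plain case the logarithm of the quotient is split
and the counts add up to the length. -/
theorem length_mul_zerothEntropy [Fintype α] (adaptive : Bool) (u : List α) :
    (u.length : ℝ) * zerothEntropy adaptive u =
      weight adaptive u.length - ∑ c : α, weight adaptive (u.count c) := by
  rcases Nat.eq_zero_or_pos u.length with h | h
  · have : u = [] := List.length_eq_zero_iff.1 h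
    subst this
    simp [weight_zero]
  have h' : (u.length : ℝ) ≠ 0 := by positivity
  cases adaptive
  · simp only [zerothEntropy, empiricalEntropy, weight_false]
    rw [if_neg (by simp), ← mul_assoc, mul_one_div_cancel h', one_mul]
    have hs : ((u.length : ℕ) : ℝ) = ∑ c : α, (u.count c : ℝ) := by
      have := Multiset.sum_count_eq_card (s := Finset.univ) (m := (u : Multiset α))
        fun a _ => Finset.mem_univ a
      simp only [Multiset.coe_count, Multiset.coe_card] at this
      exact_mod_cast this.symm
    have : (u.length : ℝ) * Real.logb 2 u.length =
        ∑ c : α, (u.count c : ℝ) * Real.logb 2 u.length := by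
      rw [← Finset.sum_mul, ← hs]
    rw [this, ← Finset.sum_sub_distrib]
    refine Finset.sum_congr rfl fun c _ => ?_
    rcases Nat.eq_zero_or_pos (u.count c) with hc | hc
    · simp [hc]
    · rw [Real.logb_div h' (by positivity), mul_sub]
  · simp only [zerothEntropy, adaptiveEntropy, weight, if_true]
    rw [← mul_assoc, mul_one_div_cancel h', one_mul]

theorem followers_cons (x u : List α) (a : α) :
    followers x (a :: u) =
      (if x <+: a :: u then ((a :: u)[x.length]?).toList else []) ++ followers x u := by
  unfold followers
  rw [List.tails_cons, List.filterMap_cons]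
  split_ifs with h
  · cases (a :: u)[x.length]? <;> simp
  · simp

/-- An occurrence of `x` at `p` has a follower inside `[i, j)` exactly if `p + |x| < j`; hence the
window `[i, j - |x|)`. Before that bound the substring and the text show the same symbols, so the
occurrences can be read off the text. -/
theorem followers_piece (T : List α) {x : List α} {j : ℕ} (hj : j ≤ T.length) (i : ℕ) :
    (followers x (piece T i j)).length =
      cnt (fun p => (T.drop p).take x.length) i (j - x.length) x ∧
    ∀ c, (followers x (piece T i j)).count c =
      cnt (fun p => (T.drop p).take (x.length + 1)) i (j - x.length) (x ++ [c]) := by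
  rcases le_total j i with h | h
  · have : piece T i j = [] := by simp [piece, Nat.sub_eq_zero_of_le h]
    rw [this, cnt_of_le (by omega)]
    refine ⟨?_, fun c => ?_⟩
    · simp [followers]
    · rw [cnt_of_le (by omega)]; simp [followers]
  induction h using Nat.decreasingInduction with
  | self =>
    have : piece T j j = [] := by simp [piece]
    rw [this, cnt_of_le (by omega)]
    refine ⟨?_, fun c => ?_⟩
    · simp [followers]
    · rw [cnt_of_le (by omega)]; simp [followers]
  | of_succ i hi ih =>
    have hp := piece_cons hi hj
    rw [hp, followers_cons, ← hp]
    rcases lt_or_ge i (j - x.length) with hx | hx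
    · have hget : (piece T i j)[x.length]? = some T[i + x.length] := by
        simp only [piece]
        rw [List.getElem?_take_of_lt (by omega), List.getElem?_drop, List.getElem?_eq_getElem]
      have hpre : x <+: piece T i j ↔ (T.drop i).take x.length = x := by
        rw [List.prefix_iff_eq_take, piece, List.take_take, min_eq_left (by omega), eq_comm]
      have htake : (T.drop i).take (x.length + 1) =
          (T.drop i).take x.length ++ [T[i + x.length]] := by
        rw [List.take_add_one, List.getElem?_drop, List.getElem?_eq_getElem]; rfl
      rw [cnt_succ_left hx, hget]
      refine ⟨?_, fun c => ?_⟩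
      · rw [List.length_append, ih.1]
        by_cases h : x <+: piece T i j
        · simp [h, hpre.1 h, add_comm]
        · simp [h, mt hpre.2 h]
      · rw [cnt_succ_left hx, List.count_append, ih.2]
        have : ((T.drop i).take (x.length + 1) = x ++ [c]) ↔
            (x <+: piece T i j ∧ T[i + x.length] = c) := by
          rw [htake, hpre]
          constructor
          · intro h; have := List.append_inj' h rfl; simpa using this
          · rintro ⟨h₁, h₂⟩; rw [h₁, h₂]
        by_cases h : x <+: piece T i j <;> by_cases hc : T[i + x.length] = c <;>
          simp [this, h, hc, add_comm]
    · have hn : (piece T i j)[x.length]? = none := by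
        rw [List.getElem?_eq_none]; rw [piece_length hj]; omega
      rw [hn]
      have := ih
      rw [cnt_of_le (by omega)] at this
      rw [cnt_of_le (by omega)]
      refine ⟨by simp [this.1], fun c => ?_⟩
      have h₂ := this.2 c
      rw [cnt_of_le (by omega)] at h₂
      rw [cnt_of_le (by omega)]
      rw [List.count_append, h₂]
      simp

/-- The factor `1/|u|` cancels. The contexts contribute the counts of the `k`-strings, and the pairs
of a context and its follower, through the injection `(u, c) ↦ u ++ [c]`, those of the
`(k+1)`-strings. -/
theorem entropy_piece [Fintype α] (adaptive : Bool) (k : ℕ) (T : List α) {i j : ℕ} (hij : i < j)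
    (hj : j ≤ T.length) :
    ((piece T i j).length : ℝ) * entropy adaptive k (piece T i j) =
      windowSum (weight adaptive) (fun p => (T.drop p).take k) i (j - k) -
        windowSum (weight adaptive) (fun p => (T.drop p).take (k + 1)) i (j - k) := by
  have hpos : ((piece T i j).length : ℝ) ≠ 0 := by
    rw [piece_length hj, Nat.cast_ne_zero]; omega
  rw [entropy, ← mul_assoc, mul_one_div_cancel hpos, one_mul]
  simp only [length_mul_zerothEntropy]
  rw [Finset.sum_sub_distrib]
  have hlen : ∀ p, p < j - k → ((T.drop p).take k).length = k := by
    intro p hp; simp; omega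
  congr 1
  · rw [← sum_cnt_eq_windowSum (φ := fun u : Fin k → α => List.ofFn u) List.ofFn_injective
      (weight_zero adaptive)]
    · refine Finset.sum_congr rfl fun u _ => ?_
      rw [(followers_piece T hj i).1]
      simp only [List.length_ofFn]
    · intro p _ hp
      refine ⟨fun q => ((T.drop p).take k)[q]'(by rw [hlen p hp]; exact q.2), ?_⟩
      refine List.ext_getElem (by simp [hlen p hp]) fun q h₁ h₂ => ?_
      simp
  · rw [← Fintype.sum_prod_type' (f := fun (u : Fin k → α) (c : α) =>
        weight adaptive ((followers (List.ofFn u) (piece T i j)).count c)),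
      ← sum_cnt_eq_windowSum (φ := fun u : (Fin k → α) × α => List.ofFn u.1 ++ [u.2]) ?_
      (weight_zero adaptive)]
    · refine Finset.sum_congr rfl fun u _ => ?_
      rw [(followers_piece T hj i).2]
      simp only [List.length_ofFn]
    · intro p _ hp
      refine ⟨(fun q => ((T.drop p).take k)[q]'(by rw [hlen p hp]; exact q.2), T[p + k]), ?_⟩
      rw [List.take_add_one, List.getElem?_drop, List.getElem?_eq_getElem (by omega)]
      simp only [Option.toList_some]
      congr 1
      refine List.ext_getElem (by simp [hlen p hp]) fun q h₁ h₂ => ?_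
      simp
    · rintro ⟨u, c⟩ ⟨u', c'⟩ h
      have := List.append_inj' h rfl
      simp only [List.cons.injEq, and_true] at this
      rw [List.ofFn_injective this.1, this.2]

/-- Symbols are treated as strings of length one, so that the naming of substrings serves for them
too. -/
theorem toFinset_piece_card (T : List α) {i j : ℕ} (hij : i ≤ j) (hj : j ≤ T.length) :
    (piece T i j).toFinset.card = distinct (fun p => (T.drop p).take 1) i j := by
  induction hij using Nat.decreasingInduction with
  | self => rw [distinct_of_le _ le_rfl]; simp [piece]
  | of_succ i hi ih =>
    rw [piece_cons hi hj, List.toFinset_cons, Finset.card_insert_eq_ite, ih,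
      distinct_succ_left _ hi]
    have : T[i] ∈ (piece T (i + 1) j).toFinset ↔
        ¬ cnt (fun p => (T.drop p).take 1) (i + 1) j ((T.drop i).take 1) = 0 := by
      rw [cnt_eq_zero]
      push Not
      rw [List.mem_toFinset, List.mem_iff_getElem]
      constructor
      · rintro ⟨q, hq, he⟩
        rw [piece_length hj] at hq
        refine ⟨i + 1 + q, by omega, by omega, ?_⟩
        simp only [piece, List.getElem_take, List.getElem_drop] at he
        simp only [List.take_one_drop_eq_of_lt_length (show i + 1 + q < T.length by omega),
          List.take_one_drop_eq_of_lt_length (show i < T.length by omega), List.get_eq_getElem, he]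
      · rintro ⟨p, hp, hpj, he⟩
        simp only [List.take_one_drop_eq_of_lt_length (show p < T.length by omega),
          List.take_one_drop_eq_of_lt_length (show i < T.length by omega)] at he
        refine ⟨p - (i + 1), by rw [piece_length hj]; omega, ?_⟩
        simp only [piece, List.getElem_take, List.getElem_drop]
        simp only [List.cons.injEq, and_true, List.get_eq_getElem] at he
        simp only [Nat.add_sub_cancel' hp, he]
    by_cases hc : cnt (fun p => (T.drop p).take 1) (i + 1) j ((T.drop i).take 1) = 0
    · simp only [this, hc]; simp
    · simp only [this, hc]; simp

theorem compressedSize_piece [Fintype α] (adaptive : Bool) (k : ℕ) (lam : ℝ) (f : ℕ → ℕ → ℝ)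
    (T : List α) {i j : ℕ} (hij : i < j) (hj : j ≤ T.length) :
    compressedSize adaptive k lam f (piece T i j) =
      edgeCost (weight adaptive) k lam f (fun p => (T.drop p).take k)
        (fun p => (T.drop p).take (k + 1)) (fun p => (T.drop p).take 1) i j := by
  rw [compressedSize, entropy_piece adaptive k T hij hj, toFinset_piece_card T hij.le hj,
    piece_length hj, edgeCost]

end Bridge

/-! ### Approximate shortest paths give approximately optimal partitions -/

section Partitions

variable {α : Type*} [Fintype α] [DecidableEq α] {adaptive : Bool} {k : ℕ} {lam ε b : ℝ}
  {f : ℕ → ℕ → ℝ} {T : List α} {c : ℕ → ℕ → ℝ} {d : ℕ → ℝ}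

theorem piece_append_drop {β : Type*} {T : List β} {i j : ℕ} (hij : i ≤ j) :
    piece T i j ++ T.drop j = T.drop i := by
  rw [piece, show T.drop j = (T.drop i).drop (j - i) by rw [List.drop_drop]; congr 1; omega,
    List.take_append_drop]

/-- The approximate path stays ahead: while the given partition has come to `i`, it is at some `x ≥
i`. A part that ends at or before `x` costs it nothing. Otherwise the remainder of the part from `x`
on is no dearer than the part by `hmono`, and `hcov` leads from `x` to a vertex that is again not
behind. The bound `b` on the whole partition bounds each part, since costs are nonnegative. -/
theorem dist_le_add_partitionCost
    (hc : ∀ i j, i < j → j ≤ T.length → compressedSize adaptive k lam f (piece T i j) = c i j)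
    (hmono : ∀ i j i', i' ≤ i → i < j → j ≤ T.length → c i j ≤ c i' j)
    (hpos : ∀ i j, i < j → j ≤ T.length → 0 ≤ c i j) (hε : 0 ≤ ε)
    (hcov : ∀ i j, i < j → j ≤ T.length → c i j ≤ b →
      ∃ j', j ≤ j' ∧ j' ≤ T.length ∧ d j' ≤ d i + (1 + ε) * c i j)
    (Q : List (List α)) (i x : ℕ) (hQ : Q.flatten = T.drop i) (hne : ∀ u ∈ Q, u ≠ [])
    (hb : partitionCost adaptive k lam f Q ≤ b) (hi : i ≤ x) (hx : x ≤ T.length) :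
    0 ≤ partitionCost adaptive k lam f Q ∧
      d T.length ≤ d x + (1 + ε) * partitionCost adaptive k lam f Q := by
  induction Q generalizing i x with
  | nil =>
    have : T.length ≤ i := by
      rw [List.flatten_nil] at hQ; exact List.drop_eq_nil_iff.1 hQ.symm
    have : x = T.length := by omega
    simp [partitionCost, this]
  | cons u Q ih =>
    rw [List.flatten_cons] at hQ
    have hu : u.length ≠ 0 := by
      have := hne u (by simp); simpa [List.length_eq_zero_iff] using this
    have hl := congrArg List.length hQ
    rw [List.length_append, List.length_drop] at hl
    have hu' : u = piece T i (i + u.length) := by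
      rw [piece, ← hQ, Nat.add_sub_cancel_left, List.take_left']
      rfl
    have hQ' : Q.flatten = T.drop (i + u.length) := by
      rw [← List.drop_drop, ← hQ, List.drop_left]
    have hcu : compressedSize adaptive k lam f u = c i (i + u.length) := by
      rw [← hc i _ (by omega) (by omega), ← hu']
    have hcost : partitionCost adaptive k lam f (u :: Q) =
        c i (i + u.length) + partitionCost adaptive k lam f Q := by
      simp [partitionCost, hcu]
    have hp := hpos i (i + u.length) (by omega) (by omega)
    have ih' := fun x => ih (i + u.length) x hQ' (fun v hv => hne v (by simp [hv])) (by linarith)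
    have h0 := (ih' T.length (by omega) le_rfl).1
    rw [hcost]
    refine ⟨by linarith, ?_⟩
    rcases le_or_gt (i + u.length) x with h | h
    · have := (ih' x h hx).2
      nlinarith
    · have hm := hmono x (i + u.length) i hi h (by omega)
      obtain ⟨j', h₁, h₂, h₃⟩ := hcov x (i + u.length) h (by omega) (by linarith)
      have := (ih' j' h₁ h₂).2
      nlinarith

/-- Partitions of cost at most `b` are handled by `dist_le_add_partitionCost`. A dearer one is
beaten outright, as the distance of the end is at most `b`. -/
theorem isApproxOptimal_of_dist
    (hc : ∀ i j, i < j → j ≤ T.length → compressedSize adaptive k lam f (piece T i j) = c i j)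
    (hmono : ∀ i j i', i' ≤ i → i < j → j ≤ T.length → c i j ≤ c i' j)
    (hpos : ∀ i j, i < j → j ≤ T.length → 0 ≤ c i j) (hε : 0 ≤ ε)
    (hcov : ∀ i j, i < j → j ≤ T.length → c i j ≤ b →
      ∃ j', j ≤ j' ∧ j' ≤ T.length ∧ d j' ≤ d i + (1 + ε) * c i j)
    (hd : d 0 = 0) (hdb : d T.length ≤ b) {Q : List (List α)} (hQ : Q.flatten = T)
    (hne : ∀ u ∈ Q, u ≠ []) (hQd : partitionCost adaptive k lam f Q ≤ d T.length) :
    IsApproxOptimal adaptive k lam f ε T Q := by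
  refine ⟨⟨hQ, hne⟩, fun Q' hQ' => hQd.trans ?_⟩
  have key := dist_le_add_partitionCost hc hmono hpos hε hcov
  rcases le_or_gt (partitionCost adaptive k lam f Q') b with h | h
  · have := (key Q' 0 0 (by simpa using hQ'.1) hQ'.2 h le_rfl (Nat.zero_le _)).2
    rwa [hd, zero_add] at this
  · have h0 : 0 ≤ partitionCost adaptive k lam f Q :=
      (key Q 0 0 (by simpa using hQ) hne (hQd.trans hdb) le_rfl (Nat.zero_le _)).1
    nlinarith

end Partitions

/-! ### Runs of equal values between boundaries -/

/-- On `[0, m)`, `pv p` is one more than the previous position with the value of `p`, or `0`, and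
`nx p` is the next position with that value, or is at least `m`. -/
structure Linked (a : ℕ → ℕ) (m : ℕ) (pv nx : ℕ → ℕ) : Prop where
  pv_le : ∀ p < m, pv p ≤ p
  pv_eq : ∀ p < m, ∀ q, pv p = q + 1 → a q = a p
  lt_pv : ∀ p < m, ∀ q < p, a q = a p → q < pv p
  lt_nx : ∀ p < m, p < nx p
  nx_eq : ∀ p < m, nx p < m → a (nx p) = a p
  nx_le : ∀ p < m, ∀ q, p < q → q < m → a q = a p → nx p ≤ q

/-- The positions in `[i, m)` with some value that lie between two neighbouring boundaries
start at `p` and end at `q`. A boundary `x` lies between the positions `x - 1` and `x`. -/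
structure IsRun (a : ℕ → ℕ) (i m : ℕ) (B : ℕ → Prop) (p q : ℕ) : Prop where
  le_fst : i ≤ p
  le : p ≤ q
  lt : q < m
  eq : a q = a p
  nob : ∀ x, p < x → x ≤ q → ¬ B x
  fst : ∀ p', i ≤ p' → p' < p → a p' = a p → ∃ x, p' < x ∧ x ≤ p ∧ B x
  lst : ∀ q', q < q' → q' < m → a q' = a p → ∃ x, q < x ∧ x ≤ q' ∧ B x

/-- `L` maps the first position of each run to the last one, and `F` the last one to the first. -/
def RunLinks (a : ℕ → ℕ) (i m : ℕ) (B : ℕ → Prop) (F L : ℕ → ℕ) : Prop :=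
  ∀ p q, IsRun a i m B p q → L p = q ∧ F q = p

/-! ### Effect of a new or removed boundary on the runs -/

section RunLinks

variable {a pv nx F L : ℕ → ℕ} {i m p q : ℕ} {B B' : ℕ → Prop}

/-- The run ends at the greatest position of the same value that no boundary separates from `p`. -/
theorem exists_isRun_of_fst (hi : i ≤ p) (hp : p < m)
    (hf : ∀ p', i ≤ p' → p' < p → a p' = a p → ∃ x, p' < x ∧ x ≤ p ∧ B x) :
    ∃ q, IsRun a i m B p q := by
  classical
  let S := (Finset.range m).filter fun q => p ≤ q ∧ a q = a p ∧ ∀ x, p < x → x ≤ q → ¬ B x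
  have hS : S.Nonempty := ⟨p, Finset.mem_filter.2
    ⟨Finset.mem_range.2 hp, le_rfl, rfl, fun x h h' => by omega⟩⟩
  obtain ⟨q, hmem, hmax⟩ : ∃ q, q ∈ S ∧ ∀ q' ∈ S, q' ≤ q :=
    ⟨S.max' hS, S.max'_mem hS, fun q hq => S.le_max' q hq⟩
  simp only [S, Finset.mem_filter, Finset.mem_range] at hmem hmax
  refine ⟨q, hi, hmem.2.1, hmem.1, hmem.2.2.1, hmem.2.2.2, hf, fun q' h h' he => ?_⟩
  by_contra hcon
  push Not at hcon
  have := hmax q' ⟨h', by omega, he, fun x h₁ h₂ => by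
    rcases le_or_gt x q with h₃ | h₃
    · exact hmem.2.2.2 x h₁ h₃
    · exact hcon x h₃ h₂⟩
  omega

theorem exists_isRun_of_lst (hi : i ≤ q) (hq : q < m)
    (hl : ∀ q', q < q' → q' < m → a q' = a q → ∃ x, q < x ∧ x ≤ q' ∧ B x) :
    ∃ p, IsRun a i m B p q := by
  classical
  have hex : ∃ p, i ≤ p ∧ p ≤ q ∧ a q = a p ∧ ∀ x, p < x → x ≤ q → ¬ B x :=
    ⟨q, hi, le_rfl, rfl, fun x h h' => by omega⟩
  obtain ⟨h₁, h₂, h₃, h₄⟩ := Nat.find_spec hex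
  have hmin := fun p (hp : p < Nat.find hex) => Nat.find_min hex hp
  set p := Nat.find hex
  refine ⟨p, h₁, h₂, hq, h₃, h₄, fun p' h h' he => ?_, fun q' h h' he => hl q' h h' (he.trans h₃.symm)⟩
  by_contra hcon
  push Not at hcon
  refine hmin p' h' ⟨h, by omega, h₃.trans he.symm, fun x h₅ h₆ => ?_⟩
  rcases le_or_gt x p with h₇ | h₇
  · exact hcon x h₅ h₇
  · exact h₄ x h₇ h₆

/-- Boundaries at or before `i` separate no two positions from `i` on. -/
theorem RunLinks.congr (h : RunLinks a i m B F L) (hB : ∀ x, i < x → (B' x ↔ B x)) :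
    RunLinks a i m B' F L := by
  refine fun p q hr => h p q ⟨hr.le_fst, hr.le, hr.lt, hr.eq, fun x h₁ h₂ => ?_,
    fun p' h₁ h₂ h₃ => ?_, fun q' h₁ h₂ h₃ => ?_⟩
  · rw [← hB x (by have := hr.le_fst; omega)]; exact hr.nob x h₁ h₂
  · obtain ⟨x, h₄, h₅, h₆⟩ := hr.fst p' h₁ h₂ h₃
    exact ⟨x, h₄, h₅, (hB x (by omega)).1 h₆⟩
  · obtain ⟨x, h₄, h₅, h₆⟩ := hr.lst q' h₁ h₂ h₃
    exact ⟨x, h₄, h₅, (hB x (by have := hr.le_fst; have := hr.le; omega)).1 h₆⟩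

/-- The effect on `L` of cutting the first position off its run. -/
def splitL (nx L : ℕ → ℕ) (p : ℕ) : ℕ → ℕ :=
  if L p = p then L else Function.update (Function.update L (nx p) (L p)) p p

/-- The effect on `F` of cutting the first position off its run. -/
def splitF (nx F L : ℕ → ℕ) (p : ℕ) : ℕ → ℕ :=
  if L p = p then F else Function.update (Function.update F (L p) (nx p)) p p

/-- By `hB` the position `p` is the first of its run. The new boundary behind it makes `p` a run of
its own, and the rest of the old run, if any, begins at `nx p` with its end unchanged. No other run
contains `p`, so no other links change. -/
theorem RunLinks.split (h : RunLinks a i m B F L) (hl : Linked a m pv nx) (hi : i ≤ p) (hp : p < m)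
    (hB : B p ∨ p = i) :
    RunLinks a i m (fun x => B x ∨ x = p + 1) (splitF nx F L p) (splitL nx L p) := by
  have hfst : ∀ p', i ≤ p' → p' < p → a p' = a p → ∃ x, p' < x ∧ x ≤ p ∧ B x := by
    intro p' h₁ h₂ _
    rcases hB with hB | hB
    · exact ⟨p, h₂, le_rfl, hB⟩
    · omega
  obtain ⟨q₀, hr₀⟩ := exists_isRun_of_fst hi hp hfst
  obtain ⟨hL, hF⟩ := h _ _ hr₀
  have hnx : q₀ ≠ p → nx p ≤ q₀ := fun hne => hl.nx_le p hp q₀ (by have := hr₀.le; omega) hr₀.lt hr₀.eq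
  have hnxa : q₀ ≠ p → a (nx p) = a p := fun hne =>
    hl.nx_eq p hp ((hnx hne).trans_lt hr₀.lt)
  have hnxp := hl.lt_nx p hp
  have hq₀ := hr₀.le
  intro p₁ q₁ hr
  have hr₁ := hr.le_fst
  have hr₂ := hr.le
  have keep : a p₁ ≠ a p ∨ (p₁ < p ∧ q₁ < p) → IsRun a i m B p₁ q₁ →
      splitL nx L p p₁ = q₁ ∧ splitF nx F L p q₁ = p₁ := by
    intro hne hrB
    obtain ⟨hL₁, hF₁⟩ := h _ _ hrB
    unfold splitL splitF
    rw [hL]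
    split_ifs with hqp
    · exact ⟨hL₁, hF₁⟩
    · have h₁ : p₁ ≠ p ∧ p₁ ≠ nx p ∧ q₁ ≠ p ∧ q₁ ≠ q₀ := by
        rcases hne with hne | hne
        · refine ⟨?_, ?_, ?_, ?_⟩ <;> rintro rfl
          · exact hne rfl
          · exact hne (hnxa hqp)
          · exact hne hrB.eq.symm
          · exact hne (hrB.eq.symm.trans hr₀.eq)
        · omega
      simp [Function.update_of_ne, h₁, hL₁, hF₁]
  by_cases hv : a p₁ = a p
  · rcases lt_trichotomy p₁ p with hlt | rfl | hgt
    · have hBp : B p := by rcases hB with hB | hB; exacts [hB, by omega]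
      have hq₁ : q₁ < p := by
        by_contra hcon
        exact hr.nob p hlt (by omega) (Or.inl hBp)
      refine keep (Or.inr ⟨hlt, hq₁⟩) ⟨hr.le_fst, hr.le, hr.lt, hr.eq,
        fun x h₁ h₂ h₃ => hr.nob x h₁ h₂ (Or.inl h₃), fun p' h₁ h₂ h₃ => ?_,
        fun q' h₁ h₂ h₃ => ?_⟩
      · obtain ⟨x, h₄, h₅, h₆⟩ := hr.fst p' h₁ h₂ h₃
        exact ⟨x, h₄, h₅, h₆.resolve_right (by omega)⟩
      · obtain ⟨x, h₄, h₅, h₆ | h₆⟩ := hr.lst q' h₁ h₂ h₃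
        · exact ⟨x, h₄, h₅, h₆⟩
        · exact ⟨p, hq₁, by omega, hBp⟩
    · have hq₁ : q₁ = p₁ := by
        by_contra hcon
        exact hr.nob (p₁ + 1) (by omega) (by omega) (Or.inr rfl)
      subst hq₁
      unfold splitL splitF
      rw [hL]
      split_ifs with hqp
      · subst hqp; exact ⟨hL, hF⟩
      · simp
    · by_cases hb : ∃ x, p < x ∧ x ≤ p₁ ∧ B x
      · have hrB : IsRun a i m B p₁ q₁ := by
          refine ⟨hr.le_fst, hr.le, hr.lt, hr.eq,
            fun x h₁ h₂ h₃ => hr.nob x h₁ h₂ (Or.inl h₃), fun p' h₁ h₂ h₃ => ?_,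
            fun q' h₁ h₂ h₃ => ?_⟩
          · obtain ⟨x, h₄, h₅, h₆ | h₆⟩ := hr.fst p' h₁ h₂ h₃
            · exact ⟨x, h₄, h₅, h₆⟩
            · obtain ⟨y, h₇, h₈, h₉⟩ := hb
              exact ⟨y, by omega, h₈, h₉⟩
          · obtain ⟨x, h₄, h₅, h₆⟩ := hr.lst q' h₁ h₂ h₃
            exact ⟨x, h₄, h₅, h₆.resolve_right (by omega)⟩
        obtain ⟨hL₁, hF₁⟩ := h _ _ hrB
        unfold splitL splitF
        rw [hL]
        split_ifs with hqp
        · exact ⟨hL₁, hF₁⟩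
        · have h₁ : p₁ ≠ nx p := by
            rintro rfl
            obtain ⟨y, h₇, h₈, h₉⟩ := hb
            exact hr₀.nob y h₇ (h₈.trans (hnx hqp)) h₉
          have h₂ : q₁ ≠ q₀ := by
            rintro rfl
            omega
          have h₃ : p₁ ≠ p := by omega
          have h₄ : q₁ ≠ p := by omega
          simp [Function.update_of_ne, h₁, h₂, h₃, h₄, hL₁, hF₁]
      · push Not at hb
        have hp₁ : p₁ = nx p := by
          have h₁ := hl.nx_le p hp p₁ hgt (hr₂.trans_lt hr.lt) hv
          by_contra hcon
          obtain ⟨x, h₂, h₃, h₄⟩ := hr.fst (nx p) (by omega) (by omega)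
            ((hl.nx_eq p hp (by have := hr.lt; omega)).trans hv.symm)
          rcases h₄ with h₄ | h₄
          · exact hb x (by omega) h₃ h₄
          · omega
        -- With no old boundary in between, `p` and `p₁ = nx p` lay in the same old run; the
        -- remainder inherits its end.
        have hrB : IsRun a i m B p q₁ := by
          refine ⟨hi, by omega, hr.lt, hr.eq.trans hv, fun x h₁ h₂ h₃ => ?_, hfst,
            fun q' h₁ h₂ h₃ => ?_⟩
          · rcases le_or_gt x p₁ with h₄ | h₄
            · exact hb x h₁ h₄ h₃
            · exact hr.nob x h₄ h₂ (Or.inl h₃)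
          · obtain ⟨x, h₄, h₅, h₆⟩ := hr.lst q' h₁ h₂ (h₃.trans hv.symm)
            exact ⟨x, h₄, h₅, h₆.resolve_right (by omega)⟩
        obtain ⟨hL₁, hF₁⟩ := h _ _ hrB
        have hne : q₁ ≠ p := by omega
        unfold splitL splitF
        rw [hL₁, if_neg hne, if_neg hne, ← hp₁]
        simp [Function.update_of_ne, hne, hgt.ne']
  · refine keep (Or.inl hv) ⟨hr.le_fst, hr.le, hr.lt, hr.eq,
      fun x h₁ h₂ h₃ => hr.nob x h₁ h₂ (Or.inl h₃), fun p' h₁ h₂ h₃ => ?_,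
      fun q' h₁ h₂ h₃ => ?_⟩
    · obtain ⟨x, h₄, h₅, h₆ | h₆⟩ := hr.fst p' h₁ h₂ h₃
      · exact ⟨x, h₄, h₅, h₆⟩
      · have hne : p' ≠ p := by rintro rfl; exact hv h₃.symm
        rcases hB with hB | hB
        · exact ⟨p, by omega, by omega, hB⟩
        · omega
    · obtain ⟨x, h₄, h₅, h₆ | h₆⟩ := hr.lst q' h₁ h₂ h₃
      · exact ⟨x, h₄, h₅, h₆⟩
      · have hne : q₁ ≠ p := by rintro rfl; exact hv hr.eq.symm
        rcases hB with hB | hB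
        · exact ⟨p, by omega, by omega, hB⟩
        · omega

/-- With boundaries on both sides, `p` is a run of its own. When the boundary `p` goes, `p` joins
the run that ends at its previous occurrence `pv p - 1`, provided that this is in the window and
nothing in `B'` still separates the two. The hypothesis `hB` leaves `B' p` open: the same boundary
may persist for another reason, and then `c` fails and nothing changes. -/
theorem RunLinks.merge (h : RunLinks a i m B F L) (hl : Linked a m pv nx) (hi : i ≤ p) (hp : p < m)
    (hBp : B p) (hBp' : B (p + 1)) (hB : ∀ x, x ≠ p → (B' x ↔ B x)) {c : Prop} [Decidable c]
    (hc : c ↔ i < pv p ∧ ∀ x, pv p ≤ x → x ≤ p → ¬ B' x) :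
    RunLinks a i m B' (if c then Function.update F p (F (pv p - 1)) else F)
      (if c then Function.update L (F (pv p - 1)) p else L) := by
  have hBB : ∀ x, B' x → B x := by
    intro x hx
    rcases eq_or_ne x p with rfl | hne
    · exact hBp
    · exact (hB x hne).1 hx
  have hpv := hl.pv_le p hp
  have hprev : i < pv p → a (pv p - 1) = a p := fun h => hl.pv_eq p hp _ (by omega)
  have hlst : i < pv p → ∀ q', pv p - 1 < q' → q' < m → a q' = a p → p ≤ q' := by
    intro h₁ q' h₂ h₃ h₄
    by_contra hcon
    have := hl.lt_pv p hp q' (by omega) h₄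
    omega
  have hrun : i < pv p → ∃ p₀, IsRun a i m B p₀ (pv p - 1) := by
    intro h₁
    refine exists_isRun_of_lst (by omega) (by omega) fun q' h₂ h₃ h₄ => ?_
    exact ⟨p, by omega, hlst h₁ q' h₂ h₃ (h₄.trans (hprev h₁)), hBp⟩
  intro p₁ q₁ hr
  have hr₁ := hr.le_fst
  have hr₂ := hr.le
  have keep : IsRun a i m B p₁ q₁ → q₁ ≠ p → (c → p₁ ≠ F (pv p - 1)) →
      (if c then Function.update L (F (pv p - 1)) p else L) p₁ = q₁ ∧
      (if c then Function.update F p (F (pv p - 1)) else F) q₁ = p₁ := by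
    intro hrB h₁ h₂
    obtain ⟨hL₁, hF₁⟩ := h _ _ hrB
    split_ifs with hcc
    · rw [Function.update_of_ne h₁, Function.update_of_ne (h₂ hcc)]
      exact ⟨hL₁, hF₁⟩
    · exact ⟨hL₁, hF₁⟩
  by_cases hv : a p₁ = a p
  · rcases lt_trichotomy p₁ p with hlt | rfl | hgt
    · rcases le_or_gt p q₁ with hq | hq
      · have hq₁ : q₁ = p := by
          by_contra hcon
          exact hr.nob (p + 1) (by omega) (by omega) ((hB _ (by omega)).2 hBp')
        subst hq₁
        have hpv₁ := hl.lt_pv q₁ hp p₁ hlt hv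
        have hcc : c := hc.2 ⟨by omega, fun x h₁ h₂ => hr.nob x (by omega) h₂⟩
        have hrB : IsRun a i m B p₁ (pv q₁ - 1) := by
          refine ⟨hr.le_fst, by omega, by omega, (hprev (by omega)).trans hv.symm,
            fun x h₁ h₂ h₃ => hr.nob x h₁ (by omega) ((hB x (by omega)).2 h₃),
            fun p' h₁ h₂ h₃ => ?_, fun q' h₁ h₂ h₃ =>
              ⟨q₁, by omega, hlst (by omega) q' h₁ h₂ (h₃.trans hv), hBp⟩⟩
          obtain ⟨x, h₄, h₅, h₆⟩ := hr.fst p' h₁ h₂ h₃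
          exact ⟨x, h₄, h₅, hBB x h₆⟩
        rw [if_pos hcc, if_pos hcc, (h _ _ hrB).2]
        simp
      · refine keep ⟨hr.le_fst, hr.le, hr.lt, hr.eq,
          fun x h₁ h₂ h₃ => hr.nob x h₁ h₂ ((hB x (by omega)).2 h₃), fun p' h₁ h₂ h₃ => ?_,
          fun q' h₁ h₂ h₃ => ?_⟩ (by omega) fun hcc hpF => ?_
        · obtain ⟨x, h₄, h₅, h₆⟩ := hr.fst p' h₁ h₂ h₃
          exact ⟨x, h₄, h₅, hBB x h₆⟩
        · obtain ⟨x, h₄, h₅, h₆⟩ := hr.lst q' h₁ h₂ h₃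
          exact ⟨x, h₄, h₅, hBB x h₆⟩
        -- A new run from the start of the preceding old run would have to reach `p`; if it ends
        -- earlier, this takes a boundary in `B'` that `c` excludes.
        · obtain ⟨hc₁, hc₂⟩ := hc.1 hcc
          obtain ⟨p₀, hr₀⟩ := hrun hc₁
          have hL₀ := (h _ _ hr₀)
          have hp₀ : p₁ = p₀ := by rw [hpF, hL₀.2]
          subst hp₀
          obtain ⟨x, h₁, h₂, h₃⟩ : ∃ x, pv p - 1 < x ∧ x ≤ p ∧ B' x := by
            have hrq : q₁ ≤ pv p - 1 := by
              have := hl.lt_pv p hp q₁ hq (hr.eq.trans hv); omega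
            rcases hrq.eq_or_lt with he | hlt'
            · rw [← he]; exact hr.lst p hq hp hv.symm
            · obtain ⟨x, h₄, h₅, h₆⟩ := hr.lst (pv p - 1) hlt' hr₀.lt ((hprev hc₁).trans hv.symm)
              exact absurd (hBB x h₆) (hr₀.nob x (by omega) h₅)
          exact hc₂ x (by omega) h₂ h₃
    · have hq₁ : q₁ = p₁ := by
        by_contra hcon
        exact hr.nob (p₁ + 1) (by omega) (by omega) ((hB _ (by omega)).2 hBp')
      have hcc : ¬ c := by
        intro hcc
        obtain ⟨hc₁, hc₂⟩ := hc.1 hcc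
        obtain ⟨x, h₁, h₂, h₃⟩ := hr.fst (pv p₁ - 1) (by omega) (by omega) (hprev hc₁)
        exact hc₂ x (by omega) h₂ h₃
      rw [if_neg hcc, if_neg hcc]
      refine h _ _ ⟨hr.le_fst, hr.le, hr.lt, hr.eq, fun x h₁ h₂ => by omega,
        fun p' h₁ h₂ h₃ => ?_, fun q' h₁ h₂ h₃ => ?_⟩
      · obtain ⟨x, h₄, h₅, h₆⟩ := hr.fst p' h₁ h₂ h₃
        exact ⟨x, h₄, h₅, hBB x h₆⟩
      · obtain ⟨x, h₄, h₅, h₆⟩ := hr.lst q' h₁ h₂ h₃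
        exact ⟨x, h₄, h₅, hBB x h₆⟩
    · refine keep ⟨hr.le_fst, hr.le, hr.lt, hr.eq,
        fun x h₁ h₂ h₃ => hr.nob x h₁ h₂ ((hB x (by omega)).2 h₃), fun p' h₁ h₂ h₃ => ?_,
        fun q' h₁ h₂ h₃ => ?_⟩ (by omega) fun hcc hpF => ?_
      · obtain ⟨x, h₄, h₅, h₆⟩ := hr.fst p' h₁ h₂ h₃
        exact ⟨x, h₄, h₅, hBB x h₆⟩
      · obtain ⟨x, h₄, h₅, h₆⟩ := hr.lst q' h₁ h₂ h₃
        exact ⟨x, h₄, h₅, hBB x h₆⟩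
      · obtain ⟨p₀, hr₀⟩ := hrun (hc.1 hcc).1
        rw [(h _ _ hr₀).2] at hpF
        have := hr₀.le
        omega
  · have hpne : p₁ ≠ p := by rintro rfl; exact hv rfl
    have hqne : q₁ ≠ p := by rintro rfl; exact hv hr.eq.symm
    refine keep ⟨hr.le_fst, hr.le, hr.lt, hr.eq, fun x h₁ h₂ h₃ => ?_, fun p' h₁ h₂ h₃ => ?_,
      fun q' h₁ h₂ h₃ => ?_⟩ hqne fun hcc hpF => ?_
    · rcases eq_or_ne x p with rfl | hne
      · exact hr.nob (x + 1) (by omega) (by omega) ((hB _ (by omega)).2 hBp')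
      · exact hr.nob x h₁ h₂ ((hB x hne).2 h₃)
    · obtain ⟨x, h₄, h₅, h₆⟩ := hr.fst p' h₁ h₂ h₃
      exact ⟨x, h₄, h₅, hBB x h₆⟩
    · obtain ⟨x, h₄, h₅, h₆⟩ := hr.lst q' h₁ h₂ h₃
      exact ⟨x, h₄, h₅, hBB x h₆⟩
    · have hc₁ := (hc.1 hcc).1
      obtain ⟨p₀, hr₀⟩ := hrun hc₁
      rw [(h _ _ hr₀).2] at hpF
      exact hv (by rw [hpF, ← hr₀.eq, hprev hc₁])

/-- The boundary `i + 1` isolates `i`. Thus moving the left end past `i` deletes one run of one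
position and spoils no other. -/
theorem RunLinks.drop (h : RunLinks a i m (fun x => B x ∨ x = i + 1) F L) :
    RunLinks a (i + 1) m B F L := by
  intro p q hr
  have hr₁ := hr.le_fst
  have hr₂ := hr.le
  refine h p q ⟨by omega, hr.le, hr.lt, hr.eq, fun x h₁ h₂ h₃ => ?_, fun p' h₁ h₂ h₃ => ?_,
    fun q' h₁ h₂ h₃ => ?_⟩
  · exact hr.nob x h₁ h₂ (h₃.resolve_right (by omega))
  · rcases eq_or_ne p' i with rfl | hne
    · exact ⟨p' + 1, by omega, by omega, Or.inr rfl⟩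
    · obtain ⟨x, h₄, h₅, h₆⟩ := hr.fst p' (by omega) h₂ h₃
      exact ⟨x, h₄, h₅, Or.inl h₆⟩
  · obtain ⟨x, h₄, h₅, h₆⟩ := hr.lst q' h₁ h₂ h₃
    exact ⟨x, h₄, h₅, Or.inl h₆⟩

/-- `cur` is the last position in `[i, e)` with the value of `i`, and `fw` the first such position
from `e` on, or is at least `m`. -/
structure WalkAt (a : ℕ → ℕ) (i m e cur fw : ℕ) : Prop where
  le_cur : i < e → i ≤ cur
  cur_lt : i < e → cur < e
  cur_eq : i < e → a cur = a i
  cur_max : i < e → ∀ q, cur < q → q < e → a q ≠ a i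
  le_fw : e ≤ fw
  fw_eq : fw < m → a fw = a i
  fw_le : ∀ q, e ≤ q → q < m → a q = a i → fw ≤ q

theorem WalkAt.start (cur : ℕ) : WalkAt a i m i cur i :=
  ⟨by omega, by omega, by omega, by omega, le_rfl, fun _ => rfl, fun _ h _ _ => h⟩

/-- If the next occurrence is not before `e'`, there is none between `e` and `e'`. -/
theorem WalkAt.stay {e e' cur fw : ℕ} (h : WalkAt a i m e cur fw) (hi : i ≤ e) (him : i < m)
    (hee : e ≤ e') (he' : e' ≤ m) (hf : e' ≤ fw) : WalkAt a i m e' cur fw := by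
  have hie : i < e' → i < e := by
    intro h'
    by_contra hcon
    have := h.fw_le i (by omega) him rfl
    omega
  refine ⟨fun h' => h.le_cur (hie h'), fun h' => (h.cur_lt (hie h')).trans_le hee,
    fun h' => h.cur_eq (hie h'), fun h' q h₁ h₂ h₃ => ?_, hf, h.fw_eq,
    fun q h₁ => h.fw_le q (hee.trans h₁)⟩
  rcases lt_or_ge q e with h₄ | h₄
  · exact h.cur_max (hie h') q h₁ h₄ h₃
  · have := h.fw_le q h₄ (by omega) h₃
    omega

/-- Since no boundary lies strictly between `e` and `e'`, all occurrences there form one run. It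
starts at `fw`, so one jump through `L` finds the last occurrence before `e'`, however many there
are. -/
theorem WalkAt.move {e e' cur fw : ℕ} (h : WalkAt a i m e cur fw) (hR : RunLinks a i m B F L)
    (hl : Linked a m pv nx) (hi : i ≤ e) (hB : e = i ∨ B e) (hB' : e' = i ∨ B e')
    (hbetween : ∀ x, B x → e < x → e' ≤ x) (he' : e' ≤ m) (hf : fw < e') :
    WalkAt a i m e' (L fw) (nx (L fw)) := by
  have hef := h.le_fw
  have ha := h.fw_eq (hf.trans_le he')
  have hfst : ∀ p', i ≤ p' → p' < fw → a p' = a fw → ∃ x, p' < x ∧ x ≤ fw ∧ B x := by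
    intro p' h₁ h₂ h₃
    have : p' < e := by
      by_contra hcon
      have := h.fw_le p' (by omega) (by omega) (h₃.trans ha)
      omega
    exact ⟨e, this, hef, hB.resolve_left (by omega)⟩
  obtain ⟨q, hr⟩ := exists_isRun_of_fst (B := B) (by omega) (hf.trans_le he') hfst
  have hq := hr.le
  rw [(hR _ _ hr).1]
  have hqe : q < e' := by
    by_contra hcon
    exact hr.nob e' hf (by omega) (hB'.resolve_left (by omega))
  have haq : a q = a i := hr.eq.trans ha
  have hafter : ∀ q', q < q' → q' < m → a q' = a i → e' ≤ q' := by
    intro q' h₁ h₂ h₃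
    obtain ⟨x, h₄, h₅, h₆⟩ := hr.lst q' h₁ h₂ (h₃.trans ha.symm)
    exact (hbetween x h₆ (by omega)).trans h₅
  have hnx := hl.lt_nx q hr.lt
  refine ⟨fun _ => by omega, fun _ => hqe, fun _ => haq, fun _ q' h₁ h₂ h₃ => ?_, ?_,
    fun h₁ => (hl.nx_eq q hr.lt h₁).trans haq, fun q' h₁ h₂ h₃ => ?_⟩
  · have := hafter q' h₁ (by omega) h₃; omega
  · rcases lt_or_ge (nx q) m with h₁ | h₁
    · exact hafter _ hnx h₁ ((hl.nx_eq q hr.lt h₁).trans haq)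
    · omega
  · exact hl.nx_le q hr.lt q' (by omega) h₂ (h₃.trans haq.symm)

/-- The occurrences after `i` and before `e` are those after `i` up to `cur`, and these are counted
by the difference of two ranks, independently of the level. -/
theorem WalkAt.cnt_eq {e cur fw : ℕ} (h : WalkAt a i m e cur fw) (hi : i < e) :
    cnt a (i + 1) e (a i) = cnt a 0 cur (a cur) - cnt a 0 i (a i) := by
  have h₁ := h.le_cur hi
  have h₂ := h.cur_lt hi
  have h₃ := h.cur_eq hi
  have h₄ : cnt a (cur + 1) e (a i) = 0 :=
    cnt_eq_zero.2 fun q hq hq' => h.cur_max hi q (by omega) hq'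
  have h₅ := cnt_add (a := a) (l := i + 1) (m := cur + 1) (r := e) (by omega) (by omega) (a i)
  have h₆ := cnt_succ_right (a := a) (l := i) (r := cur) h₁ (a i)
  have h₇ := cnt_succ_left (a := a) (l := i) (r := cur + 1) (by omega) (a i)
  have h₈ := cnt_add (a := a) (l := 0) (m := i) (r := cur) (by omega) h₁ (a i)
  rw [if_pos h₃] at h₆
  rw [if_pos rfl] at h₇
  rw [h₃]
  omega

end RunLinks

/-! ### Loops with a counter -/

infixr:67 " ;; " => Prog.seq

/-- Memory and words are large enough for numbers up to `4 n + 20`. -/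
structure Fits (M : Machine) (n : ℕ) : Prop where
  cells : 4 * n + 20 ≤ M.cells
  words : 4 * n + 20 < M.words

/-- `for x = 0, …, N - 1 do P`. -/
def Prog.forUp (x : ℕ) (N : WExp) (P : Prog) : Prog :=
  .setW x (.lit 0) ;; .loop (.wlt (.var x) N) (P ;; .setW x (.add (.var x) (.lit 1)))

theorem Runs.setW {M : Machine} {s : Store} {x : ℕ} {e : WExp} {Q : ℕ → Store → Prop}
    (he : e.good M s)
    (h : Q (e.cost + 1) { s with wvar := Function.update s.wvar x (e.val s) }) :
    Runs M (.setW x e) s Q := by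
  refine ⟨_, _, .setW s x e he.spec.1, ?_⟩
  rw [he.spec.2]
  exact h

theorem Runs.forUp {M : Machine} {x : ℕ} {E : WExp} {P : Prog} {s : Store} (I : ℕ → Store → Prop)
    (N c : ℕ) (hN : N < M.words)
    (h₀ : I 0 { s with wvar := Function.update s.wvar x 0 })
    (hI : ∀ p s, p ≤ N → I p s → s.wvar x = p ∧ E.good M s ∧ E.val s = N)
    (hP : ∀ p s, p < N → I p s → Runs M P s fun t s' => t ≤ c ∧ s'.wvar x = p ∧
      I (p + 1) { s' with wvar := Function.update s'.wvar x (p + 1) }) :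
    Runs M (.forUp x E P) s fun t s' => I N s' ∧ t ≤ (N + 1) * (c + E.cost + 9) := by
  refine Runs.seq (Runs.setW (show 0 < _ by omega) ?_)
  refine (Runs.count I N (c + 4) (fun p s hp hs => ?_) (fun p s hp hs => ?_) (Nat.zero_le N)
    h₀).mono fun t s' h => ⟨h.1, ?_⟩
  · obtain ⟨h₁, h₂, h₃⟩ := hI p s hp hs
    simp [h₁, h₂, h₃]
  · refine Runs.seq ((hP p s hp hs).mono fun t s' h => Runs.setW ?_ ?_)
    · simp only [WExp.good, WExp.val, h.2.1]
      exact ⟨trivial, by omega, by omega⟩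
    · simp only [WExp.cost, WExp.val, h.2.1]
      exact ⟨h.2.2, Nat.add_le_add_right h.1 4⟩
  · have := h.2
    simp only [WExp.cost, BExp.cost, Nat.sub_zero] at this ⊢
    nlinarith

/-- The rule for a body without loops. -/
theorem Runs.forUp_wp {M : Machine} {x : ℕ} {E : WExp} {P : Prog} {s : Store}
    (I : ℕ → Store → Prop) (N : ℕ) (hN : N < M.words)
    (h₀ : I 0 { s with wvar := Function.update s.wvar x 0 })
    (hI : ∀ p s, p ≤ N → I p s → s.wvar x = p ∧ E.good M s ∧ E.val s = N)
    (hP : ∀ p s, p < N → I p s → P.wp M (fun s' => s'.wvar x = p ∧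
      I (p + 1) { s' with wvar := Function.update s'.wvar x (p + 1) }) s) :
    Runs M (.forUp x E P) s fun t s' => I N s' ∧ t ≤ (N + 1) * (P.bound + E.cost + 9) :=
  Runs.forUp I N P.bound hN h₀ hI fun p s hp hs => (hP p s hp hs).runs

/-! ### Naming of pairs

Word variable `0` is the length `n` of the text. The word array `2` holds names of the positions
`0, …, n`, and the word array `3` second components. -/

/-- The expression `n + 1`. -/
abbrev WExp.npos : WExp := .add (.var 0) (.lit 1)

/-- Clears the heads of the chains and the stamps. -/
def clearChains : Prog :=
  .forUp 2 .npos (.storeW 4 (.var 2) (.lit 0) ;; .storeW 6 (.var 2) (.lit 0))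

/-- Links the positions of equal first component into chains. -/
def linkChains : Prog :=
  .forUp 2 .npos
    (.storeW 5 (.var 2) (.arr 4 (.arr 2 (.var 2))) ;;
     .storeW 4 (.arr 2 (.var 2)) (.add (.var 2) (.lit 1)))

/-- One step along the chains. -/
def walkChainsBody : Prog :=
  .ite (.weq (.var 4) (.lit 0))
    (.setW 3 (.add (.var 3) (.lit 1)) ;; .setW 4 (.arr 4 (.var 3)))
    (.setW 5 (.sub (.var 4) (.lit 1)) ;;
     .ite (.weq (.arr 6 (.arr 3 (.var 5))) (.add (.var 3) (.lit 1)))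
       (.storeW 2 (.var 5) (.arr 7 (.arr 3 (.var 5))))
       (.storeW 6 (.arr 3 (.var 5)) (.add (.var 3) (.lit 1)) ;;
        .storeW 7 (.arr 3 (.var 5)) (.var 5) ;;
        .storeW 2 (.var 5) (.var 5)) ;;
     .setW 4 (.arr 5 (.var 5)))

/-- Walks along the chains and names the pairs by positions. -/
def walkChains : Prog :=
  .setW 3 (.lit 0) ;; .setW 4 (.arr 4 (.lit 0)) ;; .loop (.wlt (.var 3) .npos) walkChainsBody

/-- Replaces the names by names of the pairs of name and second component. -/
def pairNames : Prog := clearChains ;; linkChains ;; walkChains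

/-- Chains of the positions below `m` with equal values, for the values up to `n`. -/
structure Chains (A : ℕ → ℕ) (n m : ℕ) (hd nx : ℕ → ℕ) : Prop where
  hd_le : ∀ v ≤ n, hd v ≤ m
  hd_eq : ∀ v ≤ n, ∀ q, hd v = q + 1 → A q = v
  lt_hd : ∀ q < m, q < hd (A q)
  nx_le : ∀ p < m, nx p ≤ p
  nx_eq : ∀ p < m, ∀ q, nx p = q + 1 → A q = A p
  lt_nx : ∀ p < m, ∀ q < p, A q = A p → q < nx p

theorem Chains.succ {A hd nx : ℕ → ℕ} {n m : ℕ} (h : Chains A n m hd nx) (hA : A m ≤ n) :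
    Chains A n (m + 1) (Function.update hd (A m) (m + 1)) (Function.update nx m (hd (A m))) := by
  refine ⟨fun v hvn => ?_, fun v hvn q hq => ?_, fun q hq => ?_, fun p hp => ?_,
    fun p hp q hq => ?_, fun p hp q hq he => ?_⟩
  · have := h.hd_le v hvn
    by_cases hv : v = A m
    · subst hv; simp
    · simp [hv]; omega
  · by_cases hv : v = A m
    · subst hv
      simp only [Function.update_self] at hq
      rw [show q = m by omega]
    · rw [Function.update_of_ne hv] at hq
      exact h.hd_eq v hvn q hq
  · by_cases hv : A q = A m
    · rw [hv, Function.update_self]; exact hq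
    · rw [Function.update_of_ne hv]
      refine h.lt_hd q ?_
      rcases Nat.lt_succ_iff_lt_or_eq.1 hq with h' | rfl
      · exact h'
      · exact absurd rfl hv
  · by_cases hpm : p = m
    · subst hpm; simp [h.hd_le _ hA]
    · rw [Function.update_of_ne hpm]; exact h.nx_le p (by omega)
  · by_cases hpm : p = m
    · subst hpm
      rw [Function.update_self] at hq
      exact h.hd_eq _ hA q hq
    · rw [Function.update_of_ne hpm] at hq
      exact h.nx_eq p (by omega) q hq
  · by_cases hpm : p = m
    · subst hpm
      rw [Function.update_self, ← he]
      exact h.lt_hd q hq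
    · rw [Function.update_of_ne hpm]
      exact h.lt_nx p (by omega) q hq he

/-- The positions visited when the walk is at the chain of `v` and about to visit `ptr - 1`. -/
def Visited (A : ℕ → ℕ) (n v ptr q : ℕ) : Prop := q ≤ n ∧ (A q < v ∨ A q = v ∧ ptr ≤ q)

instance (A : ℕ → ℕ) (n v ptr : ℕ) : DecidablePred (Visited A n v ptr) := fun _ =>
  inferInstanceAs (Decidable (_ ∧ _))

/-- Invariant of the walk along the chains. -/
structure ChainWalk (A K : ℕ → ℕ) (n v ptr : ℕ) (nm stamp tab : ℕ → ℕ) : Prop where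
  v_le : v ≤ n + 1
  ptr_le : v ≤ n → ptr ≤ n + 1
  ptr_eq : v ≤ n → ∀ q, ptr = q + 1 → A q = v
  rep : ∀ q, Visited A n v ptr q → nm q ≤ n ∧ A (nm q) = A q ∧ K (nm q) = K q
  eq : ∀ q q', Visited A n v ptr q → Visited A n v ptr q' → A q = A q' → K q = K q' → nm q = nm q'
  stamped : ∀ q, Visited A n v ptr q → A q = v → stamp (K q) = v + 1 ∧ tab (K q) = nm q
  stamp_le : ∀ x ≤ n, stamp x ≤ v + 1
  stamp_eq : ∀ x ≤ n, stamp x = v + 1 → ∃ q, Visited A n v ptr q ∧ A q = v ∧ K q = x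

/-! ### Naming of pairs by chains and stamps -/

section ChainWalk

variable {A K hd nx nm stamp tab : ℕ → ℕ} {n v ptr : ℕ}

/-- The valid stamp rises from `v + 1` to `v + 2`, which is above all stamps in memory. So the whole
table becomes stale without being cleared. -/
theorem ChainWalk.next (h : ChainWalk A K n v 0 nm stamp tab) (hc : Chains A n (n + 1) hd nx)
    (hv : v ≤ n) :
    ChainWalk A K n (v + 1) (hd (v + 1)) nm stamp tab ∧
      ∀ q, Visited A n (v + 1) (hd (v + 1)) q ↔ Visited A n v 0 q := by
  have hvis : ∀ q, Visited A n (v + 1) (hd (v + 1)) q ↔ Visited A n v 0 q := by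
    intro q
    unfold Visited
    refine and_congr_right fun hq => ?_
    constructor
    · rintro (h₁ | ⟨h₁, h₂⟩)
      · omega
      · have := hc.lt_hd q (by omega)
        rw [h₁] at this
        omega
    · omega
  refine ⟨⟨by omega, fun hv => hc.hd_le _ hv, fun hv q hq => hc.hd_eq _ hv q hq, fun q hq => ?_,
    fun q q' hq hq' => ?_, fun q hq hA => ?_, fun x hx => ?_, fun x hx hs => ?_⟩, hvis⟩
  · exact h.rep q ((hvis q).1 hq)
  · exact h.eq q q' ((hvis q).1 hq) ((hvis q').1 hq')
  · have := ((hvis q).1 hq).2; omega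
  · have := h.stamp_le x hx; omega
  · have := h.stamp_le x hx; omega

/-- A valid stamp means that some visited position of the same chain has the same second component,
and `q` takes over its name. Otherwise `q` is the first with this pair and becomes the name. -/
theorem ChainWalk.visit {q : ℕ} (h : ChainWalk A K n v (q + 1) nm stamp tab)
    (hc : Chains A n (n + 1) hd nx) (hv : v ≤ n) (hK : ∀ p ≤ n, K p ≤ n) :
    (∀ p, Visited A n v (nx q) p ↔ Visited A n v (q + 1) p ∨ p = q) ∧ q ≤ n ∧
    ¬ Visited A n v (q + 1) q ∧
    (stamp (K q) = v + 1 →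
      ChainWalk A K n v (nx q) (Function.update nm q (tab (K q))) stamp tab) ∧
    (stamp (K q) ≠ v + 1 →
      ChainWalk A K n v (nx q) (Function.update nm q q) (Function.update stamp (K q) (v + 1))
        (Function.update tab (K q) q)) := by
  have hqn : q ≤ n := by have := h.ptr_le hv; omega
  have hAq : A q = v := h.ptr_eq hv q rfl
  have hnx := hc.nx_le q (by omega)
  have hvis : ∀ p, Visited A n v (nx q) p ↔ Visited A n v (q + 1) p ∨ p = q := by
    intro p
    unfold Visited
    constructor
    · rintro ⟨h₁, h₂ | ⟨h₂, h₃⟩⟩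
      · exact Or.inl ⟨h₁, Or.inl h₂⟩
      · rcases lt_trichotomy p q with h₄ | h₄ | h₄
        · have := hc.lt_nx q (by omega) p h₄ (by omega); omega
        · exact Or.inr h₄
        · exact Or.inl ⟨h₁, Or.inr ⟨h₂, h₄⟩⟩
    · rintro (⟨h₁, h₂⟩ | rfl)
      · exact ⟨h₁, by omega⟩
      · exact ⟨hqn, Or.inr ⟨hAq, hnx⟩⟩
  have hnv : ¬ Visited A n v (q + 1) q := by unfold Visited; omega
  have hne : ∀ p, Visited A n v (q + 1) p → p ≠ q := by rintro p hp rfl; exact hnv hp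
  refine ⟨hvis, hqn, hnv, fun hs => ?_, fun hs => ?_⟩
  · obtain ⟨q₀, hq₀, hA₀, hK₀⟩ := h.stamp_eq (K q) (hK q hqn) hs
    have ht : tab (K q) = nm q₀ := hK₀ ▸ (h.stamped q₀ hq₀ hA₀).2
    have hr := h.rep q₀ hq₀
    refine ⟨h.v_le, fun _ => by omega, fun _ p hp => (hc.nx_eq q (by omega) p hp).trans hAq,
      fun p hp => ?_, fun p p' hp hp' hA hKK => ?_, fun p hp hA => ?_, h.stamp_le,
      fun x hx hx' => ?_⟩
    · rcases (hvis p).1 hp with hp | rfl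
      · rw [Function.update_of_ne (hne p hp)]; exact h.rep p hp
      · rw [Function.update_self, ht, hAq, ← hA₀, ← hK₀]; exact hr
    · rcases (hvis p).1 hp with hp | rfl <;> rcases (hvis p').1 hp' with hp' | rfl
      · rw [Function.update_of_ne (hne p hp), Function.update_of_ne (hne p' hp')]
        exact h.eq p p' hp hp' hA hKK
      · rw [Function.update_of_ne (hne p hp), Function.update_self, ht]
        exact h.eq p q₀ hp hq₀ (by omega) (by omega)
      · rw [Function.update_of_ne (hne p' hp'), Function.update_self, ht]
        exact h.eq q₀ p' hq₀ hp' (by omega) (by omega)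
      · rfl
    · rcases (hvis p).1 hp with hp | rfl
      · rw [Function.update_of_ne (hne p hp)]; exact h.stamped p hp hA
      · rw [Function.update_self]; exact ⟨hs, rfl⟩
    · obtain ⟨p, hp, hA, hKp⟩ := h.stamp_eq x hx hx'
      exact ⟨p, (hvis p).2 (Or.inl hp), hA, hKp⟩
  · have hfresh : ∀ p, Visited A n v (q + 1) p → A p = v → K p ≠ K q := by
      intro p hp hA hKp
      exact hs (hKp ▸ (h.stamped p hp hA).1)
    refine ⟨h.v_le, fun _ => by omega, fun _ p hp => (hc.nx_eq q (by omega) p hp).trans hAq,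
      fun p hp => ?_, fun p p' hp hp' hA hKK => ?_, fun p hp hA => ?_, fun x hx => ?_,
      fun x hx hx' => ?_⟩
    · rcases (hvis p).1 hp with hp | rfl
      · rw [Function.update_of_ne (hne p hp)]; exact h.rep p hp
      · rw [Function.update_self]; exact ⟨hqn, rfl, rfl⟩
    · rcases (hvis p).1 hp with hp | rfl <;> rcases (hvis p').1 hp' with hp' | rfl
      · rw [Function.update_of_ne (hne p hp), Function.update_of_ne (hne p' hp')]
        exact h.eq p p' hp hp' hA hKK
      · exact absurd hKK (hfresh p hp (by omega))
      · exact absurd hKK.symm (hfresh p' hp' (by omega))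
      · rfl
    · rcases (hvis p).1 hp with hp | rfl
      · rw [Function.update_of_ne (hne p hp), Function.update_of_ne (hfresh p hp hA),
          Function.update_of_ne (hfresh p hp hA)]
        exact h.stamped p hp hA
      · simp
    · by_cases hxk : x = K q
      · subst hxk; simp
      · rw [Function.update_of_ne hxk]; exact h.stamp_le x hx
    · by_cases hxk : x = K q
      · exact ⟨q, (hvis q).2 (Or.inr rfl), hAq, hxk.symm⟩
      · rw [Function.update_of_ne hxk] at hx'
        obtain ⟨p, hp, hA, hKp⟩ := h.stamp_eq x hx hx'
        exact ⟨p, (hvis p).2 (Or.inl hp), hA, hKp⟩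

end ChainWalk

theorem clearChains_runs {M : Machine} {n : ℕ} (hM : Fits M n) {s : Store} (hn : s.wvar 0 = n) :
    Runs M clearChains s fun t s' => (∀ q ≤ n, s'.warr 4 q = 0 ∧ s'.warr 6 q = 0) ∧
      t ≤ 30 * (n + 2) := by
  obtain ⟨hC, hW⟩ := hM
  refine (Runs.forUp_wp (fun p s' => s'.wvar 2 = p ∧ s'.wvar 0 = n ∧
    ∀ q < p, s'.warr 4 q = 0 ∧ s'.warr 6 q = 0) (n + 1) (by omega)
    (by simp [hn]) ?_ ?_).mono ?_
  · rintro p s' hp ⟨h₁, h₂, -⟩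
    simp [h₁, h₂]; omega
  · rintro p s' hp ⟨h₁, h₂, h₅⟩
    simp [h₁, h₂]
    refine ⟨by omega, by omega, by omega, by omega, fun q hq => ?_⟩
    rcases hq.lt_or_eq with hq | rfl
    · simp [hq.ne, h₅ q hq]
    · simp
  · rintro t s' ⟨⟨-, -, h⟩, ht⟩
    refine ⟨fun q hq => h q (by omega), ?_⟩
    simp only [Prog.bound, WExp.cost] at ht
    omega

theorem linkChains_runs {M : Machine} {n : ℕ} (hM : Fits M n) {s : Store} (hn : s.wvar 0 = n)
    (hA : ∀ p ≤ n, s.warr 2 p ≤ n) (h0 : ∀ q ≤ n, s.warr 4 q = 0) :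
    Runs M linkChains s fun t s' => Chains (s.warr 2) n (n + 1) (s'.warr 4) (s'.warr 5) ∧
      t ≤ 40 * (n + 2) := by
  obtain ⟨hC, hW⟩ := hM
  refine (Runs.forUp_wp (fun p s' => s'.wvar 2 = p ∧ s'.wvar 0 = n ∧ s'.warr 2 = s.warr 2 ∧
    Chains (s.warr 2) n p (s'.warr 4) (s'.warr 5)) (n + 1) (by omega) ?_ ?_ ?_).mono ?_
  · refine ⟨by simp, by simp [hn], rfl, fun v hv => ?_, fun v hv q hq => ?_, by omega, by omega,
      by omega, by omega⟩
    · simp [h0 v hv]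
    · simp [h0 v hv] at hq
  · rintro p s' hp ⟨h₁, h₂, -⟩
    simp [h₁, h₂]; omega
  · rintro p s' hp ⟨h₁, h₂, h₃, h₄⟩
    have := hA p (by omega)
    have hc := h₄.succ this
    simp [h₁, h₂, h₃]
    and_intros
    all_goals omega
  · rintro t s' ⟨⟨-, -, -, h⟩, ht⟩
    refine ⟨h, ?_⟩
    simp only [Prog.bound, WExp.cost] at ht
    omega

theorem walkChains_runs {M : Machine} {n : ℕ} (hM : Fits M n) {s : Store} (hn : s.wvar 0 = n)
    {A : ℕ → ℕ} (hA : ∀ p ≤ n, A p ≤ n) (hK : ∀ p ≤ n, s.warr 3 p ≤ n)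
    (hc : Chains A n (n + 1) (s.warr 4) (s.warr 5)) (h0 : ∀ q ≤ n, s.warr 6 q = 0) :
    Runs M walkChains s fun t s' => (∀ p ≤ n, s'.warr 2 p ≤ n ∧ A (s'.warr 2 p) = A p ∧
        s.warr 3 (s'.warr 2 p) = s.warr 3 p) ∧
      (∀ p ≤ n, ∀ q ≤ n, A p = A q → s.warr 3 p = s.warr 3 q → s'.warr 2 p = s'.warr 2 q) ∧
      t ≤ 200 * (n + 2) := by
  obtain ⟨hC, hW⟩ := hM
  set K := s.warr 3
  let I : Store → Prop := fun s' => s'.wvar 0 = n ∧ s'.warr 3 = K ∧ s'.warr 4 = s.warr 4 ∧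
    s'.warr 5 = s.warr 5 ∧
    ChainWalk A K n (s'.wvar 3) (s'.wvar 4) (s'.warr 2) (s'.warr 6) (s'.warr 7)
  -- Each step either turns to the next chain or visits a new position, so the number of steps is
  -- linear although chains vary in length.
  let μ : Store → ℕ := fun s' => 70 * ((n + 1 - s'.wvar 3) +
    ((Finset.range (n + 1)).filter fun q => ¬ Visited A n (s'.wvar 3) (s'.wvar 4) q).card)
  have hbody : walkChainsBody.bound ≤ 60 := by decide
  have key : ∀ s', I s' → s'.wvar 3 < n + 1 → walkChainsBody.wp M (fun s'' => I s'' ∧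
      μ s'' + 70 ≤ μ s') s' := by
    rintro s' ⟨h₁, h₂, h₃, h₄, h₅⟩ hv
    have hv' : s'.wvar 3 ≤ n := by omega
    refine ⟨by simp; omega, fun h0 => ?_, fun h0 => ?_⟩
    · simp only [BExp.val, WExp.val] at h0
      rw [h0] at h₅
      obtain ⟨h₆, h₇⟩ := h₅.next hc hv'
      have hμ : ∀ m, 70 * ((n + 1 - (s'.wvar 3 + 1)) + m) + 70 = 70 * ((n + 1 - s'.wvar 3) + m) := by
        intro m; omega
      simp [I, μ, h₁, h₂, h₃, h₄, h0]
      refine ⟨by omega, by omega, h₆, ?_⟩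
      simp only [h₇]
      omega
    · simp only [BExp.val, WExp.val] at h0
      obtain ⟨q, hq⟩ : ∃ q, s'.wvar 4 = q + 1 := ⟨s'.wvar 4 - 1, by omega⟩
      rw [hq] at h₅
      obtain ⟨h₆, h₇, h₈, h₉, h₁₀⟩ := h₅.visit hc hv' hK
      have hKq := hK q h₇
      have hμ : 70 * ((n + 1 - s'.wvar 3) + ((Finset.range (n + 1)).filter
            fun p => ¬ Visited A n (s'.wvar 3) (s.warr 5 q) p).card) + 70 ≤
          70 * ((n + 1 - s'.wvar 3) + ((Finset.range (n + 1)).filter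
            fun p => ¬ Visited A n (s'.wvar 3) (q + 1) p).card) := by
        have : ((Finset.range (n + 1)).filter
            fun p => ¬ Visited A n (s'.wvar 3) (s.warr 5 q) p).card <
          ((Finset.range (n + 1)).filter
            fun p => ¬ Visited A n (s'.wvar 3) (q + 1) p).card := by
          refine Finset.card_lt_card (Finset.ssubset_iff_of_subset ?_ |>.2 ⟨q, ?_, ?_⟩)
          · refine Finset.monotone_filter_right _ fun p _ h hp' => ?_
            exact h ((h₆ p).2 (Or.inl hp'))
          · simp [h₈]; omega
          · simp [h₆]
        omega
      simp [I, μ, h₁, h₂, h₃, h₄, hq]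
      and_intros
      any_goals first | omega | intro hs; and_intros
      any_goals omega
      · exact h₉ hs
      · exact h₁₀ hs
  have hv0 : ∀ q, Visited A n 0 (s.warr 4 0) q → False := by
    rintro q ⟨h₁, h₂ | ⟨h₂, h₃⟩⟩
    · omega
    · have := hc.lt_hd q (by omega)
      rw [h₂] at this
      omega
  refine Runs.seq (Runs.setW (by simp; omega) (Runs.seq (Runs.setW (by simp; omega) ?_)))
  refine (Runs.loop I μ ?_ ?_ ?_).mono ?_
  · rintro s' ⟨h₁, -⟩
    simp [h₁]; omega
  · intro s' hs hb
    have hn' := hs.1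
    refine (key s' hs (by simpa [hn'] using hb)).runs.mono fun t s'' h => ⟨h.2.1, ?_⟩
    have h₁ := h.1
    have h₂ := h.2.2
    simp only [BExp.cost, WExp.cost]
    omega
  · refine ⟨by simp [hn], by simp [K], by simp, by simp, ?_⟩
    simp
    exact ⟨by omega, fun _ => hc.hd_le _ (by omega), fun _ q hq => hc.hd_eq _ (by omega) q hq,
      fun q hq => (hv0 q hq).elim, fun q _ hq => (hv0 q hq).elim, fun q hq => (hv0 q hq).elim,
      fun x hx => by rw [h0 x hx]; omega, fun x hx hx' => by rw [h0 x hx] at hx'; omega⟩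
  · rintro t s' ⟨⟨h₁, h₂, h₃, h₄, h₅⟩, hb, ht⟩
    have hv : ∀ q ≤ n, Visited A n (s'.wvar 3) (s'.wvar 4) q := by
      intro q hq
      simp [h₁] at hb
      exact ⟨hq, Or.inl (by have := hA q hq; omega)⟩
    refine ⟨fun p hp => h₅.rep p (hv p hp), fun p hp q hq => h₅.eq p q (hv p hp) (hv q hq), ?_⟩
    have : ∀ q : ℕ → Prop, ∀ _ : DecidablePred q,
        ((Finset.range (n + 1)).filter q).card ≤ n + 1 := fun q _ =>
      (Finset.card_filter_le _ _).trans (by simp)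
    have h₆ := this (fun q => ¬ Visited A n 0 (s.warr 4 0) q) inferInstance
    simp [μ, BExp.cost, WExp.cost] at ht ⊢
    omega

/-- A name is a representative position with the same pair. Hence names stay at most `n`, equal
names force equal pairs, and no sorting is needed. -/
theorem pairNames_runs {M : Machine} {n : ℕ} (hM : Fits M n) {s : Store} (hn : s.wvar 0 = n)
    (hA : ∀ p ≤ n, s.warr 2 p ≤ n) (hK : ∀ p ≤ n, s.warr 3 p ≤ n) :
    Runs M pairNames s fun t s' => (∀ p ≤ n, s'.warr 2 p ≤ n) ∧
      (∀ p ≤ n, ∀ q ≤ n, s'.warr 2 p = s'.warr 2 q ↔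
        s.warr 2 p = s.warr 2 q ∧ s.warr 3 p = s.warr 3 q) ∧ t ≤ 300 * (n + 2) := by
  refine Runs.seq ((clearChains_runs hM hn).frame.mono ?_)
  rintro t₁ s₁ ⟨⟨hz, ht₁⟩, hf₁⟩
  have e₁ := hf₁.wvar 0 (by simp [clearChains, Prog.forUp])
  have e₂ := hf₁.warr 2 (by simp [clearChains, Prog.forUp])
  have e₃ := hf₁.warr 3 (by simp [clearChains, Prog.forUp])
  refine Runs.seq ((linkChains_runs hM (e₁.trans hn) (by rwa [e₂]) fun q hq =>
    (hz q hq).1).frame.mono ?_)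
  rintro t₂ s₂ ⟨⟨hc, ht₂⟩, hf₂⟩
  have e₄ := hf₂.wvar 0 (by simp [linkChains, Prog.forUp])
  have e₅ := hf₂.warr 3 (by simp [linkChains, Prog.forUp])
  have e₆ := hf₂.warr 6 (by simp [linkChains, Prog.forUp])
  rw [e₂] at hc
  refine (walkChains_runs hM ((e₄.trans e₁).trans hn) hA (by rwa [e₅, e₃]) hc
    (fun q hq => by rw [e₆]; exact (hz q hq).2)).mono ?_
  rintro t₃ s₃ ⟨h₁, h₂, ht₃⟩
  rw [e₅, e₃] at h₁ h₂
  refine ⟨fun p hp => (h₁ p hp).1, fun p hp q hq => ⟨fun h => ?_, fun h => h₂ p hp q hq h.1 h.2⟩,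
    by omega⟩
  rw [← (h₁ p hp).2.1, ← (h₁ q hq).2.1, ← (h₁ p hp).2.2, ← (h₁ q hq).2.2, h]
  exact ⟨rfl, rfl⟩

/-! ### Naming of substrings -/

/-- The values of `a` at the positions `0, …, n` name the substrings of length `m`, cut off at the
end of the text. -/
def IsNaming {α : Type*} (T : List α) (n m : ℕ) (a : ℕ → ℕ) : Prop :=
  (∀ p ≤ n, a p ≤ n) ∧ ∀ p ≤ n, ∀ q ≤ n, a p = a q ↔ (T.drop p).take m = (T.drop q).take m

theorem take_eq_take_iff_getElem? {α : Type*} {u v : List α} {m : ℕ} :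
    u.take m = v.take m ↔ ∀ i < m, u[i]? = v[i]? := by
  constructor
  · intro h i hi
    rw [← List.getElem?_take_of_lt hi, h, List.getElem?_take_of_lt hi]
  · intro h
    refine List.ext_getElem? fun i => ?_
    rcases lt_or_ge i m with hi | hi
    · rw [List.getElem?_take_of_lt hi, List.getElem?_take_of_lt hi, h i hi]
    · simp [hi]

/-- The two pieces may overlap; they only have to cover the prefix. This admits lengths other than
powers of two. -/
theorem take_add_eq_take_add_iff {α : Type*} {u v : List α} {a b c : ℕ} (h : c ≤ a)
    (h' : a ≤ c + b) :
    u.take (c + b) = v.take (c + b) ↔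
      u.take a = v.take a ∧ (u.drop c).take b = (v.drop c).take b := by
  simp only [take_eq_take_iff_getElem?, List.getElem?_drop]
  refine ⟨fun hu => ⟨fun i hi => hu i (by omega), fun i hi => hu _ (by omega)⟩, ?_⟩
  rintro ⟨h₁, h₂⟩ i hi
  rcases lt_or_ge i a with h₃ | h₃
  · exact h₁ i h₃
  · have := h₂ (i - c) (by omega)
    rwa [Nat.add_sub_cancel' (h.trans h₃)] at this

/-- One digit of the symbols. -/
def digitRound : Prog :=
  .forUp 2 .npos
    (.storeW 3 (.var 2) (.mod (.arr 0 (.var 2)) .npos) ;;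
     .storeW 0 (.var 2) (.div (.arr 0 (.var 2)) .npos)) ;;
  pairNames

/-- Names the symbols by `D` digits in base `n + 1`. -/
def symbolNames : ℕ → Prog
  | 0 => .storeW 2 (.var 0) (.lit 1)
  | D + 1 => symbolNames D ;; digitRound

theorem digitRound_runs {M : Machine} {n : ℕ} (hM : Fits M n) {s : Store} (hn : s.wvar 0 = n)
    (hA : ∀ p ≤ n, s.warr 2 p ≤ n) :
    Runs M digitRound s fun t s' => s'.wvar 0 = n ∧ (∀ p ≤ n, s'.warr 2 p ≤ n) ∧
      (∀ p ≤ n, ∀ q ≤ n, s'.warr 2 p = s'.warr 2 q ↔ s.warr 2 p = s.warr 2 q ∧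
        s.warr 0 p % (n + 1) = s.warr 0 q % (n + 1)) ∧
      (∀ p ≤ n, s'.warr 0 p = s.warr 0 p / (n + 1)) ∧ t ≤ 400 * (n + 2) := by
  have hC := hM.cells
  have hW := hM.words
  refine Runs.seq ?_
  refine (Runs.forUp_wp (fun p s' => s'.wvar 2 = p ∧ s'.wvar 0 = n ∧ s'.warr 2 = s.warr 2 ∧
    (∀ q < p, s'.warr 3 q = s.warr 0 q % (n + 1) ∧ s'.warr 0 q = s.warr 0 q / (n + 1)) ∧
    ∀ q, p ≤ q → s'.warr 0 q = s.warr 0 q) (n + 1) (by omega) (by simp [hn]) ?_ ?_).mono ?_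
  · rintro p s' hp ⟨h₁, h₂, -⟩
    simp [h₁, h₂]; omega
  · rintro p s' hp ⟨h₁, h₂, h₃, h₄, h₅⟩
    simp [h₁, h₂, h₃]
    and_intros
    any_goals omega
    · intro q hq
      rcases hq.lt_or_eq with hq | rfl
      · simp [hq.ne, h₄ q hq]
      · simp [h₅]
    · intro q hq
      simp [show q ≠ p by omega, h₅ q (by omega)]
  · rintro t₁ s₁ ⟨⟨-, h₂, h₃, h₄, -⟩, ht₁⟩
    refine (pairNames_runs hM h₂ (by rwa [h₃]) fun p hp => ?_).frame.mono ?_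
    · rw [(h₄ p (by omega)).1]
      exact Nat.lt_succ_iff.1 (Nat.mod_lt _ (by omega))
    · rintro t₂ s₂ ⟨⟨h₅, h₆, ht₂⟩, hf⟩
      have e₁ := hf.wvar 0 (by simp [pairNames, clearChains, linkChains, walkChains,
        walkChainsBody, Prog.forUp])
      have e₂ := hf.warr 0 (by simp [pairNames, clearChains, linkChains, walkChains,
        walkChainsBody, Prog.forUp])
      refine ⟨e₁.trans h₂, h₅, fun p hp q hq => ?_, fun p hp => ?_, ?_⟩
      · rw [h₆ p hp q hq, h₃, (h₄ p (by omega)).1, (h₄ q (by omega)).1]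
      · rw [e₂]; exact (h₄ p (by omega)).2
      · simp only [Prog.bound, WExp.cost] at ht₁
        omega

/-- The names after `D` digits represent the residue modulo `(n + 1) ^ D`, and the array `0` keeps
the quotient. The position `n` behind the text starts with the name `1` and so stays apart from all
symbols. -/
theorem symbolNames_runs_aux {M : Machine} {n : ℕ} (hM : Fits M n) (h1 : 1 ≤ n) {s : Store}
    (hn : s.wvar 0 = n) (h0 : ∀ p, s.warr 2 p = 0) (D : ℕ) :
    Runs M (symbolNames D) s fun t s' => s'.wvar 0 = n ∧ (∀ p ≤ n, s'.warr 2 p ≤ n) ∧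
      (∀ p ≤ n, ∀ q ≤ n, s'.warr 2 p = s'.warr 2 q ↔ (p = n ↔ q = n) ∧
        s.warr 0 p % (n + 1) ^ D = s.warr 0 q % (n + 1) ^ D) ∧
      (∀ p ≤ n, s'.warr 0 p = s.warr 0 p / (n + 1) ^ D) ∧ t ≤ (D + 1) * (400 * (n + 2)) := by
  have hC := hM.cells
  have hW := hM.words
  induction D with
  | zero =>
    refine (Prog.wp.runs (Q := fun s' => s' =
      { s with warr := Function.update s.warr 2 (Function.update (s.warr 2) n 1) }) ?_).mono ?_
    · simp [symbolNames, hn]; omega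
    · rintro t s' ⟨ht, rfl⟩
      simp only [symbolNames, Prog.bound, WExp.cost] at ht
      refine ⟨hn, fun p hp => ?_, fun p hp q hq => ?_, fun p hp => by simp, by omega⟩
      · by_cases hpn : p = n
        · simp [hpn, h1]
        · simp [hpn, h0]
      · by_cases hpn : p = n <;> by_cases hqn : q = n <;> simp [hpn, hqn, h0, Nat.mod_one]
  | succ D ih =>
    refine Runs.seq (ih.mono ?_)
    rintro t₁ s₁ ⟨h₁, h₂, h₃, h₄, ht₁⟩
    refine (digitRound_runs hM h₁ h₂).mono ?_
    rintro t₂ s₂ ⟨h₅, h₆, h₇, h₈, ht₂⟩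
    refine ⟨h₅, h₆, fun p hp q hq => ?_, fun p hp => ?_, by linarith⟩
    · rw [h₇ p hp q hq, h₃ p hp q hq, h₄ p hp, h₄ q hq, pow_succ, Nat.mod_mul, Nat.mod_mul,
        and_assoc]
      refine and_congr_right fun _ => ⟨fun h => by rw [h.1, h.2], fun h => ?_⟩
      have hpos : 0 < (n + 1) ^ D := by positivity
      -- The residue modulo the larger power determines the one modulo the smaller power; the top
      -- digit then follows by cancellation.
      have e : s.warr 0 p % (n + 1) ^ D = s.warr 0 q % (n + 1) ^ D := by
        have := congrArg (· % (n + 1) ^ D) h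
        simpa using this
      exact ⟨e, Nat.eq_of_mul_eq_mul_left hpos (by omega)⟩
    · rw [h₈ p hp, h₄ p hp, pow_succ, Nat.div_div_eq_div_mul]

/-- Copies the names into the array `b`. -/
def copyNames (b : ℕ) : Prog := .forUp 2 .npos (.storeW b (.var 2) (.arr 2 (.var 2)))

theorem copyNames_runs {M : Machine} {n : ℕ} (hM : Fits M n) {s : Store} (hn : s.wvar 0 = n)
    {b : ℕ} (hb : b ≠ 2) :
    Runs M (copyNames b) s fun t s' => (∀ p ≤ n, s'.warr b p = s.warr 2 p) ∧
      t ≤ 20 * (n + 2) := by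
  have hC := hM.cells
  have hW := hM.words
  refine (Runs.forUp_wp (fun p s' => s'.wvar 2 = p ∧ s'.wvar 0 = n ∧ s'.warr 2 = s.warr 2 ∧
    ∀ q < p, s'.warr b q = s.warr 2 q) (n + 1) (by omega) (by simp [hn]) ?_ ?_).mono ?_
  · rintro p s' hp ⟨h₁, h₂, -⟩
    simp [h₁, h₂]; omega
  · rintro p s' hp ⟨h₁, h₂, h₃, h₄⟩
    simp [h₁, h₂, h₃, hb.symm]
    and_intros
    any_goals omega
    intro q hq
    rcases hq.lt_or_eq with hq | rfl
    · simp [hq.ne, h₄ q hq]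
    · simp
  · rintro t s' ⟨⟨-, -, -, h⟩, ht⟩
    refine ⟨fun p hp => h p (by omega), ?_⟩
    simp only [Prog.bound, WExp.cost] at ht
    omega

/-- The second component of `p` becomes the value of the array `b` at `p` plus the word variable
`x`, or at `n`. -/
def shiftNames (b x : ℕ) : Prog :=
  .forUp 2 .npos (.ite (.wlt (.var 0) (.add (.var 2) (.var x)))
    (.storeW 3 (.var 2) (.arr b (.var 0)))
    (.storeW 3 (.var 2) (.arr b (.add (.var 2) (.var x)))))

theorem shiftNames_runs {M : Machine} {n : ℕ} (hM : Fits M n) {s : Store} (hn : s.wvar 0 = n)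
    {b x : ℕ} (hb : b ≠ 3) (hx : x ≠ 2) (hxn : s.wvar x ≤ n) :
    Runs M (shiftNames b x) s fun t s' =>
      (∀ p ≤ n, s'.warr 3 p = s.warr b (min (p + s.wvar x) n)) ∧ t ≤ 40 * (n + 2) := by
  have hC := hM.cells
  have hW := hM.words
  refine (Runs.forUp_wp (fun p s' => s'.wvar 2 = p ∧ s'.wvar 0 = n ∧ s'.wvar x = s.wvar x ∧
    s'.warr b = s.warr b ∧ ∀ q < p, s'.warr 3 q = s.warr b (min (q + s.wvar x) n))
    (n + 1) (by omega) (by simp [hn, hx]) ?_ ?_).mono ?_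
  · rintro p s' hp ⟨h₁, h₂, -⟩
    simp [h₁, h₂]; omega
  · rintro p s' hp ⟨h₁, h₂, h₃, h₄, h₅⟩
    simp [h₁, h₂, h₃, h₄, hb, hx]
    refine ⟨by omega, fun h => ⟨by omega, by omega, fun q hq => ?_⟩,
      fun h => ⟨by omega, by omega, fun q hq => ?_⟩⟩
    · rcases hq.lt_or_eq with hq | rfl
      · simp [hq.ne, h₅ q hq]
      · simp [min_eq_right h.le]
    · rcases hq.lt_or_eq with hq | rfl
      · simp [hq.ne, h₅ q hq]
      · simp [min_eq_left h]
  · rintro t s' ⟨⟨-, -, -, -, h⟩, ht⟩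
    refine ⟨fun p hp => h p (by omega), ?_⟩
    simp only [Prog.bound, WExp.cost, BExp.cost] at ht
    omega

/-- Doubles the length in the word variable `6` of the named substrings, up to the word
variable `1`. -/
def doubleNames : Prog :=
  .ite (.wlt (.sub (.var 1) (.var 6)) (.var 6)) (.setW 7 (.sub (.var 1) (.var 6)))
    (.setW 7 (.var 6)) ;;
  shiftNames 2 7 ;; pairNames ;; .setW 6 (.add (.var 6) (.var 7))

/-- From names of symbols to names of substrings of length the word variable `1`. -/
def gramNames : Prog :=
  .ite (.weq (.var 1) (.lit 0))
    (.forUp 2 .npos (.storeW 2 (.var 2) (.lit 0)))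
    (.setW 6 (.lit 1) ;; .loop (.wlt (.var 6) (.var 1)) doubleNames)

/-! ### Names of longer substrings from names of shorter ones -/

section Naming

variable {α : Type*} {T : List α} {n : ℕ}

/-- The string of length `S + B` at `p` is determined by its prefix of length `A ≥ S` and the string
of length `B` at `p + S`. Capping the shifted position at `n` is harmless, as the text is empty from
there on. -/
theorem IsNaming.pair {a a' c : ℕ → ℕ} {A B S : ℕ} (hT : T.length = n)
    (ha : IsNaming T n A a) (hc : IsNaming T n B c) (hS : S ≤ A) (hSB : A ≤ S + B)
    (hle : ∀ p ≤ n, a' p ≤ n)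
    (h : ∀ p ≤ n, ∀ q ≤ n, a' p = a' q ↔ a p = a q ∧ c (min (p + S) n) = c (min (q + S) n)) :
    IsNaming T n (S + B) a' := by
  refine ⟨hle, fun p hp q hq => ?_⟩
  have hdrop : ∀ p, T.drop (min (p + S) n) = (T.drop p).drop S := by
    intro p
    rw [List.drop_drop]
    rcases le_total (p + S) n with h | h
    · rw [min_eq_left h]
    · rw [min_eq_right h, List.drop_eq_nil_of_le (by omega), List.drop_eq_nil_of_le (by omega)]
  rw [h p hp q hq, ha.2 p hp q hq, hc.2 _ (by omega) _ (by omega), hdrop, hdrop,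
    take_add_eq_take_add_iff hS hSB]

theorem IsNaming.congr {a a' : ℕ → ℕ} {m : ℕ} (h : IsNaming T n m a) (he : ∀ p ≤ n, a' p = a p) :
    IsNaming T n m a' := by
  refine ⟨fun p hp => (he p hp).trans_le (h.1 p hp), fun p hp q hq => ?_⟩
  rw [he p hp, he q hq]; exact h.2 p hp q hq

theorem doubleNames_runs {M : Machine} (hM : Fits M n) (hT : T.length = n) {s : Store}
    (hn : s.wvar 0 = n) {k : ℕ} (hk : s.wvar 1 = k) (hkn : k ≤ n) {m : ℕ} (hm : s.wvar 6 = m)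
    (hmk : m ≤ k) (h : IsNaming T n m (s.warr 2)) :
    Runs M doubleNames s fun t s' => s'.wvar 0 = n ∧ s'.wvar 1 = k ∧
      s'.wvar 6 = min (2 * m) k ∧ IsNaming T n (min (2 * m) k) (s'.warr 2) ∧
      t ≤ 400 * (n + 2) := by
  have hC := hM.cells
  have hW := hM.words
  refine Runs.seq ((Prog.wp.runs (Q := fun s' => s'.wvar 7 = min m (k - m)) ?_).frame.mono ?_)
  · simp [hk, hm]; omega
  rintro t₁ s₁ ⟨⟨ht₁, h₁⟩, hf₁⟩
  have e₀ := hf₁.wvar 0 (by simp)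
  have e₁ := hf₁.wvar 1 (by simp)
  have e₆ := hf₁.wvar 6 (by simp)
  have e₂ := hf₁.warr 2 (by simp)
  simp only [Prog.bound, WExp.cost, BExp.cost] at ht₁
  refine Runs.seq ((shiftNames_runs hM (e₀.trans hn) (by norm_num) (by norm_num)
    (by omega)).frame.mono ?_)
  rintro t₂ s₂ ⟨⟨h₂, ht₂⟩, hf₂⟩
  have e'₀ := hf₂.wvar 0 (by simp [shiftNames, Prog.forUp])
  have e'₁ := hf₂.wvar 1 (by simp [shiftNames, Prog.forUp])
  have e'₆ := hf₂.wvar 6 (by simp [shiftNames, Prog.forUp])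
  have e'₇ := hf₂.wvar 7 (by simp [shiftNames, Prog.forUp])
  have e'₂ := hf₂.warr 2 (by simp [shiftNames, Prog.forUp])
  refine Runs.seq ((pairNames_runs hM (by omega) (by rw [e'₂, e₂]; exact h.1)
    fun p hp => ?_).frame.mono ?_)
  · rw [h₂ p hp, e₂]; exact h.1 _ (by omega)
  rintro t₃ s₃ ⟨⟨h₃, h₄, ht₃⟩, hf₃⟩
  have e''₀ := hf₃.wvar 0 (by simp [pairNames, clearChains, linkChains, walkChains,
        walkChainsBody, Prog.forUp])
  have e''₁ := hf₃.wvar 1 (by simp [pairNames, clearChains, linkChains, walkChains,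
        walkChainsBody, Prog.forUp])
  have e''₆ := hf₃.wvar 6 (by simp [pairNames, clearChains, linkChains, walkChains,
        walkChainsBody, Prog.forUp])
  have e''₇ := hf₃.wvar 7 (by simp [pairNames, clearChains, linkChains, walkChains,
        walkChainsBody, Prog.forUp])
  refine Runs.setW (by simp; omega) ⟨?_, ?_, ?_, ?_, ?_⟩
  · simp; omega
  · simp; omega
  · simp; omega
  · have : min (2 * m) k = min m (k - m) + m := by omega
    simp only [this]
    refine IsNaming.pair hT h h (by omega) (by omega) h₃ fun p hp q hq => ?_
    rw [h₄ p hp q hq, h₂ p hp, h₂ q hq, e'₂, e₂, h₁]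
  · simp only [WExp.cost]; omega

theorem gramNames_runs {M : Machine} (hM : Fits M n) (hT : T.length = n) {s : Store}
    (hn : s.wvar 0 = n) {k : ℕ} (hk : s.wvar 1 = k) (hkn : k ≤ n)
    (h : IsNaming T n 1 (s.warr 2)) :
    Runs M gramNames s fun t s' => IsNaming T n k (s'.warr 2) ∧
      t ≤ (Nat.log 2 n + 2) * (500 * (n + 2)) := by
  have hC := hM.cells
  have hW := hM.words
  refine Runs.ite (by simp; omega) (fun hb => ?_) (fun hb => ?_)
  · simp only [BExp.val, WExp.val, hk] at hb
    refine (Runs.forUp_wp (fun p s' => s'.wvar 2 = p ∧ s'.wvar 0 = n ∧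
      ∀ q < p, s'.warr 2 q = 0) (n + 1) (by omega) (by simp [hn]) ?_ ?_).mono ?_
    · rintro p s' hp ⟨h₁, h₂, -⟩
      simp [h₁, h₂]; omega
    · rintro p s' hp ⟨h₁, h₂, h₃⟩
      simp [h₁, h₂]
      refine ⟨by omega, by omega, fun q hq => ?_⟩
      rcases hq.lt_or_eq with hq | rfl
      · simp [hq.ne, h₃ q hq]
      · simp
    · rintro t s' ⟨⟨-, -, h₁⟩, ht⟩
      refine ⟨⟨fun p hp => by rw [h₁ p (by omega)]; omega, fun p hp q hq => ?_⟩, ?_⟩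
      · rw [h₁ p (by omega), h₁ q (by omega)]; simp [hb]
      · simp only [Prog.bound, WExp.cost, BExp.cost] at ht ⊢
        nlinarith [Nat.zero_le (Nat.log 2 n)]
  · simp only [BExp.val, WExp.val, hk] at hb
    refine Runs.seq (Runs.setW (by simp; omega) ?_)
    let I : Store → Prop := fun s' => s'.wvar 0 = n ∧ s'.wvar 1 = k ∧ 1 ≤ s'.wvar 6 ∧
      s'.wvar 6 ≤ k ∧ IsNaming T n (s'.wvar 6) (s'.warr 2)
    -- The number of doublings that remain, times a bound on the time of one.
    let μ : Store → ℕ := fun s' =>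
      (if s'.wvar 6 < k then Nat.log 2 (k / s'.wvar 6) + 1 else 0) * (450 * (n + 2))
    refine (Runs.loop I μ (fun s' _ => by simp) ?_ ?_).mono ?_
    · rintro s' ⟨h₁, h₂, h₃, h₄, h₅⟩ hlt
      simp only [BExp.val, WExp.val, h₂] at hlt
      refine (doubleNames_runs hM hT h₁ h₂ hkn rfl h₄ h₅).mono ?_
      rintro t s'' ⟨h₆, h₇, h₈, h₉, ht⟩
      refine ⟨⟨h₆, h₇, by omega, by omega, by rwa [h₈]⟩, ?_⟩
      have hlog : (if s''.wvar 6 < k then Nat.log 2 (k / s''.wvar 6) + 1 else 0) + 1 ≤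
          (if s'.wvar 6 < k then Nat.log 2 (k / s'.wvar 6) + 1 else 0) := by
        rw [if_pos hlt]
        split_ifs with hlt'
        · have he : s''.wvar 6 = s'.wvar 6 * 2 := by omega
          have hge : 2 ≤ k / s'.wvar 6 := (Nat.le_div_iff_mul_le (by omega)).2 (by omega)
          have hpos := Nat.log_pos (by norm_num : 1 < 2) hge
          rw [he, ← Nat.div_div_eq_div_mul, Nat.log_div_base]
          omega
        · omega
      simp only [μ, BExp.cost, WExp.cost]
      nlinarith
    · refine ⟨by simp [hn], by simp [hk], by simp, by simp; omega, by simpa using h⟩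
    · rintro t s' ⟨⟨h₁, h₂, h₃, h₄, h₅⟩, hb', ht⟩
      simp only [BExp.val, WExp.val, h₂] at hb'
      have : s'.wvar 6 = k := by omega
      refine ⟨by rwa [this] at h₅, ?_⟩
      have hlog : (if 1 < k then Nat.log 2 (k / 1) + 1 else 0) ≤ Nat.log 2 n + 1 := by
        have := Nat.log_mono_right (b := 2) hkn
        split_ifs
        · rw [Nat.div_one]; omega
        · omega
      have hmul := Nat.mul_le_mul_right (450 * (n + 2)) hlog
      simp only [μ, BExp.cost, WExp.cost, Function.update_self, WExp.val] at ht ⊢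
      have hpos : 0 ≤ Nat.log 2 n * (n + 2) := Nat.zero_le _
      nlinarith [Nat.zero_le ((if s'.wvar 6 < k then Nat.log 2 (k / s'.wvar 6) + 1 else 0) *
        (450 * (n + 2)))]

/-- Names for the symbols in the array `20`, for the substrings of length `k` in the array `30`,
and for those of length `k + 1` in the array `40`. The word variable `1` is cut down to `n`. -/
def nameSubstrings (D : ℕ) : Prog :=
  symbolNames D ;; copyNames 20 ;;
  .ite (.wlt (.var 0) (.var 1)) (.setW 1 (.var 0)) .skip ;;
  gramNames ;; copyNames 30 ;; shiftNames 20 1 ;; pairNames ;; copyNames 40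

theorem symbolNames_keeps {l : Loc} (h : digitRound.Keeps l) (D : ℕ) : (symbolNames D).Keeps l := by
  induction D with
  | zero =>
    simp [digitRound, pairNames, clearChains, linkChains, walkChains, walkChainsBody,
      Prog.forUp] at h
    simp [symbolNames, h]
  | succ D ih => exact ⟨ih, h⟩

end Naming

/-- By `hσ` the symbols are determined by `D` digits. The order is cut down to `n`, after which
logarithmically many doublings give the names of the contexts; pairing these with the symbol behind
gives the longer strings. -/
theorem nameSubstrings_runs {M : Machine} {n σ k D : ℕ} (hM : Fits M n) (h1 : 1 ≤ n)
    {T : List (Fin σ)} (hT : T.length = n) {s : Store} (hn : s.wvar 0 = n) (hk : s.wvar 1 = k)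
    (hσ : σ ≤ (n + 1) ^ D) (hTs : ∀ p, s.warr 0 p = ((T[p]?).map Fin.val).getD 0)
    (h0 : ∀ p, s.warr 2 p = 0) :
    Runs M (nameSubstrings D) s fun t s' => s'.wvar 1 = min k n ∧
      IsNaming T n 1 (s'.warr 20) ∧ IsNaming T n (min k n) (s'.warr 30) ∧
      IsNaming T n (min k n + 1) (s'.warr 40) ∧
      t ≤ (Nat.log 2 n + D + 5) * (500 * (n + 2)) := by
  have hC := hM.cells
  have hW := hM.words
  have hpair : ∀ l, pairNames.Keeps l ↔ l ≠ .wvar 2 ∧ l ≠ .wvar 3 ∧ l ≠ .wvar 4 ∧ l ≠ .wvar 5 ∧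
      l ≠ .warr 2 ∧ l ≠ .warr 4 ∧ l ≠ .warr 5 ∧ l ≠ .warr 6 ∧ l ≠ .warr 7 := by
    intro l
    simp [pairNames, clearChains, linkChains, walkChains, walkChainsBody, Prog.forUp]
    tauto
  refine Runs.seq ((symbolNames_runs_aux hM h1 hn h0 D).frame.mono ?_)
  rintro t₁ s₁ ⟨⟨a₁, a₂, a₃, a₄, ht₁⟩, hf₁⟩
  have b₁ := hf₁.wvar 1 (symbolNames_keeps (by simp [digitRound, Prog.forUp, hpair]) D)
  have hnam : IsNaming T n 1 (s₁.warr 2) := by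
    refine ⟨a₂, fun p hp q hq => ?_⟩
    have hlt : ∀ p, s.warr 0 p < (n + 1) ^ D := by
      intro p
      rw [hTs]
      rcases lt_or_ge p T.length with h | h
      · rw [List.getElem?_eq_getElem h]
        exact (T[p]).2.trans_le hσ
      · rw [List.getElem?_eq_none h]
        simp
    rw [a₃ p hp q hq, Nat.mod_eq_of_lt (hlt p), Nat.mod_eq_of_lt (hlt q), hTs, hTs]
    have hnil : (T.drop n).take 1 = [] := by rw [List.drop_eq_nil_of_le hT.le]; rfl
    have hcons : ∀ p (h : p < T.length), (T.drop p).take 1 = [T[p]] := by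
      intro p h
      rw [List.drop_eq_getElem_cons h]; rfl
    rcases hp.lt_or_eq with hp | rfl <;> rcases hq.lt_or_eq with hq | rfl
    · rw [hcons p (by omega), hcons q (by omega), List.getElem?_eq_getElem (by omega),
        List.getElem?_eq_getElem (by omega)]
      simp [hp.ne, hq.ne, Fin.val_inj]
    · rw [hcons p (by omega), hnil]; simp [hp.ne]
    · rw [hcons q (by omega), hnil]; simp [hq.ne]
    · simp
  refine Runs.seq ((copyNames_runs hM a₁ (by norm_num)).frame.mono ?_)
  rintro t₂ s₂ ⟨⟨a₅, ht₂⟩, hf₂⟩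
  have b₂ := hf₂.wvar 0 (by simp [copyNames, Prog.forUp])
  have b₃ := hf₂.wvar 1 (by simp [copyNames, Prog.forUp])
  have b₄ := hf₂.warr 2 (by simp [copyNames, Prog.forUp])
  refine Runs.seq ((Prog.wp.runs (Q := fun s' => s'.wvar 1 = min k n) ?_).frame.mono ?_)
  · simp [b₂, a₁, b₃, b₁, hk]
    omega
  rintro t₃ s₃ ⟨⟨ht₃, a₆⟩, hf₃⟩
  simp only [Prog.bound, WExp.cost, BExp.cost] at ht₃
  have b₅ := hf₃.wvar 0 (by simp)
  have b₆ := hf₃.warr 2 (by simp)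
  have b₇ := hf₃.warr 20 (by simp)
  refine Runs.seq ((gramNames_runs hM hT (by omega) a₆ (min_le_right _ _)
    (by rwa [b₆, b₄])).frame.mono ?_)
  rintro t₄ s₄ ⟨⟨a₇, ht₄⟩, hf₄⟩
  have b₈ := hf₄.wvar 0 (by simp [gramNames, Prog.forUp, doubleNames, shiftNames, hpair])
  have b₉ := hf₄.wvar 1 (by simp [gramNames, Prog.forUp, doubleNames, shiftNames, hpair])
  have b₁₀ := hf₄.warr 20 (by simp [gramNames, Prog.forUp, doubleNames, shiftNames, hpair])
  refine Runs.seq ((copyNames_runs hM (by omega) (by norm_num)).frame.mono ?_)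
  rintro t₅ s₅ ⟨⟨a₈, ht₅⟩, hf₅⟩
  have c₁ := hf₅.wvar 0 (by simp [copyNames, Prog.forUp])
  have c₂ := hf₅.wvar 1 (by simp [copyNames, Prog.forUp])
  have c₃ := hf₅.warr 2 (by simp [copyNames, Prog.forUp])
  have c₄ := hf₅.warr 20 (by simp [copyNames, Prog.forUp])
  refine Runs.seq ((shiftNames_runs hM (by omega) (b := 20) (x := 1) (by norm_num) (by norm_num)
    (by omega)).frame.mono ?_)
  rintro t₆ s₆ ⟨⟨a₉, ht₆⟩, hf₆⟩
  have c₅ := hf₆.wvar 0 (by simp [shiftNames, Prog.forUp])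
  have c₆ := hf₆.wvar 1 (by simp [shiftNames, Prog.forUp])
  have c₇ := hf₆.warr 2 (by simp [shiftNames, Prog.forUp])
  have c₈ := hf₆.warr 20 (by simp [shiftNames, Prog.forUp])
  have c₉ := hf₆.warr 30 (by simp [shiftNames, Prog.forUp])
  have hn20 : IsNaming T n 1 (s₅.warr 20) := by
    rw [c₄, b₁₀, b₇]; exact hnam.congr a₅
  refine Runs.seq ((pairNames_runs hM (by omega) (by rw [c₇, c₃]; exact a₇.1)
    fun p hp => ?_).frame.mono ?_)
  · rw [a₉ p hp]; exact hn20.1 _ (by omega)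
  rintro t₇ s₇ ⟨⟨d₁, d₂, ht₇⟩, hf₇⟩
  have c₁₀ := hf₇.wvar 0 (by simp [hpair])
  have c₁₁ := hf₇.wvar 1 (by simp [hpair])
  have c₁₂ := hf₇.warr 20 (by simp [hpair])
  have c₁₃ := hf₇.warr 30 (by simp [hpair])
  refine (copyNames_runs hM (by omega) (by norm_num)).frame.mono ?_
  rintro t₈ s₈ ⟨⟨d₃, ht₈⟩, hf₈⟩
  have c₁₄ := hf₈.wvar 1 (by simp [copyNames, Prog.forUp])
  have c₁₅ := hf₈.warr 20 (by simp [copyNames, Prog.forUp])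
  have c₁₆ := hf₈.warr 30 (by simp [copyNames, Prog.forUp])
  refine ⟨by omega, by rw [c₁₅, c₁₂, c₈]; exact hn20, ?_, ?_, ?_⟩
  · rw [c₁₆, c₁₃, c₉]; exact a₇.congr a₈
  · refine IsNaming.congr (IsNaming.pair hT a₇ hn20 le_rfl (by omega) d₁ fun p hp q hq => ?_) d₃
    rw [d₂ p hp q hq, c₇, c₃, a₉ p hp, a₉ q hq, c₂, b₉, a₆]
  · linarith [Nat.zero_le (D * n), Nat.zero_le D, Nat.zero_le (Nat.log 2 n * n),
      Nat.zero_le (Nat.log 2 n)]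

/-! ### Links between equal names -/

/-- State of the preprocessing of the sequence `a` after `t` positions. -/
structure Prepared (a : ℕ → ℕ) (n t : ℕ) (pv nx rank F L last : ℕ → ℕ) : Prop where
  linked : Linked a t pv nx
  nx_lt : ∀ p < t, nx p < t ∨ nx p = n + 1
  rank_eq : ∀ p < t, rank p = cnt a 0 p (a p)
  runs : RunLinks a 0 t (fun _ => False) F L
  last_le : ∀ v ≤ n, last v ≤ t
  last_eq : ∀ v ≤ n, ∀ q, last v = q + 1 → a q = v
  lt_last : ∀ q < t, a q ≤ n → q < last (a q)

section Prepared

variable {a pv nx rank F L last : ℕ → ℕ} {n t : ℕ}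

theorem Prepared.zero (h : ∀ v ≤ n, last v = 0) : Prepared a n 0 pv nx rank F L last :=
  ⟨⟨by omega, by omega, by omega, by omega, by omega, by omega⟩, by omega, by omega,
    fun p q hr => by have := hr.lt; omega, fun v hv => (h v hv).le,
    fun v hv q hq => by rw [h v hv] at hq; omega, by omega⟩

theorem Prepared.last_succ (h : Prepared a n t pv nx rank F L last) (ha : a t ≤ n) :
    (∀ v ≤ n, Function.update last (a t) (t + 1) v ≤ t + 1) ∧
    (∀ v ≤ n, ∀ q, Function.update last (a t) (t + 1) v = q + 1 → a q = v) ∧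
    (∀ q < t + 1, a q ≤ n → q < Function.update last (a t) (t + 1) (a q)) := by
  refine ⟨fun v hv => ?_, fun v hv q hq => ?_, fun q hq hqn => ?_⟩
  · by_cases hva : v = a t
    · simp [hva]
    · rw [Function.update_of_ne hva]; have := h.last_le v hv; omega
  · by_cases hva : v = a t
    · rw [hva, Function.update_self] at hq
      rw [hva, show q = t by omega]
    · rw [Function.update_of_ne hva] at hq
      exact h.last_eq v hv q hq
  · by_cases hva : a q = a t
    · rw [hva, Function.update_self]; omega
    · rw [Function.update_of_ne hva]
      have hne : q ≠ t := by rintro rfl; exact hva rfl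
      exact h.lt_last q (by omega) hqn

theorem RunLinks.restrict {p q : ℕ} (hr : IsRun a 0 (t + 1) (fun _ => False) p q)
    (hne : a p ≠ a t) : IsRun a 0 t (fun _ => False) p q :=
  ⟨hr.le_fst, hr.le, by
    have := hr.lt
    have : q ≠ t := by rintro rfl; exact hne hr.eq.symm
    omega, hr.eq, hr.nob, hr.fst, fun q' h₁ h₂ h₃ => hr.lst q' h₁ (by omega) h₃⟩

/-- A value seen for the first time forms a run of its own. The default `n + 1` for the next
position exceeds every bound in use. -/
theorem Prepared.succ_none (h : Prepared a n t pv nx rank F L last) (ha : a t ≤ n) (htn : t ≤ n)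
    (hl : last (a t) = 0) :
    Prepared a n (t + 1) (Function.update pv t 0) (Function.update nx t (n + 1))
      (Function.update rank t 0) (Function.update F t t) (Function.update L t t)
      (Function.update last (a t) (t + 1)) := by
  have hnone : ∀ q < t, a q ≠ a t := by
    intro q hq he
    have := h.lt_last q hq (by omega)
    rw [he, hl] at this
    omega
  obtain ⟨h₁, h₂, h₃⟩ := h.last_succ ha
  refine ⟨⟨fun p hp => ?_, fun p hp q hq => ?_, fun p hp q hq he => ?_, fun p hp => ?_,
    fun p hp hp' => ?_, fun p hp q hq hq' he => ?_⟩, fun p hp => ?_, fun p hp => ?_,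
    fun p q hr => ?_, h₁, h₂, h₃⟩
  · by_cases hpt : p = t
    · simp [hpt]
    · rw [Function.update_of_ne hpt]; exact h.linked.pv_le p (by omega)
  · by_cases hpt : p = t
    · simp [hpt] at hq
    · rw [Function.update_of_ne hpt] at hq; exact h.linked.pv_eq p (by omega) q hq
  · by_cases hpt : p = t
    · subst hpt; exact absurd he (hnone q hq)
    · rw [Function.update_of_ne hpt]; exact h.linked.lt_pv p (by omega) q hq he
  · by_cases hpt : p = t
    · simp [hpt]; omega
    · rw [Function.update_of_ne hpt]; exact h.linked.lt_nx p (by omega)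
  · by_cases hpt : p = t
    · simp [hpt] at hp'; omega
    · rw [Function.update_of_ne hpt] at hp' ⊢
      rcases h.nx_lt p (by omega) with h' | h'
      · exact h.linked.nx_eq p (by omega) h'
      · omega
  · by_cases hpt : p = t
    · omega
    · rw [Function.update_of_ne hpt]
      rcases Nat.lt_succ_iff_lt_or_eq.1 hq' with h' | rfl
      · exact h.linked.nx_le p (by omega) q hq h' he
      · exact absurd he.symm (hnone p hq)
  · by_cases hpt : p = t
    · simp [hpt]
    · rw [Function.update_of_ne hpt]
      rcases h.nx_lt p (by omega) with h' | h'
      · left; omega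
      · exact Or.inr h'
  · by_cases hpt : p = t
    · subst hpt
      rw [Function.update_self, eq_comm, cnt_eq_zero]
      exact fun q _ hq => hnone q hq
    · rw [Function.update_of_ne hpt]; exact h.rank_eq p (by omega)
  · by_cases he : a p = a t
    · have hpt : p = t := by
        by_contra hcon
        have := hr.le
        have := hr.lt
        exact hnone p (by omega) he
      subst hpt
      have : q = p := by
        have := hr.le
        have := hr.lt
        omega
      simp [this]
    · have hr' := RunLinks.restrict hr he
      have hpt : p ≠ t := by rintro rfl; exact he rfl
      rw [Function.update_of_ne hpt, Function.update_of_ne (hr'.lt.ne)]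
      exact h.runs p q hr'

/-- As long as there are no boundaries, all positions of one value form a single run. The new
position is appended behind the last occurrence `q₀`, whose `F` is the start of that run. -/
theorem Prepared.succ_some (h : Prepared a n t pv nx rank F L last) (ha : a t ≤ n) (htn : t ≤ n)
    {q₀ : ℕ} (hl : last (a t) = q₀ + 1) :
    Prepared a n (t + 1) (Function.update pv t (q₀ + 1))
      (Function.update (Function.update nx t (n + 1)) q₀ t)
      (Function.update rank t (rank q₀ + 1)) (Function.update F t (F q₀))
      (Function.update L (F q₀) t) (Function.update last (a t) (t + 1)) := by
  have hq₀ : q₀ < t := by have := h.last_le _ ha; omega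
  have ha₀ : a q₀ = a t := h.last_eq _ ha q₀ hl
  have hmax : ∀ q < t, a q = a t → q ≤ q₀ := by
    intro q hq he
    have := h.lt_last q hq (by omega)
    rw [he, hl] at this
    omega
  obtain ⟨h₁, h₂, h₃⟩ := h.last_succ ha
  obtain ⟨p₀, hr₀⟩ := exists_isRun_of_lst (a := a) (i := 0) (m := t) (B := fun _ => False)
    (Nat.zero_le q₀) hq₀ fun q' h₄ h₅ h₆ => by
      have := hmax q' h₅ (h₆.trans ha₀); omega
  have hF₀ := (h.runs _ _ hr₀).2
  refine ⟨⟨fun p hp => ?_, fun p hp q hq => ?_, fun p hp q hq he => ?_, fun p hp => ?_,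
    fun p hp hp' => ?_, fun p hp q hq hq' he => ?_⟩, fun p hp => ?_, fun p hp => ?_,
    fun p q hr => ?_, h₁, h₂, h₃⟩
  · by_cases hpt : p = t
    · simp [hpt]; omega
    · rw [Function.update_of_ne hpt]; exact h.linked.pv_le p (by omega)
  · by_cases hpt : p = t
    · subst hpt
      rw [Function.update_self] at hq
      rw [show q = q₀ by omega, ha₀]
    · rw [Function.update_of_ne hpt] at hq; exact h.linked.pv_eq p (by omega) q hq
  · by_cases hpt : p = t
    · subst hpt
      rw [Function.update_self]; have := hmax q hq he; omega
    · rw [Function.update_of_ne hpt]; exact h.linked.lt_pv p (by omega) q hq he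
  · by_cases hpq : p = q₀
    · simp [hpq, hq₀]
    rw [Function.update_of_ne hpq]
    by_cases hpt : p = t
    · simp [hpt]; omega
    · rw [Function.update_of_ne hpt]; exact h.linked.lt_nx p (by omega)
  · by_cases hpq : p = q₀
    · simp [hpq, ha₀]
    rw [Function.update_of_ne hpq] at hp' ⊢
    by_cases hpt : p = t
    · simp [hpt] at hp'; omega
    · rw [Function.update_of_ne hpt] at hp' ⊢
      rcases h.nx_lt p (by omega) with h' | h'
      · exact h.linked.nx_eq p (by omega) h'
      · omega
  · by_cases hpq : p = q₀
    · subst hpq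
      rw [Function.update_self]
      by_contra hcon
      have := hmax q (by omega) (he.trans ha₀)
      omega
    rw [Function.update_of_ne hpq]
    by_cases hpt : p = t
    · omega
    · rw [Function.update_of_ne hpt]
      rcases Nat.lt_succ_iff_lt_or_eq.1 hq' with h' | rfl
      · exact h.linked.nx_le p (by omega) q hq h' he
      · have := hmax p hq he.symm
        have := h.linked.nx_le p (by omega) q₀ (by omega) hq₀ (ha₀.trans he)
        omega
  · by_cases hpq : p = q₀
    · simp [hpq]
    rw [Function.update_of_ne hpq]
    by_cases hpt : p = t
    · simp [hpt]
    · rw [Function.update_of_ne hpt]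
      rcases h.nx_lt p (by omega) with h' | h'
      · left; omega
      · exact Or.inr h'
  · by_cases hpt : p = t
    · subst hpt
      rw [Function.update_self, h.rank_eq q₀ hq₀, ha₀,
        cnt_add (Nat.zero_le q₀) hq₀.le, cnt_succ_left hq₀, if_pos ha₀,
        (cnt_eq_zero (l := q₀ + 1)).2]
      intro q h₅ h₆ h₇
      have := hmax q h₆ h₇
      omega
    · rw [Function.update_of_ne hpt]; exact h.rank_eq p (by omega)
  · rw [hF₀]
    by_cases he : a p = a t
    · have hq : q = t := by
        by_contra hcon
        have := hr.lt
        obtain ⟨x, -, -, hx⟩ := hr.lst t (by omega) (by omega) he.symm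
        exact hx
      have hpt : p < t := by
        by_contra hcon
        have := hr.le
        obtain ⟨x, -, -, hx⟩ := hr.fst q₀ (by omega) (by omega) (ha₀.trans he.symm)
        exact hx
      have hr' : IsRun a 0 t (fun _ => False) p q₀ :=
        ⟨by omega, hmax p hpt he, hq₀, ha₀.trans he.symm, fun x _ _ hx => hx, hr.fst,
          fun q' h₄ h₅ h₆ => by have := hmax q' h₅ (h₆.trans he); omega⟩
      have hpp : p = p₀ := by rw [← (h.runs _ _ hr').2, hF₀]
      simp [hq, hpp]
    · have hr' := RunLinks.restrict hr he
      have hpp : p ≠ p₀ := by rintro rfl; exact he (hr₀.eq.symm.trans ha₀)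
      rw [Function.update_of_ne hpp, Function.update_of_ne (hr'.lt.ne)]
      exact h.runs p q hr'

end Prepared

/-- Preprocesses the names in the array `b` below the word variable `y`: the arrays `b + 1`,
`b + 2`, `b + 3`, `b + 5`, `b + 6` receive the previous position plus one, the next position, the
rank, the first and the last position; the array `b + 7` is auxiliary. -/
def prepare (b y : ℕ) : Prog :=
  .forUp 2 (.var y)
    (.setW 3 (.arr (b + 7) (.arr b (.var 2))) ;;
     .storeW (b + 1) (.var 2) (.var 3) ;;
     .storeW (b + 2) (.var 2) (.add (.var 0) (.lit 1)) ;;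
     .ite (.weq (.var 3) (.lit 0))
       (.storeW (b + 3) (.var 2) (.lit 0) ;;
        .storeW (b + 5) (.var 2) (.var 2) ;;
        .storeW (b + 6) (.var 2) (.var 2))
       (.setW 3 (.sub (.var 3) (.lit 1)) ;;
        .storeW (b + 3) (.var 2) (.add (.arr (b + 3) (.var 3)) (.lit 1)) ;;
        .storeW (b + 2) (.var 3) (.var 2) ;;
        .storeW (b + 5) (.var 2) (.arr (b + 5) (.var 3)) ;;
        .storeW (b + 6) (.arr (b + 5) (.var 3)) (.var 2)) ;;
     .storeW (b + 7) (.arr b (.var 2)) (.add (.var 2) (.lit 1)))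

theorem prepare_runs {M : Machine} {n m : ℕ} (hM : Fits M n) {s : Store} (hn : s.wvar 0 = n)
    {b y : ℕ} (hy : y ≠ 2) (hy' : y ≠ 3) (hm : s.wvar y = m) (hmn : m ≤ n)
    (ha : ∀ p ≤ n, s.warr b p ≤ n) (h0 : ∀ v, s.warr (b + 7) v = 0) :
    Runs M (prepare b y) s fun t s' =>
      Prepared (s.warr b) n m (s'.warr (b + 1)) (s'.warr (b + 2)) (s'.warr (b + 3))
        (s'.warr (b + 5)) (s'.warr (b + 6)) (s'.warr (b + 7)) ∧ t ≤ 100 * (n + 2) := by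
  have hC := hM.cells
  have hW := hM.words
  refine (Runs.forUp_wp (fun p s' => s'.wvar 2 = p ∧ s'.wvar 0 = n ∧ s'.wvar y = m ∧
    s'.warr b = s.warr b ∧ Prepared (s.warr b) n p (s'.warr (b + 1)) (s'.warr (b + 2))
      (s'.warr (b + 3)) (s'.warr (b + 5)) (s'.warr (b + 6)) (s'.warr (b + 7))) m (by omega)
      ?_ ?_ ?_).mono ?_
  · refine ⟨by simp, by simp [hn], by simp [hy, hm], rfl, Prepared.zero fun v _ => h0 v⟩
  · rintro p s' hp ⟨h₁, h₂, h₃, -⟩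
    simp [h₁, h₃]
  · rintro p s' hp ⟨h₁, h₂, h₃, h₄, h₅⟩
    have hap := ha p (by omega)
    simp [h₁, h₂, h₃, h₄, hy, hy']
    and_intros
    any_goals omega
    · intro hl
      and_intros
      any_goals omega
      rw [hl]
      exact h₅.succ_none hap (by omega) hl
    · intro hl
      obtain ⟨q, hq⟩ : ∃ q, s'.warr (b + 7) (s.warr b p) = q + 1 :=
        ⟨s'.warr (b + 7) (s.warr b p) - 1, by omega⟩
      have hqp := h₅.last_le _ hap
      have hnew := h₅.succ_some hap (by omega) hq
      -- Needed so that the increment of the rank does not overflow; the next bound makes the first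
      -- position a valid address.
      have hr : s'.warr (b + 3) q ≤ n := by
        rw [h₅.rank_eq q (by omega)]
        exact (cnt_le _ _ _ _).trans (by omega)
      have hF : s'.warr (b + 5) q ≤ n := by
        obtain ⟨p₀, hr₀⟩ := exists_isRun_of_lst (a := s.warr b) (i := 0) (m := p)
          (B := fun _ => False) (q := q) (Nat.zero_le _) (by omega) fun q' h₆ h₇ h₈ => by
            have h₉ := h₅.last_eq _ hap q hq
            have := h₅.lt_last q' h₇ (by omega)
            rw [h₈, h₉] at this
            omega
        rw [(h₅.runs _ _ hr₀).2]
        have := hr₀.le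
        omega
      rw [hq] at hqp ⊢
      have hqne : q ≠ p := by omega
      simp [hqne]
      and_intros
      all_goals omega
  · rintro t s' ⟨⟨-, -, -, -, h⟩, ht⟩
    refine ⟨h, ?_⟩
    simp only [Prog.bound, WExp.cost, BExp.cost] at ht
    have : m + 1 ≤ n + 2 := by omega
    nlinarith

/-! ### Tables -/

/-- The table of weights, in the real array `0`. -/
def weightTable (adaptive : Bool) : Prog :=
  .forUp 2 .npos (if adaptive then
      .ite (.weq (.var 2) (.lit 0)) (.storeR 0 (.var 2) (.ofWord (.lit 0)))
        (.storeR 0 (.var 2) (.add (.arr 0 (.sub (.var 2) (.lit 1))) (.log₂ (.var 2))))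
    else .storeR 0 (.var 2) (.mul (.ofWord (.var 2)) (.log₂ (.var 2))))

theorem weightTable_runs {M : Machine} {n : ℕ} (hM : Fits M n) {s : Store} (hn : s.wvar 0 = n)
    (adaptive : Bool) :
    Runs M (weightTable adaptive) s fun t s' => (∀ p ≤ n, s'.rarr 0 p = weight adaptive p) ∧
      t ≤ 60 * (n + 2) := by
  have hC := hM.cells
  have hW := hM.words
  refine (Runs.forUp_wp (fun p s' => s'.wvar 2 = p ∧ s'.wvar 0 = n ∧
    ∀ q < p, s'.rarr 0 q = weight adaptive q) (n + 1) (by omega) (by simp [hn]) ?_ ?_).mono ?_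
  · rintro p s' hp ⟨h₁, h₂, -⟩
    simp [h₁, h₂]; omega
  · rintro p s' hp ⟨h₁, h₂, h₃⟩
    cases adaptive
    · simp [h₁, h₂]
      refine ⟨by omega, fun q hq => ?_⟩
      rcases hq.lt_or_eq with hq | rfl
      · simp [hq.ne, h₃ q hq]
      · simp [weight_false]
    · simp [h₁, h₂]
      and_intros
      any_goals omega
      · rintro rfl
        refine ⟨by omega, by omega, by simp [weight_zero]⟩
      · intro hp0
        and_intros
        any_goals omega
        intro q hq
        rcases hq.lt_or_eq with hq | rfl
        · simp [hq.ne, h₃ q hq]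
        · obtain ⟨r, rfl⟩ : ∃ r, q = r + 1 := ⟨q - 1, by omega⟩
          simp [h₃ r (by omega), weight_true_succ]
  · rintro t s' ⟨⟨-, -, h⟩, ht⟩
    refine ⟨fun p hp => h p (by omega), ?_⟩
    cases adaptive <;> simp [Prog.bound, WExp.cost, BExp.cost, RExp.cost] at ht <;> omega

/-- The overhead of single symbols, in the real variable `2`, and the distances of the partition
into single symbols, in the real array `3`, with predecessors in the word array `10`. -/
def initDist : Prog :=
  .setR 2 (.overhead (.lit 1) (.lit 1)) ;;
  .forUp 2 .npos
    (.storeR 3 (.var 2) (.mul (.ofWord (.var 2)) (.var 2)) ;;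
     .storeW 10 (.var 2) (.sub (.var 2) (.lit 1)))

theorem initDist_runs {M : Machine} {n : ℕ} (hM : Fits M n) {s : Store} (hn : s.wvar 0 = n) :
    Runs M initDist s fun t s' => s'.rvar 2 = M.f 1 1 ∧
      (∀ p ≤ n, s'.rarr 3 p = p * M.f 1 1 ∧ s'.warr 10 p = p - 1) ∧ t ≤ 60 * (n + 2) := by
  have hC := hM.cells
  have hW := hM.words
  refine Runs.seq ((Prog.wp.runs (Q := fun s' => s'.rvar 2 = M.f 1 1 ∧ s'.wvar 0 = n)
    (by simp [hn]; omega)).mono ?_)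
  rintro t₁ s₁ ⟨ht₁, h₁, h₂⟩
  simp only [Prog.bound, WExp.cost, RExp.cost] at ht₁
  refine (Runs.forUp_wp (fun p s' => s'.wvar 2 = p ∧ s'.wvar 0 = n ∧ s'.rvar 2 = M.f 1 1 ∧
    ∀ q < p, s'.rarr 3 q = q * M.f 1 1 ∧ s'.warr 10 q = q - 1) (n + 1) (by omega)
    (by simp [h₁, h₂]) ?_ ?_).mono ?_
  · rintro p s' hp ⟨h₁, h₂, -⟩
    simp [h₁, h₂]; omega
  · rintro p s' hp ⟨h₁, h₂, h₃, h₄⟩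
    simp [h₁, h₂, h₃]
    and_intros
    any_goals omega
    intro q hq
    rcases hq.lt_or_eq with hq | rfl
    · simp [hq.ne, h₄ q hq]
    · simp
  · rintro t s' ⟨⟨-, -, h₃, h⟩, ht⟩
    refine ⟨h₃, fun p hp => h p (by omega), ?_⟩
    simp only [Prog.bound, WExp.cost, RExp.cost] at ht
    omega

/-- One more threshold. -/
def nextThreshold : Prog :=
  .setR 3 (.mul (.var 3) (.add (.ofWord (.lit 1)) (.var 1))) ;;
  .setW 9 (.add (.var 9) (.lit 1)) ;;
  .storeR 1 (.var 9) (.var 3)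

/-- The thresholds, in the real array `1`, up to the index in the word variable `9`; the real
variable `3` holds the last one, and the real variable `4` the cost of the partition into single
symbols. -/
def thresholds : Prog :=
  .setR 3 (.var 2) ;; .setR 4 (.mul (.ofWord (.var 0)) (.var 2)) ;;
  .setW 9 (.lit 0) ;; .storeR 1 (.lit 0) (.var 3) ;;
  .loop (.conj (.wlt (.var 9) (.var 0)) (.neg (.rle (.var 4) (.var 3)))) nextThreshold

/-- The list ends at the first threshold that reaches the cost of the trivial partition. The cap at
`n` keeps it in memory if `ε` is tiny. For `c = 0` it ends at once, with `R = 0`. -/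
theorem thresholds_runs {M : Machine} {n : ℕ} (hM : Fits M n) {s : Store} (hn : s.wvar 0 = n)
    {c ε : ℝ} (hc : s.rvar 2 = c) (hε : s.rvar 1 = ε) :
    Runs M thresholds s fun t s' => ∃ R, s'.wvar 9 = R ∧ R ≤ n ∧
      (∀ r ≤ R, s'.rarr 1 r = c * (1 + ε) ^ r) ∧ s'.rvar 3 = c * (1 + ε) ^ R ∧
      s'.rvar 4 = n * c ∧ (∀ r < R, c * (1 + ε) ^ r < n * c) ∧
      (R = n ∨ n * c ≤ c * (1 + ε) ^ R) ∧ t ≤ 60 * (R + 1) := by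
  have hC := hM.cells
  have hW := hM.words
  refine Runs.seq ((Prog.wp.runs (Q := fun s' => s'.wvar 0 = n ∧ s'.rvar 1 = ε ∧
    s'.rvar 2 = c ∧ s'.rvar 3 = c) (by simp [hn, hc, hε])).mono ?_)
  rintro t₁ s₁ ⟨ht₁, a₁, a₂, a₃, a₄⟩
  refine Runs.seq ((Prog.wp.runs (Q := fun s' => s'.wvar 0 = n ∧ s'.rvar 1 = ε ∧
    s'.rvar 3 = c ∧ s'.rvar 4 = n * c) (by simp [a₁, a₂, a₃, a₄])).mono ?_)
  rintro t₂ s₂ ⟨ht₂, b₁, b₂, b₃, b₄⟩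
  refine Runs.seq ((Prog.wp.runs (Q := fun s' => s'.wvar 0 = n ∧ s'.wvar 9 = 0 ∧ s'.rvar 1 = ε ∧
    s'.rvar 3 = c ∧ s'.rvar 4 = n * c) (by simp [b₁, b₂, b₃, b₄]; omega)).mono ?_)
  rintro t₃ s₃ ⟨ht₃, c₁, c₂, c₃, c₄, c₅⟩
  let I : Store → Prop := fun s' => s'.wvar 0 = n ∧ s'.wvar 9 ≤ n ∧ s'.rvar 1 = ε ∧
    s'.rvar 3 = c * (1 + ε) ^ s'.wvar 9 ∧ s'.rvar 4 = n * c ∧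
    (∀ r ≤ s'.wvar 9, s'.rarr 1 r = c * (1 + ε) ^ r) ∧
    (∀ r < s'.wvar 9, c * (1 + ε) ^ r < n * c)
  refine Runs.seq ((Prog.wp.runs (Q := fun s' => I s' ∧ s'.wvar 9 = 0)
    (by simp [I, c₁, c₂, c₃, c₄, c₅]; omega)).mono ?_)
  rintro t₄ s₄ ⟨ht₄, hI, d₁⟩
  simp only [Prog.bound, WExp.cost, RExp.cost] at ht₁ ht₂ ht₃ ht₄
  have hb : nextThreshold.bound ≤ 20 := by decide
  -- The measure counts down from the number of rounds, so that the time is linear in it.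
  obtain ⟨R, hR⟩ : ∃ R, (R = n ∨ n * c ≤ c * (1 + ε) ^ R) ∧ R ≤ n ∧
      ∀ r < R, ¬ (n * c ≤ c * (1 + ε) ^ r) := by
    classical
    by_cases h : ∃ r < n, n * c ≤ c * (1 + ε) ^ r
    · refine ⟨Nat.find h, Or.inr (Nat.find_spec h).2, (Nat.find_spec h).1.le, fun r hr hr' => ?_⟩
      exact Nat.find_min h hr ⟨hr.trans (Nat.find_spec h).1, hr'⟩
    · push Not at h
      exact ⟨n, Or.inl rfl, le_rfl, fun r hr => not_le.2 (h r hr)⟩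
  refine (Runs.loop (fun s' => I s' ∧ s'.wvar 9 ≤ R) (fun s' => 30 * (R - s'.wvar 9))
    ?_ ?_ ?_).mono ?_
  · rintro s' ⟨⟨h₁, h₂, -⟩, -⟩
    simp
  · rintro s' ⟨⟨h₁, h₂, h₃, h₄, h₅, h₆, h₇⟩, h₈⟩ hb'
    simp only [BExp.val, WExp.val, RExp.val, h₁, h₄, h₅, not_le] at hb'
    have hlt : s'.wvar 9 < R := by
      rcases h₈.lt_or_eq with h | h
      · exact h
      · rcases hR.1 with h' | h'
        · omega
        · rw [h] at hb'; exact absurd hb'.2 (not_lt.2 h')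
    refine (Prog.wp.runs (Q := fun s'' => I s'' ∧ s''.wvar 9 = s'.wvar 9 + 1) ?_).mono ?_
    · have key : ∀ r ≤ s'.wvar 9 + 1, Function.update (s'.rarr 1) (s'.wvar 9 + 1)
          (c * (1 + ε) ^ s'.wvar 9 * (1 + ε)) r = c * (1 + ε) ^ r := by
        intro r hr
        rcases hr.lt_or_eq with hr | rfl
        · rw [Function.update_of_ne hr.ne]; exact h₆ r (by omega)
        · rw [Function.update_self, pow_succ, mul_assoc]
      have key' : ∀ r ≤ s'.wvar 9, c * (1 + ε) ^ r < n * c := by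
        intro r hr
        rcases hr.lt_or_eq with hr | rfl
        · exact h₇ r hr
        · exact hb'.2
      simp [nextThreshold, I, h₁, h₃, h₄, h₅]
      and_intros
      any_goals omega
      · rw [pow_succ, mul_assoc]
    · rintro t s'' ⟨ht, h₉, h₁₀⟩
      refine ⟨⟨h₉, by omega⟩, ?_⟩
      simp only [BExp.cost, WExp.cost, RExp.cost]
      omega
  · exact ⟨hI, by omega⟩
  · rintro t s' ⟨⟨⟨h₁, h₂, h₃, h₄, h₅, h₆, h₇⟩, h₈⟩, hb', ht⟩
    simp only [BExp.val, WExp.val, RExp.val, h₁, h₄, h₅, not_and_or, not_not, not_lt] at hb'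
    have he : s'.wvar 9 = R := by
      by_contra hcon
      rcases hb' with h | h
      · omega
      · exact hR.2.2 _ (by omega) h
    refine ⟨R, he, hR.2.1, by rwa [he] at h₆, by rwa [he] at h₄, h₅, by rwa [he] at h₇, hR.1, ?_⟩
    simp only [BExp.cost, WExp.cost, RExp.cost] at ht
    omega

/-! ### Memory that stays fixed -/

/-- The two memories agree on the parts with the property `K`. -/
def Agree (K : Loc → Prop) (s₀ s : Store) : Prop := ∀ l, K l → l.Same s₀ s

/-- The parts of the memory that are fixed after the preprocessing. -/
def Static : Loc → Prop
  | .wvar x => x ∈ [0, 1, 8, 9]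
  | .warr a => a ∈ [20, 21, 22, 30, 31, 32, 33, 40, 41, 42, 43]
  | .rvar x => x ∈ [0, 1, 2]
  | .rarr a => a ∈ [0, 1]

/-- The entropy part of the cost of `[i, j)` in terms of the names in memory. -/
noncomputable def Store.windowCost (s : Store) (adaptive : Bool) (k i j : ℕ) : ℝ :=
  windowSum (weight adaptive) (s.warr 30) i (j - k) -
    windowSum (weight adaptive) (s.warr 40) i (j - k)

/-- The cost of `[i, j)` in terms of the names in memory. -/
noncomputable def Store.cost (s : Store) (M : Machine) (adaptive : Bool) (k i j : ℕ) : ℝ :=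
  edgeCost (weight adaptive) k (s.rvar 0) M.f (s.warr 30) (s.warr 40) (s.warr 20) i j

theorem Store.cost_eq (s : Store) (M : Machine) (adaptive : Bool) (k i j : ℕ) :
    s.cost M adaptive k i j = s.rvar 0 * s.windowCost adaptive k i j +
      M.f (j - i) (distinct (s.warr 20) i j) := rfl

theorem Store.cost_succ (s : Store) (M : Machine) (adaptive : Bool) (k i : ℕ) :
    s.cost M adaptive k i (i + 1) = M.f 1 1 := edgeCost_succ i

/-- The state after the preprocessing, for a text of length `n` and substrings of length `k`. -/
structure Ready (M : Machine) (adaptive : Bool) (n k : ℕ) (s : Store) : Prop where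
  fits : Fits M n
  n_eq : s.wvar 0 = n
  k_eq : s.wvar 1 = k
  m_eq : s.wvar 8 = n - k
  k_le : k ≤ n
  x_le : ∀ p ≤ n, s.warr 30 p ≤ n
  y_le : ∀ p ≤ n, s.warr 40 p ≤ n
  linked_z : Linked (s.warr 20) n (s.warr 21) (s.warr 22)
  linked_x : Linked (s.warr 30) (n - k) (s.warr 31) (s.warr 32)
  linked_y : Linked (s.warr 40) (n - k) (s.warr 41) (s.warr 42)
  rank_x : ∀ p < n - k, s.warr 33 p = cnt (s.warr 30) 0 p (s.warr 30 p)
  rank_y : ∀ p < n - k, s.warr 43 p = cnt (s.warr 40) 0 p (s.warr 40 p)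
  weight_eq : ∀ t ≤ n, s.rarr 0 t = weight adaptive t
  cost_mono : ∀ i j i' j', i' ≤ i → i < j → j ≤ j' → j' ≤ n →
    s.cost M adaptive k i j ≤ s.cost M adaptive k i' j'
  unit_nonneg : 0 ≤ M.f 1 1

/-! ### Extension of a window by one symbol -/

/-- Adds the position in the word variable `13` with the names in the array `b`: the real variable
`5` changes by the increment of the weight, with the sign `+` if `plus`. -/
def addPosition (b : ℕ) (plus : Bool) : Prog :=
  .setW 14 (.sub (.arr (b + 3) (.var 13)) (.arr (b + 4) (.arr b (.var 13)))) ;;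
  .setR 7 (.sub (.arr 0 (.add (.var 14) (.lit 1))) (.arr 0 (.var 14))) ;;
  .setR 5 (if plus then .add (.var 5) (.var 7) else .sub (.var 5) (.var 7))

/-- Extends the window from the word variable `10` to the word variable `11` by one symbol. The
real variable `5` is its entropy part, the word variable `12` its number of distinct symbols, and
the real variable `6` becomes its cost. -/
def extendWindow : Prog :=
  .ite (.wlt (.var 11) (.add (.var 10) (.var 1))) .skip
    (.setW 13 (.sub (.var 11) (.var 1)) ;; addPosition 30 true ;; addPosition 40 false) ;;
  .ite (.wlt (.var 10) (.arr 21 (.var 11))) .skip (.setW 12 (.add (.var 12) (.lit 1))) ;;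
  .setW 11 (.add (.var 11) (.lit 1)) ;;
  .setR 6 (.add (.mul (.var 0) (.var 5)) (.overhead (.sub (.var 11) (.var 10)) (.var 12)))

section ExtendWindow

variable {M : Machine} {adaptive : Bool} {n k : ℕ} {s₀ s : Store}

/-- The array `b + 4` counts the names in the array `b` before `i`. -/
def IsBase (s : Store) (n b i : ℕ) : Prop := ∀ v ≤ n, s.warr (b + 4) v = cnt (s.warr b) 0 i v

/-- A symbol is new to the window iff its previous occurrence is before `i`. As `pv` is shifted by
one, with `0` for no occurrence, a single comparison decides. -/
theorem Linked.cnt_eq_zero_iff {a pv nx : ℕ → ℕ} {m i j : ℕ} (h : Linked a m pv nx) (hj : j < m) :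
    cnt a i j (a j) = 0 ↔ pv j ≤ i := by
  rw [cnt_eq_zero]
  constructor
  · intro hc
    by_contra hcon
    have h₁ := h.pv_le j hj
    exact hc (pv j - 1) (by omega) (by omega) (h.pv_eq j hj _ (by omega))
  · intro hp q hq hqj he
    have := h.lt_pv j hj q hqj he
    omega

theorem Linked.cnt_eq_zero_iff_nx {a pv nx : ℕ → ℕ} {m i j : ℕ} (h : Linked a m pv nx)
    (hi : i < m) (hj : j ≤ m) : cnt a (i + 1) j (a i) = 0 ↔ j ≤ nx i := by
  rw [cnt_eq_zero]
  have h₁ := h.lt_nx i hi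
  constructor
  · intro hc
    by_contra hcon
    exact hc (nx i) (by omega) (by omega) (h.nx_eq i hi (by omega))
  · intro hp q hq hqj he
    have := h.nx_le i hi q (by omega) (by omega) he
    omega

/-- The count in `[i, p)` is the rank of `p` minus the number of occurrences before `i`. The
counters depend on `i` alone, so one table serves the windows of all levels. -/
theorem addPosition_runs (hR : Ready M adaptive n k s₀) (hs : Agree Static s₀ s) {i p : ℕ}
    (hip : i ≤ p) (hp : p < n - k) (h₁₃ : s.wvar 13 = p) {b : ℕ} (hb : b = 30 ∨ b = 40)
    (hbase : IsBase s n b i) (plus : Bool) :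
    Runs M (addPosition b plus) s fun t s' => s'.rvar 5 = s.rvar 5 + (if plus then 1 else -1) *
      (weight adaptive (cnt (s₀.warr b) i p (s₀.warr b p) + 1) -
        weight adaptive (cnt (s₀.warr b) i p (s₀.warr b p))) ∧ t ≤ 30 := by
  have hC := hR.fits.cells
  have hW := hR.fits.words
  have e₀ : s.rarr 0 = s₀.rarr 0 := hs (.rarr 0) (by simp [Static])
  have eb : s.warr b = s₀.warr b := hs (.warr b) (by rcases hb with rfl | rfl <;> simp [Static])
  have e₃ : s.warr (b + 3) = s₀.warr (b + 3) :=
    hs (.warr (b + 3)) (by rcases hb with rfl | rfl <;> simp [Static])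
  have hle : s₀.warr b p ≤ n := by
    rcases hb with rfl | rfl
    · exact hR.x_le p (by omega)
    · exact hR.y_le p (by omega)
  have hrank : s₀.warr (b + 3) p = cnt (s₀.warr b) 0 p (s₀.warr b p) := by
    rcases hb with rfl | rfl
    · exact hR.rank_x p hp
    · exact hR.rank_y p hp
  have hbv := hbase _ hle
  rw [eb] at hbv
  have hadd := cnt_add (a := s₀.warr b) (Nat.zero_le i) hip (s₀.warr b p)
  have hcle := cnt_le (s₀.warr b) i p (s₀.warr b p)
  have hcnt : s₀.warr (b + 3) p - s.warr (b + 4) (s₀.warr b p) =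
      cnt (s₀.warr b) i p (s₀.warr b p) := by omega
  have hw₁ := hR.weight_eq (cnt (s₀.warr b) i p (s₀.warr b p)) (by omega)
  have hw₂ := hR.weight_eq (cnt (s₀.warr b) i p (s₀.warr b p) + 1) (by omega)
  refine (Prog.wp.runs (Q := fun s' => s'.rvar 5 = s.rvar 5 + (if plus then 1 else -1) *
      (weight adaptive (cnt (s₀.warr b) i p (s₀.warr b p) + 1) -
        weight adaptive (cnt (s₀.warr b) i p (s₀.warr b p)))) ?_).mono fun t s' h => ⟨h.2, ?_⟩
  · cases plus
    · simp [addPosition, h₁₃, eb, e₃, e₀, hcnt, hw₁, hw₂]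
      and_intros
      any_goals omega
      ring
    · simp [addPosition, h₁₃, eb, e₃, e₀, hcnt, hw₁, hw₂]
      omega
  · have := h.1
    cases plus <;> simp [addPosition, Prog.bound, WExp.cost, RExp.cost] at this <;> omega

/-- The symbol at `j` is the follower of the context that starts at `j - k`, so this is the position
that enters the sums. If `j < i + k` the context begins outside the window, and both sums stay
empty. -/
theorem extendWindow_runs (hR : Ready M adaptive n k s₀) (hs : Agree Static s₀ s) {i j : ℕ}
    (hij : i ≤ j) (hj : j < n) (h₁₀ : s.wvar 10 = i) (h₁₁ : s.wvar 11 = j)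
    (hx : IsBase s n 30 i) (hy : IsBase s n 40 i)
    (h₅ : s.rvar 5 = s₀.windowCost adaptive k i j)
    (h₁₂ : s.wvar 12 = distinct (s₀.warr 20) i j) :
    Runs M extendWindow s fun t s' => s'.wvar 11 = j + 1 ∧
      s'.rvar 5 = s₀.windowCost adaptive k i (j + 1) ∧
      s'.wvar 12 = distinct (s₀.warr 20) i (j + 1) ∧
      s'.rvar 6 = s₀.cost M adaptive k i (j + 1) ∧ t ≤ 150 := by
  have hC := hR.fits.cells
  have hW := hR.fits.words
  have hk := hR.k_le
  have e₁ : s.wvar 1 = k := Eq.trans (b := s₀.wvar 1) (hs (.wvar 1) (by simp [Static])) hR.k_eq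
  have hfirst : Runs M (.ite (.wlt (.var 11) (.add (.var 10) (.var 1))) .skip
      (.setW 13 (.sub (.var 11) (.var 1)) ;; addPosition 30 true ;; addPosition 40 false)) s
      fun t s' => s'.rvar 5 = s₀.windowCost adaptive k i (j + 1) ∧ t ≤ 90 := by
    refine Runs.ite (by simp [h₁₀, e₁]; omega) (fun hb => ?_) (fun hb => ?_)
    · simp only [BExp.val, WExp.val, h₁₀, h₁₁, e₁] at hb
      refine ⟨_, _, .skip s, ?_, by simp [BExp.cost, WExp.cost]⟩
      rw [h₅]
      simp only [Store.windowCost]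
      rw [windowSum_of_le _ _ (by omega), windowSum_of_le _ _ (by omega),
        windowSum_of_le _ _ (by omega), windowSum_of_le _ _ (by omega)]
    · simp only [BExp.val, WExp.val, h₁₀, h₁₁, e₁] at hb
      refine Runs.seq ((Prog.wp.runs (Q := fun s' => s'.wvar 13 = j - k ∧ s'.rvar 5 = s.rvar 5)
        (by simp [h₁₁, e₁])).frame.mono ?_)
      rintro t₁ s₁ ⟨⟨ht₁, a₁, a₂⟩, hf₁⟩
      have hs₁ : Agree Static s₀ s₁ := fun l hl => (hs l hl).trans (hf₁ l (by
        rcases l with x | x | x | x <;> simp [Static] at hl ⊢; omega))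
      have hx₁ : IsBase s₁ n 30 i := by
        intro v hv
        rw [hf₁.warr 34 (by simp), hf₁.warr 30 (by simp)]; exact hx v hv
      have hy₁ : IsBase s₁ n 40 i := by
        intro v hv
        rw [hf₁.warr 44 (by simp), hf₁.warr 40 (by simp)]; exact hy v hv
      refine Runs.seq ((addPosition_runs hR hs₁ (p := j - k) (by omega) (by omega) a₁
        (Or.inl rfl) hx₁ true).frame.mono ?_)
      rintro t₂ s₂ ⟨⟨a₃, ht₂⟩, hf₂⟩
      have hs₂ : Agree Static s₀ s₂ := fun l hl => (hs₁ l hl).trans (hf₂ l (by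
        rcases l with x | x | x | x <;> simp [Static, addPosition] at hl ⊢ <;> omega))
      have hy₂ : IsBase s₂ n 40 i := by
        intro v hv
        rw [hf₂.warr 44 (by simp [addPosition]), hf₂.warr 40 (by simp [addPosition])]
        exact hy₁ v hv
      refine (addPosition_runs hR hs₂ (p := j - k) (by omega) (by omega)
        ((hf₂.wvar 13 (by simp [addPosition])).trans a₁) (Or.inr rfl) hy₂ false).mono ?_
      rintro t₃ s₃ ⟨a₄, ht₃⟩
      constructor
      · rw [a₄, a₃, a₂, h₅]
        simp only [Store.windowCost]
        rw [Nat.sub_add_comm (by omega), windowSum_succ_right _ _ (by omega),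
          windowSum_succ_right _ _ (by omega)]
        simp
        ring
      · simp only [Prog.bound, WExp.cost, BExp.cost] at ht₁ ⊢
        omega
  refine Runs.seq (hfirst.frame.mono ?_)
  rintro t₁ s₁ ⟨⟨b₁, ht₁⟩, hf₁⟩
  have c₀ : s₁.rvar 0 = s₀.rvar 0 :=
    (hf₁.rvar 0 (by simp [addPosition])).trans (hs (.rvar 0) (by simp [Static]))
  have c₂₁ : s₁.warr 21 = s₀.warr 21 :=
    (hf₁.warr 21 (by simp [addPosition])).trans (hs (.warr 21) (by simp [Static]))
  have c₁₀ : s₁.wvar 10 = i := (hf₁.wvar 10 (by simp [addPosition])).trans h₁₀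
  have c₁₁ : s₁.wvar 11 = j := (hf₁.wvar 11 (by simp [addPosition])).trans h₁₁
  have c₁₂ : s₁.wvar 12 = distinct (s₀.warr 20) i j :=
    (hf₁.wvar 12 (by simp [addPosition])).trans h₁₂
  have hd := distinct_le (s₀.warr 20) i j
  have hdist : distinct (s₀.warr 20) i (j + 1) =
      if i < s₀.warr 21 j then distinct (s₀.warr 20) i j else distinct (s₀.warr 20) i j + 1 := by
    rw [distinct_succ_right _ hij]
    simp only [hR.linked_z.cnt_eq_zero_iff hj]
    split_ifs <;> omega
  refine (Prog.wp.runs (Q := fun s' => s'.wvar 11 = j + 1 ∧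
      s'.rvar 5 = s₀.windowCost adaptive k i (j + 1) ∧
      s'.wvar 12 = distinct (s₀.warr 20) i (j + 1) ∧
      s'.rvar 6 = s₀.cost M adaptive k i (j + 1)) ?_).mono ?_
  · simp [c₀, c₂₁, c₁₀, c₁₁, c₁₂, b₁, Store.cost_eq, hdist]
    refine ⟨by omega, fun h => ?_, fun h => ?_⟩
    · simp [h]; omega
    · simp [not_lt.2 h]; omega
  · rintro t s' ⟨ht, h₁, h₂, h₃, h₄⟩
    refine ⟨h₁, h₂, h₃, h₄, ?_⟩
    simp only [Prog.bound, WExp.cost, BExp.cost, RExp.cost] at ht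
    omega

end ExtendWindow

/-! ### Distances -/

theorem Agree.frame {K : Loc → Prop} {P : Prog} {s₀ s s' : Store} (h : Agree K s₀ s)
    (hf : Frame P s s') (hK : ∀ l, K l → P.Keeps l) : Agree K s₀ s' :=
  fun l hl => (h l hl).trans (hf l (hK l hl))

theorem Agree.setW {K : Loc → Prop} {s₀ s : Store} (h : Agree K s₀ s) {x : ℕ}
    (hx : ¬ K (.wvar x)) (v : ℕ) :
    Agree K s₀ { s with wvar := Function.update s.wvar x v } := by
  rintro (y | y | y | y) hl
  · have hne : y ≠ x := by rintro rfl; exact hx hl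
    exact (Function.update_of_ne hne _ _).trans (h _ hl)
  all_goals exact h _ hl

/-- Upper bounds `d` for the least costs of the prefixes, with predecessors `par`, where `c i j` is
the cost of the substring `[i, j)` and `u` the cost of a symbol. -/
structure PathBounds (c : ℕ → ℕ → ℝ) (n : ℕ) (u : ℝ) (d : ℕ → ℝ) (par : ℕ → ℕ) : Prop where
  zero : d 0 = 0
  par_lt : ∀ j, 0 < j → j ≤ n → par j < j
  le : ∀ j, 0 < j → j ≤ n → d (par j) + c (par j) j ≤ d j
  le_mul : ∀ j ≤ n, d j ≤ j * u

/-- A lower value at `j` also keeps the inequality for the vertices whose predecessor is `j`, where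
it stands on the smaller side. The weight `v` may exceed the true cost of the edge. -/
theorem PathBounds.update {c : ℕ → ℕ → ℝ} {n i j : ℕ} {u v : ℝ} {d : ℕ → ℝ} {par : ℕ → ℕ}
    (h : PathBounds c n u d par) (hij : i < j) (hv : c i j ≤ v)
    (hlt : d i + v < d j) :
    PathBounds c n u (Function.update d j (d i + v)) (Function.update par j i) := by
  have hle : ∀ x, Function.update d j (d i + v) x ≤ d x := by
    intro x
    by_cases hx : x = j
    · subst hx; rw [Function.update_self]; exact hlt.le
    · rw [Function.update_of_ne hx]
  refine ⟨?_, fun x h₀ hn => ?_, fun x h₀ hn => ?_, fun x hn => (hle x).trans (h.le_mul x hn)⟩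
  · rw [Function.update_of_ne (by omega), h.zero]
  · by_cases hx : x = j
    · subst hx; rwa [Function.update_self]
    · rw [Function.update_of_ne hx]; exact h.par_lt x h₀ hn
  · by_cases hx : x = j
    · subst hx
      rw [Function.update_self, Function.update_self, Function.update_of_ne hij.ne]
      linarith
    · rw [Function.update_of_ne hx, Function.update_of_ne hx]
      have h₁ := h.le x h₀ hn
      have h₂ := hle (par x)
      linarith

/-- Relaxation of the edge from the word variable `10` to the word variable `16` with the cost
in the real variable `7`. -/
def relax : Prog :=
  .ite (.rle (.arr 3 (.var 16)) (.add (.arr 3 (.var 10)) (.var 7))) .skip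
    (.storeR 3 (.var 16) (.add (.arr 3 (.var 10)) (.var 7)) ;;
     .storeW 10 (.var 16) (.var 10))

theorem relax_runs {M : Machine} {n i j : ℕ} (hM : Fits M n) {s : Store} {c : ℕ → ℕ → ℝ} {u : ℝ}
    (h₁₀ : s.wvar 10 = i) (h₁₆ : s.wvar 16 = j) (hij : i < j) (hj : j ≤ n)
    (hc : c i j ≤ s.rvar 7) (hd : PathBounds c n u (s.rarr 3) (s.warr 10)) :
    Runs M relax s fun t s' => PathBounds c n u (s'.rarr 3) (s'.warr 10) ∧
      (∀ x, s'.rarr 3 x ≤ s.rarr 3 x) ∧ (∀ x ≤ i, s'.rarr 3 x = s.rarr 3 x) ∧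
      s'.rarr 3 j ≤ s.rarr 3 i + s.rvar 7 ∧ t ≤ 40 := by
  have hC := hM.cells
  have hW := hM.words
  refine (Prog.wp.runs (Q := fun s' => PathBounds c n u (s'.rarr 3) (s'.warr 10) ∧
      (∀ x, s'.rarr 3 x ≤ s.rarr 3 x) ∧ (∀ x ≤ i, s'.rarr 3 x = s.rarr 3 x) ∧
      s'.rarr 3 j ≤ s.rarr 3 i + s.rvar 7) ?_).mono ?_
  · simp only [relax, Prog.wp, BExp.good, RExp.good, WExp.good, BExp.val, RExp.val, WExp.val, h₁₀,
      h₁₆, not_le, true_and]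
    refine ⟨⟨by omega, by omega, trivial⟩, fun h => ⟨hd, fun _ => le_rfl, fun _ _ => trivial, h⟩,
      fun h => ⟨⟨by omega, trivial⟩, by omega, by omega, ?_, fun x => ?_, fun x hx => ?_, ?_⟩⟩
    · simpa using hd.update hij hc h
    · by_cases hx : x = j
      · subst hx; simpa using h.le
      · simp [hx]
    · simp [show x ≠ j by omega]
    · simp
  · rintro t s' ⟨ht, h₁, h₂, h₃, h₄⟩
    refine ⟨h₁, h₂, h₃, h₄, ?_⟩
    simp only [relax, Prog.bound, WExp.cost, BExp.cost, RExp.cost] at ht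
    omega

/-! ### Counters of the names before the current position -/

/-- Clears the counters. -/
def clearBase : Prog :=
  .forUp 2 .npos (.storeW 34 (.var 2) (.lit 0) ;; .storeW 44 (.var 2) (.lit 0))

/-- Counts the names at the position in the word variable `10`. -/
def stepBase : Prog :=
  .storeW 34 (.arr 30 (.var 10)) (.add (.arr 34 (.arr 30 (.var 10))) (.lit 1)) ;;
  .storeW 44 (.arr 40 (.var 10)) (.add (.arr 44 (.arr 40 (.var 10))) (.lit 1))

section Base

variable {M : Machine} {adaptive : Bool} {n k i : ℕ} {s₀ s : Store}

theorem Ready.exprs (hR : Ready M adaptive n k s₀) (hs : Agree Static s₀ s) :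
    s.wvar 0 = n ∧ s.wvar 1 = k ∧ s.warr 30 = s₀.warr 30 ∧ s.warr 40 = s₀.warr 40 :=
  ⟨Eq.trans (b := s₀.wvar 0) (hs (.wvar 0) (by simp [Static])) hR.n_eq,
    Eq.trans (b := s₀.wvar 1) (hs (.wvar 1) (by simp [Static])) hR.k_eq,
    hs (.warr 30) (by simp [Static]), hs (.warr 40) (by simp [Static])⟩

theorem clearBase_runs (hR : Ready M adaptive n k s₀) (hs : Agree Static s₀ s) :
    Runs M clearBase s fun t s' => IsBase s' n 30 0 ∧ IsBase s' n 40 0 ∧ t ≤ 40 * (n + 2) := by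
  have hC := hR.fits.cells
  have hW := hR.fits.words
  obtain ⟨hn, -⟩ := hR.exprs hs
  refine (Runs.forUp_wp (fun p s' => s'.wvar 2 = p ∧ s'.wvar 0 = n ∧
    ∀ q < p, s'.warr 34 q = 0 ∧ s'.warr 44 q = 0) (n + 1) (by omega) (by simp [hn]) ?_ ?_).mono ?_
  · rintro p s' hp ⟨h₁, h₂, -⟩
    simp [h₁, h₂]; omega
  · rintro p s' hp ⟨h₁, h₂, h₃⟩
    simp [h₁, h₂]
    and_intros
    any_goals omega
    intro q hq
    rcases hq.lt_or_eq with hq | rfl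
    · simp [hq.ne, h₃ q hq]
    · simp
  · rintro t s' ⟨⟨-, -, h⟩, ht⟩
    refine ⟨fun v hv => ?_, fun v hv => ?_, ?_⟩
    · rw [cnt_of_le le_rfl]; exact (h v (by omega)).1
    · rw [cnt_of_le le_rfl]; exact (h v (by omega)).2
    · simp only [Prog.bound, WExp.cost] at ht
      omega

theorem stepBase_runs (hR : Ready M adaptive n k s₀) (hs : Agree Static s₀ s) (hi : i < n)
    (h₁₀ : s.wvar 10 = i) (hx : IsBase s n 30 i) (hy : IsBase s n 40 i) :
    Runs M stepBase s fun t s' => IsBase s' n 30 (i + 1) ∧ IsBase s' n 40 (i + 1) ∧ t ≤ 30 := by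
  have hC := hR.fits.cells
  have hW := hR.fits.words
  obtain ⟨-, -, e₁, e₂⟩ := hR.exprs hs
  have hxi := hR.x_le i hi.le
  have hyi := hR.y_le i hi.le
  rw [← e₁] at hxi
  rw [← e₂] at hyi
  have bx : s.warr 34 _ = _ := hx _ hxi
  have hby : s.warr 44 _ = _ := hy _ hyi
  have cx := cnt_le (s.warr 30) 0 i (s.warr 30 i)
  have cy := cnt_le (s.warr 40) 0 i (s.warr 40 i)
  have step : ∀ a f : ℕ → ℕ, (∀ v ≤ n, f v = cnt a 0 i v) → ∀ v ≤ n,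
      Function.update f (a i) (f (a i) + 1) v = cnt a 0 (i + 1) v := by
    intro a f h v hv
    rw [cnt_succ_right (Nat.zero_le i)]
    by_cases hva : a i = v
    · subst hva; rw [Function.update_self, if_pos rfl, h _ hv]
    · rw [Function.update_of_ne (Ne.symm hva), if_neg hva, h _ hv, add_zero]
  refine (Prog.wp.runs (Q := fun s' => IsBase s' n 30 (i + 1) ∧ IsBase s' n 40 (i + 1)) ?_).mono ?_
  · simp [stepBase, h₁₀, IsBase]
    and_intros
    any_goals omega
    · exact step _ _ hx
    · exact step _ _ hy
  · rintro t s' ⟨ht, h₁, h₂⟩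
    refine ⟨h₁, h₂, ?_⟩
    simp only [stepBase, Prog.bound, WExp.cost] at ht
    omega

end Base

/-! ### All windows -/

/-- Extends the window and relaxes its edge. -/
def edgeRound : Prog := extendWindow ;; (.setW 16 (.var 11) ;; .setR 7 (.var 6)) ;; relax

/-- Relaxes all edges from the word variable `10`. -/
def edgeRow : Prog :=
  (.setR 5 (.ofWord (.lit 0)) ;; .setW 12 (.lit 0) ;; .setW 11 (.var 10)) ;;
  .loop (.wlt (.var 11) (.var 0)) edgeRound

/-- Shortest paths over all edges. -/
def allEdges : Prog := clearBase ;; .forUp 10 (.var 0) (edgeRow ;; stepBase)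

theorem Static.keeps_edgeRound {l : Loc} (hl : Static l) : edgeRound.Keeps l := by
  rcases l with x | x | x | x <;>
    simp [Static, edgeRound, extendWindow, addPosition, relax] at hl ⊢ <;> omega

theorem Static.keeps_edgeRow {l : Loc} (hl : Static l) : edgeRow.Keeps l := by
  have := hl.keeps_edgeRound
  rcases l with x | x | x | x <;> simp [Static, edgeRow] at hl this ⊢ <;> simp [this] <;> omega

theorem Static.keeps_stepBase {l : Loc} (hl : Static l) : stepBase.Keeps l := by
  rcases l with x | x | x | x <;> simp [Static, stepBase] at hl ⊢ <;> omega

theorem Static.keeps_clearBase {l : Loc} (hl : Static l) : clearBase.Keeps l := by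
  rcases l with x | x | x | x <;> simp [Static, clearBase, Prog.forUp] at hl ⊢ <;> omega

section Exact

variable {M : Machine} {adaptive : Bool} {n k i : ℕ} {s₀ s : Store}

theorem windowCost_self (s : Store) (adaptive : Bool) (k i : ℕ) :
    s.windowCost adaptive k i i = 0 := by
  rw [Store.windowCost, windowSum_of_le _ _ (Nat.sub_le i k), windowSum_of_le _ _ (Nat.sub_le i k),
    sub_zero]

theorem edgeRow_runs (hR : Ready M adaptive n k s₀) (hs : Agree Static s₀ s) (hi : i < n)
    (h₁₀ : s.wvar 10 = i) (hx : IsBase s n 30 i) (hy : IsBase s n 40 i) {u : ℝ}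
    (hd : PathBounds (s₀.cost M adaptive k) n u (s.rarr 3) (s.warr 10)) :
    Runs M edgeRow s fun t s' => PathBounds (s₀.cost M adaptive k) n u (s'.rarr 3) (s'.warr 10) ∧
      (∀ x, s'.rarr 3 x ≤ s.rarr 3 x) ∧ (∀ x ≤ i, s'.rarr 3 x = s.rarr 3 x) ∧
      (∀ j, i < j → j ≤ n → s'.rarr 3 j ≤ s.rarr 3 i + s₀.cost M adaptive k i j) ∧
      t ≤ 250 * (n + 1) := by
  have hC := hR.fits.cells
  have hW := hR.fits.words
  let I : ℕ → Store → Prop := fun j s' => Agree Static s₀ s' ∧ i ≤ j ∧ s'.wvar 10 = i ∧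
    s'.wvar 11 = j ∧ IsBase s' n 30 i ∧ IsBase s' n 40 i ∧
    s'.rvar 5 = s₀.windowCost adaptive k i j ∧ s'.wvar 12 = distinct (s₀.warr 20) i j ∧
    PathBounds (s₀.cost M adaptive k) n u (s'.rarr 3) (s'.warr 10) ∧
    (∀ x, s'.rarr 3 x ≤ s.rarr 3 x) ∧ (∀ x ≤ i, s'.rarr 3 x = s.rarr 3 x) ∧
    ∀ x, i < x → x ≤ j → s'.rarr 3 x ≤ s.rarr 3 i + s₀.cost M adaptive k i x
  have hinit : Prog.wp M (.setR 5 (.ofWord (.lit 0)) ;; .setW 12 (.lit 0) ;;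
      .setW 11 (.var 10)) (I i) s := by
    simp [I, h₁₀, windowCost_self, distinct_of_le, hd]
    refine ⟨by omega, ?_, hx, hy, fun x h₁ h₂ => by omega⟩
    rintro (x | x | x | x) hl
    · have : x ≠ 12 ∧ x ≠ 11 := by simp [Static] at hl; omega
      simpa [Loc.Same, this] using hs _ hl
    · exact hs _ hl
    · have : x ≠ 5 := by simp [Static] at hl; omega
      simpa [Loc.Same, this] using hs _ hl
    · exact hs _ hl
  refine Runs.seq (hinit.runs.mono ?_)
  rintro t₁ s₁ ⟨ht₁, hI₁⟩
  simp only [Prog.bound, WExp.cost, RExp.cost] at ht₁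
  refine (Runs.count I n 215 ?_ ?_ hi.le hI₁).mono ?_
  · rintro j s' hj ⟨h₁, -, -, h₂, -⟩
    simp [(hR.exprs h₁).1, h₂]
  · rintro j s' hj ⟨h₁, h₂, h₃, h₄, h₅, h₆, h₇, h₈, h₉, h₁₀, h₁₁, h₁₂⟩
    refine (Runs.seq ((extendWindow_runs hR h₁ h₂ hj h₃ h₄ h₅ h₆ h₇ h₈).frame.mono ?_)).frame.mono
      (Q := fun t s'' => (t ≤ 215 ∧ s''.wvar 11 = j + 1 ∧
        s''.rvar 5 = s₀.windowCost adaptive k i (j + 1) ∧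
        s''.wvar 12 = distinct (s₀.warr 20) i (j + 1) ∧
        PathBounds (s₀.cost M adaptive k) n u (s''.rarr 3) (s''.warr 10) ∧
        (∀ x, s''.rarr 3 x ≤ s'.rarr 3 x) ∧ (∀ x ≤ i, s''.rarr 3 x = s'.rarr 3 x) ∧
        s''.rarr 3 (j + 1) ≤ s'.rarr 3 i + s₀.cost M adaptive k i (j + 1)) ∧
        Frame edgeRound s' s'') ?_
    · rintro t₂ s₂ ⟨⟨a₁, a₂, a₃, a₄, ht₂⟩, hf₂⟩
      have b₁ := hf₂.wvar 10 (by simp [extendWindow, addPosition])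
      have b₂ := hf₂.warr 10 (by simp [extendWindow, addPosition])
      have b₃ := hf₂.rarr 3 (by simp [extendWindow, addPosition])
      refine Runs.seq ((Prog.wp.runs (Q := fun s' => s'.rvar 7 = s₂.rvar 6 ∧
        s'.wvar 16 = s₂.wvar 11) (by simp)).frame.mono ?_)
      rintro t₃ s₃ ⟨⟨ht₃, c₁, c₂⟩, hf₃⟩
      have c₃ := hf₃.wvar 10 (by simp)
      have c₄ := hf₃.warr 10 (by simp)
      have c₅ := hf₃.rarr 3 (by simp)
      simp only [Prog.bound, WExp.cost, RExp.cost] at ht₃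
      refine (relax_runs (c := s₀.cost M adaptive k) (u := u) hR.fits (i := i) (j := j + 1)
        (by rw [c₃, b₁, h₃]) (by rw [c₂, a₁]) (by omega) hj (by rw [c₁, a₄])
        (by rw [c₄, c₅, b₂, b₃]; exact h₉)).frame.mono ?_
      rintro t₄ s₄ ⟨⟨d₁, d₂, d₃, d₄, ht₄⟩, hf₄⟩
      rw [c₁, c₅, b₃, a₄] at d₄
      rw [c₅, b₃] at d₂ d₃
      refine ⟨by omega, ?_, ?_, ?_, d₁, d₂, d₃, d₄⟩
      · rw [hf₄.wvar 11 (by simp [relax]), hf₃.wvar 11 (by simp), a₁]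
      · rw [hf₄.rvar 5 (by simp [relax]), hf₃.rvar 5 (by simp), a₂]
      · rw [hf₄.wvar 12 (by simp [relax]), hf₃.wvar 12 (by simp), a₃]
    · rintro t s'' ⟨⟨ht, a₁, a₂, a₃, a₄, a₅, a₆, a₇⟩, hf⟩
      have k₁ := hf.warr 30 (by simp [edgeRound, extendWindow, addPosition, relax])
      have k₂ := hf.warr 34 (by simp [edgeRound, extendWindow, addPosition, relax])
      have k₃ := hf.warr 40 (by simp [edgeRound, extendWindow, addPosition, relax])
      have k₄ := hf.warr 44 (by simp [edgeRound, extendWindow, addPosition, relax])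
      have k₅ := hf.wvar 10 (by simp [edgeRound, extendWindow, addPosition, relax])
      refine ⟨⟨h₁.frame hf fun l hl => hl.keeps_edgeRound, by omega, by omega, a₁,
        fun v hv => by rw [k₁, k₂]; exact h₅ v hv, fun v hv => by rw [k₃, k₄]; exact h₆ v hv,
        a₂, a₃, a₄, fun x => (a₅ x).trans (h₁₀ x), fun x hx => (a₆ x hx).trans (h₁₁ x hx),
        fun x hx hxj => ?_⟩, ht⟩
      rcases hxj.lt_or_eq with hxj | rfl
      · exact (a₅ x).trans (h₁₂ x hx (by omega))
      · rw [h₁₁ i le_rfl] at a₇; exact a₇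
  · rintro t s' ⟨⟨h₁, h₂, h₃, h₄, h₅, h₆, h₇, h₈, h₉, h₁₀, h₁₁, h₁₂⟩, ht⟩
    refine ⟨h₉, h₁₀, h₁₁, h₁₂, ?_⟩
    simp only [BExp.cost, WExp.cost] at ht
    have : (n - i + 1) * (215 + (1 + 1 + 1) + 1) ≤ (n + 1) * 219 :=
      Nat.mul_le_mul (by omega) (by norm_num)
    omega

/-- Rows from `i` on leave the distance of `i` alone and lower the others. So the inequalities
obtained in row `i` survive to the end. -/
theorem allEdges_runs (hR : Ready M adaptive n k s₀) (hs : Agree Static s₀ s) {u : ℝ}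
    (hd : PathBounds (s₀.cost M adaptive k) n u (s.rarr 3) (s.warr 10)) :
    Runs M allEdges s fun t s' => PathBounds (s₀.cost M adaptive k) n u (s'.rarr 3) (s'.warr 10) ∧
      (∀ i j, i < j → j ≤ n → s'.rarr 3 j ≤ s'.rarr 3 i + s₀.cost M adaptive k i j) ∧
      t ≤ 400 * ((n + 1) * (n + 1)) := by
  have hC := hR.fits.cells
  have hW := hR.fits.words
  refine Runs.seq ((clearBase_runs hR hs).frame.mono ?_)
  rintro t₁ s₁ ⟨⟨a₁, a₂, ht₁⟩, hf₁⟩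
  have hs₁ := hs.frame hf₁ fun l hl => hl.keeps_clearBase
  rw [← hf₁.rarr 3 (by simp [clearBase, Prog.forUp]),
    ← hf₁.warr 10 (by simp [clearBase, Prog.forUp])] at hd
  refine (Runs.forUp (fun i s' => Agree Static s₀ s' ∧ s'.wvar 10 = i ∧ IsBase s' n 30 i ∧
    IsBase s' n 40 i ∧ PathBounds (s₀.cost M adaptive k) n u (s'.rarr 3) (s'.warr 10) ∧
    ∀ i' j, i' < i → i' < j → j ≤ n →
      s'.rarr 3 j ≤ s'.rarr 3 i' + s₀.cost M adaptive k i' j) n (250 * (n + 1) + 30) (by omega)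
    ⟨hs₁.setW (by simp [Static]) 0, by simp, a₁, a₂, hd, by omega⟩ ?_ ?_).mono ?_
  · rintro i s' hi ⟨h₁, h₂, -⟩
    exact ⟨h₂, trivial, (hR.exprs h₁).1⟩
  · rintro i s' hi ⟨h₁, h₂, h₃, h₄, h₅, h₆⟩
    refine Runs.seq ((edgeRow_runs hR h₁ hi h₂ h₃ h₄ h₅).frame.mono ?_)
    rintro t₂ s₂ ⟨⟨b₁, b₂, b₃, b₄, ht₂⟩, hf₂⟩
    have hk : ∀ a ∈ [30, 34, 40, 44], s₂.warr a = s'.warr a := fun a ha => hf₂.warr a (by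
      simp at ha
      simp [edgeRow, edgeRound, extendWindow, addPosition, relax]; omega)
    refine (stepBase_runs hR (h₁.frame hf₂ fun l hl => hl.keeps_edgeRow) hi
      ((hf₂.wvar 10 (by simp [edgeRow, edgeRound, extendWindow, addPosition, relax])).trans h₂)
      (fun v hv => by rw [hk 30 (by simp), hk (30 + 4) (by simp)]; exact h₃ v hv)
      (fun v hv => by rw [hk 40 (by simp), hk (40 + 4) (by simp)]; exact h₄ v hv)).frame.mono ?_
    rintro t₃ s₃ ⟨⟨c₁, c₂, ht₃⟩, hf₃⟩
    have e₁ := hf₃.rarr 3 (by simp [stepBase])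
    have e₂ := hf₃.warr 10 (by simp [stepBase])
    refine ⟨by omega, ?_, Agree.setW ((h₁.frame hf₂ fun l hl => hl.keeps_edgeRow).frame hf₃
      fun l hl => hl.keeps_stepBase) (by simp [Static]) _, by simp, c₁, c₂, ?_, ?_⟩
    · rw [hf₃.wvar 10 (by simp [stepBase]),
        hf₂.wvar 10 (by simp [edgeRow, edgeRound, extendWindow, addPosition, relax]), h₂]
    · simpa only [e₁, e₂] using b₁
    · intro i' j hi' hij hj
      simp only [e₁]
      rcases (Nat.lt_succ_iff_lt_or_eq.1 hi') with hi' | rfl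
      · rw [b₃ i' hi'.le]
        exact (b₂ j).trans (h₆ i' j hi' hij hj)
      · rw [b₃ i' le_rfl]
        exact b₄ j hij hj
  · rintro t s' ⟨⟨-, -, -, -, h₁, h₂⟩, ht⟩
    refine ⟨h₁, fun i j hij hj => h₂ i j (by omega) hij hj, ?_⟩
    simp only [WExp.cost] at ht
    have h₃ : (n + 1) * (250 * (n + 1) + 30 + 1 + 9) ≤ (n + 1) * (300 * (n + 1)) :=
      Nat.mul_le_mul_left _ (by omega)
    have h₄ : (n + 1) * (300 * (n + 1)) = 300 * ((n + 1) * (n + 1)) := by ring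
    have h₅ : n + 1 ≤ (n + 1) * (n + 1) := Nat.le_mul_of_pos_left _ (by omega)
    omega

end Exact

/-! ### Boundaries of the levels -/

section RunBounds

variable {a pv nx F L : ℕ → ℕ} {i m p : ℕ} {B : ℕ → Prop}

/-- Keeps the addresses used for cutting off a position within the memory; the links are meaningful
only at the ends of runs. -/
theorem RunLinks.lst_lt (h : RunLinks a i m B F L) (hl : Linked a m pv nx) (hi : i ≤ p)
    (hp : p < m) (hB : B p ∨ p = i) : L p < m ∧ (L p ≠ p → nx p < m) := by
  obtain ⟨q, hr⟩ := exists_isRun_of_fst (a := a) (B := B) hi hp fun p' h₁ h₂ _ =>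
    ⟨p, h₂, le_rfl, hB.resolve_right (by omega)⟩
  have hq := hr.le
  rw [(h _ _ hr).1]
  exact ⟨hr.lt, fun hne => (hl.nx_le p hp q (by omega) hr.lt hr.eq).trans_lt hr.lt⟩

theorem RunLinks.fst_lt (h : RunLinks a i m B F L) (hl : Linked a m pv nx) (hp : p < m)
    (hi : i < pv p) (hB : B p) : F (pv p - 1) < m := by
  have hpv := hl.pv_le p hp
  have ha := hl.pv_eq p hp (pv p - 1) (by omega)
  obtain ⟨p₀, hr⟩ := exists_isRun_of_lst (a := a) (B := B) (i := i) (m := m) (q := pv p - 1)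
    (by omega) (by omega) fun q' h₁ h₂ h₃ => by
      refine ⟨p, by omega, ?_, hB⟩
      by_contra hcon
      have := hl.lt_pv p hp q' (by omega) (h₃.trans ha)
      omega
  rw [(h _ _ hr).2]
  have := hr.le
  omega

end RunBounds

/-- Cuts the position in the word variable `13` off its run, for the names in the array `b`. -/
def splitPosition (b : ℕ) : Prog :=
  .ite (.weq (.arr (b + 6) (.var 13)) (.var 13)) .skip
    (.setW 16 (.arr (b + 6) (.var 13)) ;; .setW 17 (.arr (b + 2) (.var 13)) ;;
     .storeW (b + 6) (.var 17) (.var 16) ;; .storeW (b + 5) (.var 16) (.var 17) ;;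
     .storeW (b + 6) (.var 13) (.var 13) ;; .storeW (b + 5) (.var 13) (.var 13))

theorem splitPosition_runs {M : Machine} {n m b p i : ℕ} (hM : Fits M n) (hm : m ≤ n) {s : Store}
    {a pv : ℕ → ℕ} {B : ℕ → Prop} (h₁₃ : s.wvar 13 = p) (hl : Linked a m pv (s.warr (b + 2)))
    (h : RunLinks a i m B (s.warr (b + 5)) (s.warr (b + 6))) (hi : i ≤ p) (hp : p < m)
    (hB : B p ∨ p = i) :
    Runs M (splitPosition b) s fun t s' =>
      RunLinks a i m (fun x => B x ∨ x = p + 1) (s'.warr (b + 5)) (s'.warr (b + 6)) ∧ t ≤ 40 := by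
  have hC := hM.cells
  have hW := hM.words
  have hs := h.split hl hi hp hB
  obtain ⟨h₁, h₂⟩ := h.lst_lt hl hi hp hB
  refine (Prog.wp.runs (Q := fun s' => s'.warr (b + 5) =
    splitF (s.warr (b + 2)) (s.warr (b + 5)) (s.warr (b + 6)) p ∧ s'.warr (b + 6) =
    splitL (s.warr (b + 2)) (s.warr (b + 6)) p) ?_).mono ?_
  · simp [splitPosition, h₁₃, splitF, splitL]
    refine ⟨by omega, fun h => by simp [h], fun h => ?_⟩
    have h₃ := h₂ h
    simp [h]
    omega
  · rintro t s' ⟨ht, h₁, h₂⟩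
    rw [h₁, h₂]
    refine ⟨hs, ?_⟩
    simp only [splitPosition, Prog.bound, WExp.cost, BExp.cost] at ht
    omega

/-- The boundaries of the levels `0, …, R`. -/
def IsBoundary (J : ℕ → ℕ) (R k x : ℕ) : Prop := ∃ r ≤ R, J r = x + k

/-- Removes the boundary at the word variable `13`, of the level below the word variable `15`, unless
it is a boundary of the preceding level too, for the names in the array `b`. -/
def mergePosition (b : ℕ) : Prog :=
  .ite (.conj (.wlt (.var 10) (.arr (b + 1) (.var 13)))
      (.neg (.conj (.neg (.weq (.var 15) (.lit 1)))
        (.neg (.wlt (.arr 8 (.sub (.var 15) (.lit 2))) (.add (.arr (b + 1) (.var 13)) (.var 1)))))))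
    (.setW 16 (.arr (b + 5) (.sub (.arr (b + 1) (.var 13)) (.lit 1))) ;;
     .storeW (b + 5) (.var 13) (.var 16) ;; .storeW (b + 6) (.var 16) (.var 13))
    .skip

/-- Moves the boundary at the word variable `13` up by one. -/
def moveBoundary (b : ℕ) : Prog := splitPosition b ;; mergePosition b

/-- The boundary `p + 1` is added before `p` is removed, so that `p` is isolated in between. Whether
another boundary separates `p` from its previous occurrence is decided by level `r - 1` alone: lower
levels end no later than that one, and higher levels end beyond `p + k`. -/
theorem moveBoundary_runs {M : Machine} {n m b p i k r R : ℕ} (hM : Fits M n) (hm : m + k = n)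
    {s : Store} {a : ℕ → ℕ} (h₁ : s.wvar 1 = k) (h₁₀ : s.wvar 10 = i) (h₁₃ : s.wvar 13 = p)
    (h₁₅ : s.wvar 15 = r + 1) (hl : Linked a m (s.warr (b + 1)) (s.warr (b + 2)))
    (h : RunLinks a i m (IsBoundary (s.warr 8) R k) (s.warr (b + 5)) (s.warr (b + 6)))
    (hi : i ≤ p) (hp : p < m) (hr : r ≤ R) (hR : R ≤ n) (hJ : s.warr 8 r = p + k)
    (hle : s.warr 8 (r - 1) ≤ p + k) (hlt : ∀ r' < r, s.warr 8 r' ≤ s.warr 8 (r - 1))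
    (hgt : ∀ r', r < r' → r' ≤ R → p + k < s.warr 8 r') (hb : 10 ≤ b) :
    Runs M (moveBoundary b) s fun t s' =>
      RunLinks a i m (IsBoundary (Function.update (s.warr 8) r (p + k + 1)) R k)
        (s'.warr (b + 5)) (s'.warr (b + 6)) ∧ t ≤ 100 := by
  have hC := hM.cells
  have hW := hM.words
  refine Runs.seq ((splitPosition_runs hM (by omega) h₁₃ hl h hi hp
    (Or.inl ⟨r, hr, hJ⟩)).frame.mono ?_)
  rintro t₁ s₁ ⟨⟨h₂, ht₁⟩, hf⟩
  have e₁ := hf.wvar 1 (by simp [splitPosition])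
  have e₁₀ := hf.wvar 10 (by simp [splitPosition])
  have e₁₃ := hf.wvar 13 (by simp [splitPosition])
  have e₁₅ := hf.wvar 15 (by simp [splitPosition])
  have e₈ := hf.warr 8 (by simp [splitPosition]; omega)
  have eb₁ := hf.warr (b + 1) (by simp [splitPosition])
  have hpv := hl.pv_le p hp
  let B' := IsBoundary (Function.update (s.warr 8) r (p + k + 1)) R k
  let c : Prop := i < s.warr (b + 1) p ∧ (r = 0 ∨ s.warr 8 (r - 1) < s.warr (b + 1) p + k)
  have hB : ∀ x, x ≠ p → (B' x ↔ (IsBoundary (s.warr 8) R k x ∨ x = p + 1)) := by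
    intro x hx
    constructor
    · rintro ⟨r', hr', h'⟩
      by_cases hrr : r' = r
      · subst hrr; rw [Function.update_self] at h'; right; omega
      · rw [Function.update_of_ne hrr] at h'; exact Or.inl ⟨r', hr', h'⟩
    · rintro (⟨r', hr', h'⟩ | rfl)
      · have hrr : r' ≠ r := by rintro rfl; omega
        exact ⟨r', hr', by rwa [Function.update_of_ne hrr]⟩
      · exact ⟨r, hr, by rw [Function.update_self]; omega⟩
  have hc : c ↔ i < s.warr (b + 1) p ∧ ∀ x, s.warr (b + 1) p ≤ x → x ≤ p → ¬ B' x := by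
    refine and_congr_right fun hip => ⟨?_, fun hx => ?_⟩
    · rintro h₃ x hx hxp ⟨r', hr', h'⟩
      by_cases hrr : r' = r
      · subst hrr; rw [Function.update_self] at h'; omega
      · rw [Function.update_of_ne hrr] at h'
        rcases lt_or_gt_of_ne hrr with hrr | hrr
        · have := hlt r' hrr; omega
        · have := hgt r' hrr hr'; omega
    · by_contra hcon
      push Not at hcon
      -- The end of the level `r - 1` itself is the separating boundary.
      refine hx (s.warr 8 (r - 1) - k) (by omega) (by omega) ⟨r - 1, by omega, ?_⟩
      rw [Function.update_of_ne (by omega)]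
      omega
  have hBp : IsBoundary (s.warr 8) R k p ∨ p = p + 1 := Or.inl ⟨r, hr, hJ⟩
  classical
  have hmerge := h₂.merge hl hi hp hBp (Or.inr rfl) hB hc
  have hF : c → s₁.warr (b + 5) (s.warr (b + 1) p - 1) < m := fun hcc =>
    h₂.fst_lt hl hp hcc.1 hBp
  refine (Prog.wp.runs (Q := fun s' => s'.warr (b + 5) = (if c then Function.update
    (s₁.warr (b + 5)) p (s₁.warr (b + 5) (s.warr (b + 1) p - 1)) else s₁.warr (b + 5)) ∧
    s'.warr (b + 6) = (if c then Function.update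
    (s₁.warr (b + 6)) (s₁.warr (b + 5) (s.warr (b + 1) p - 1)) p else s₁.warr (b + 6))) ?_).mono ?_
  · have hval : (i < s.warr (b + 1) p ∧
        ¬(¬r + 1 = 1 ∧ ¬ s.warr 8 (r + 1 - 2) < s.warr (b + 1) p + k)) ↔ c := by
      have : r + 1 - 2 = r - 1 := by omega
      rw [this]
      simp only [c]
      omega
    simp only [mergePosition, Prog.wp, BExp.good, WExp.good, BExp.val, WExp.val, e₁, e₁₀, e₁₃, e₁₅,
      e₈, eb₁, h₁, h₁₀, h₁₃, h₁₅, hval]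
    refine ⟨?_, fun hcc => ?_, fun hcc => ?_⟩
    · simp; omega
    · have := hF hcc
      simp [hcc, h₁₃, e₁₃]
      omega
    · simp [hcc]
  · rintro t s' ⟨ht, h₃, h₄⟩
    rw [h₃, h₄]
    refine ⟨hmerge, ?_⟩
    simp only [mergePosition, Prog.bound, WExp.cost, BExp.cost] at ht
    omega

/-! ### Levels -/

/-- The edges from `i` of cost at most `v` end before some position that is reached from `i` with
cost `v`. -/
def Covers (c : ℕ → ℕ → ℝ) (v : ℝ) (n : ℕ) (d : ℕ → ℝ) (i : ℕ) : Prop :=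
  ∃ j' ≤ n, (∀ j, i < j → j ≤ n → c i j ≤ v → j ≤ j') ∧ d j' ≤ d i + v

/-- The state of the levels `0, …, R` at the position `i`. Level `r` has a window `[i, J r)` of cost
at most `θ r`, with `J` in the word array `8` and `θ` in the real array `1`. The word array `9`
holds the numbers of distinct symbols, and the real array `2` the entropy parts of the cost. -/
structure Levels (M : Machine) (adaptive : Bool) (n k : ℕ) (s₀ : Store) (R i : ℕ) (s : Store) :
    Prop where
  agree : Agree Static s₀ s
  pos : s.wvar 10 = i
  base_x : IsBase s n 30 i
  base_y : IsBase s n 40 i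
  top : s.warr 8 (R + 1) = n
  mono : ∀ r ≤ R, s.warr 8 r ≤ s.warr 8 (r + 1)
  ge : ∀ r ≤ R, i ≤ s.warr 8 r
  cost_le : ∀ r ≤ R, s.warr 8 r = i ∨ s₀.cost M adaptive k i (s.warr 8 r) ≤ s₀.rarr 1 r
  sum_eq : ∀ r ≤ R, s.rarr 2 r = s₀.windowCost adaptive k i (s.warr 8 r)
  dist_eq : ∀ r ≤ R, s.warr 9 r = distinct (s₀.warr 20) i (s.warr 8 r)
  runs_x : RunLinks (s₀.warr 30) i (n - k) (IsBoundary (s.warr 8) R k) (s.warr 35) (s.warr 36)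
  runs_y : RunLinks (s₀.warr 40) i (n - k) (IsBoundary (s.warr 8) R k) (s.warr 45) (s.warr 46)
  bounds : PathBounds (s₀.cost M adaptive k) n (M.f 1 1) (s.rarr 3) (s.warr 10)
  covers : ∀ i' < i, ∀ r ≤ R, Covers (s₀.cost M adaptive k) (s₀.rarr 1 r) n (s.rarr 3) i'

/-- The parts of the memory that describe the levels. -/
def LevelLoc (l : Loc) : Prop :=
  Static l ∨ l ∈ [.wvar 10, .warr 8, .warr 9, .warr 10, .warr 34, .warr 35, .warr 36, .warr 44,
    .warr 45, .warr 46, .rarr 2, .rarr 3]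

section Levels

variable {M : Machine} {adaptive : Bool} {n k R i : ℕ} {s₀ s : Store}

theorem Covers.mono {c : ℕ → ℕ → ℝ} {v : ℝ} {d d' : ℕ → ℝ} (h : Covers c v n d i)
    (hle : ∀ x, d' x ≤ d x) (heq : d' i = d i) : Covers c v n d' i := by
  obtain ⟨j', h₁, h₂, h₃⟩ := h
  exact ⟨j', h₁, h₂, by rw [heq]; exact (hle j').trans h₃⟩

/-- A relaxation from `i` only lowers distances, and none before `i`. Hence the earlier positions
stay covered: their own distance is unchanged while the targets only improve. -/
theorem Levels.relaxed {s' : Store} (h : Levels M adaptive n k s₀ R i s)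
    (hs : Agree (fun l => LevelLoc l ∧ l ≠ .warr 10 ∧ l ≠ .rarr 3) s s')
    (hd : PathBounds (s₀.cost M adaptive k) n (M.f 1 1) (s'.rarr 3) (s'.warr 10))
    (hle : ∀ x, s'.rarr 3 x ≤ s.rarr 3 x) (heq : ∀ x < i, s'.rarr 3 x = s.rarr 3 x) :
    Levels M adaptive n k s₀ R i s' := by
  have e₁ : s'.wvar 10 = s.wvar 10 := hs (.wvar 10) (by simp [LevelLoc])
  have e₂ : s'.warr 8 = s.warr 8 := hs (.warr 8) (by simp [LevelLoc])
  have e₃ : s'.warr 9 = s.warr 9 := hs (.warr 9) (by simp [LevelLoc])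
  have e₅ : s'.warr 34 = s.warr 34 := hs (.warr 34) (by simp [LevelLoc])
  have e₆ : s'.warr 35 = s.warr 35 := hs (.warr 35) (by simp [LevelLoc])
  have e₇ : s'.warr 36 = s.warr 36 := hs (.warr 36) (by simp [LevelLoc])
  have e₈ : s'.warr 44 = s.warr 44 := hs (.warr 44) (by simp [LevelLoc])
  have e₉ : s'.warr 45 = s.warr 45 := hs (.warr 45) (by simp [LevelLoc])
  have e₁₀ : s'.warr 46 = s.warr 46 := hs (.warr 46) (by simp [LevelLoc])
  have e₁₁ : s'.rarr 2 = s.rarr 2 := hs (.rarr 2) (by simp [LevelLoc])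
  have e₁₃ : s'.warr 30 = s.warr 30 := hs (.warr 30) (by simp [LevelLoc, Static])
  have e₁₄ : s'.warr 40 = s.warr 40 := hs (.warr 40) (by simp [LevelLoc, Static])
  obtain ⟨a₁, a₂, a₃, a₄, a₅, a₆, a₇, a₈, a₉, a₁₀, a₁₁, a₁₂, a₁₃, a₁₄⟩ := h
  refine ⟨fun l hl => (a₁ l hl).trans (hs l ⟨Or.inl hl, ?_⟩), e₁.trans a₂, fun v hv => ?_,
    fun v hv => ?_, ?_, ?_, ?_, ?_, ?_, ?_, ?_, ?_, hd,
    fun i' hi' r hr => (a₁₄ i' hi' r hr).mono hle (heq i' hi')⟩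
  · constructor <;> rintro rfl <;> simp [Static] at hl
  · show s'.warr 34 v = _
    rw [e₅, e₁₃]; exact a₃ v hv
  · show s'.warr 44 v = _
    rw [e₈, e₁₄]; exact a₄ v hv
  all_goals simpa only [e₂, e₃, e₆, e₇, e₉, e₁₀, e₁₁]

theorem Levels.congr {s' : Store} (h : Levels M adaptive n k s₀ R i s) (hs : Agree LevelLoc s s') :
    Levels M adaptive n k s₀ R i s' := by
  have e₁ : s'.warr 10 = s.warr 10 := hs (.warr 10) (by simp [LevelLoc])
  have e₂ : s'.rarr 3 = s.rarr 3 := hs (.rarr 3) (by simp [LevelLoc])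
  exact h.relaxed (fun l hl => hs l hl.1) (by rw [e₁, e₂]; exact h.bounds)
    (fun x => by rw [e₂]) (fun x _ => by rw [e₂])

theorem Levels.le (h : Levels M adaptive n k s₀ R i s) {r : ℕ} (hr : r ≤ R + 1) :
    s.warr 8 r ≤ n := by
  obtain ⟨t, ht⟩ : ∃ t, r + t = R + 1 := ⟨R + 1 - r, by omega⟩
  induction t generalizing r with
  | zero => rw [show r = R + 1 by omega, h.top]
  | succ t ih => exact (h.mono r (by omega)).trans (ih (by omega) (by omega))

theorem Levels.mono' (h : Levels M adaptive n k s₀ R i s) {r r' : ℕ} (hr : r ≤ r')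
    (hr' : r' ≤ R + 1) : s.warr 8 r ≤ s.warr 8 r' := by
  induction r', hr using Nat.le_induction with
  | base => exact le_rfl
  | succ r' _ ih => exact (ih (by omega)).trans (h.mono r' (by omega))

/-- Lengthens the window of the level below the word variable `15` by one. -/
def commit : Prog :=
  .ite (.wlt (.var 11) (.add (.add (.var 10) (.var 1)) (.lit 1))) .skip
    (.setW 13 (.sub (.sub (.var 11) (.lit 1)) (.var 1)) ;; moveBoundary 30 ;; moveBoundary 40) ;;
  (.storeW 8 (.sub (.var 15) (.lit 1)) (.var 11) ;;
   .storeW 9 (.sub (.var 15) (.lit 1)) (.var 12) ;;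
   .storeR 2 (.sub (.var 15) (.lit 1)) (.var 5))

/-- The end of level `r` passes the position `p = J r - k`, and the boundary moves from `p` to `p +
1` in both families of runs. The strict inequality `hlt` keeps the ends sorted. -/
theorem commit_runs (hR : Ready M adaptive n k s₀) (hn : R ≤ n)
    (h : Levels M adaptive n k s₀ R i s) {r : ℕ} (hr : r ≤ R) (h₁₅ : s.wvar 15 = r + 1)
    (hlt : s.warr 8 r < s.warr 8 (r + 1)) (h₁₁ : s.wvar 11 = s.warr 8 r + 1)
    (h₁₂ : s.wvar 12 = distinct (s₀.warr 20) i (s.warr 8 r + 1))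
    (h₅ : s.rvar 5 = s₀.windowCost adaptive k i (s.warr 8 r + 1))
    (hc : s₀.cost M adaptive k i (s.warr 8 r + 1) ≤ s₀.rarr 1 r) :
    Runs M commit s fun t s' => Levels M adaptive n k s₀ R i s' ∧
      s'.warr 8 = Function.update (s.warr 8) r (s.warr 8 r + 1) ∧ t ≤ 300 := by
  have hC := hR.fits.cells
  have hW := hR.fits.words
  have hk := hR.k_le
  have hi := h.ge r hr
  have hjn := h.le (r := r + 1) (by omega)
  obtain ⟨e₀, e₁, e₃₀, e₄₀⟩ := hR.exprs h.agree
  have e₃₁ : s.warr 31 = s₀.warr 31 := h.agree (.warr 31) (by simp [Static])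
  have e₃₂ : s.warr 32 = s₀.warr 32 := h.agree (.warr 32) (by simp [Static])
  have e₄₁ : s.warr 41 = s₀.warr 41 := h.agree (.warr 41) (by simp [Static])
  have e₄₂ : s.warr 42 = s₀.warr 42 := h.agree (.warr 42) (by simp [Static])
  obtain ⟨j, hj⟩ : ∃ j, s.warr 8 r = j := ⟨_, rfl⟩
  rw [hj] at hi hlt h₁₁ h₁₂ h₅ hc ⊢
  have hmove : Runs M (.ite (.wlt (.var 11) (.add (.add (.var 10) (.var 1)) (.lit 1))) .skip
      (.setW 13 (.sub (.sub (.var 11) (.lit 1)) (.var 1)) ;; moveBoundary 30 ;; moveBoundary 40)) s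
      fun t s' => RunLinks (s₀.warr 30) i (n - k)
          (IsBoundary (Function.update (s.warr 8) r (j + 1)) R k) (s'.warr 35) (s'.warr 36) ∧
        RunLinks (s₀.warr 40) i (n - k)
          (IsBoundary (Function.update (s.warr 8) r (j + 1)) R k) (s'.warr 45) (s'.warr 46) ∧
        t ≤ 230 := by
    refine Runs.ite (by simp [h.pos, e₁]; omega) (fun hb => ?_) (fun hb => ?_)
    · simp only [BExp.val, WExp.val, h.pos, h₁₁, e₁] at hb
      -- If `J r < i + k`, both the old and the new boundary are at most `i` and thus invisible.
      have hB : ∀ x, i < x →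
          (IsBoundary (Function.update (s.warr 8) r (j + 1)) R k x ↔
            IsBoundary (s.warr 8) R k x) := by
        intro x hx
        refine exists_congr fun r' => and_congr_right fun _ => ?_
        by_cases hrr : r' = r
        · subst hrr; rw [Function.update_self]; omega
        · rw [Function.update_of_ne hrr]
      exact ⟨_, _, .skip s, h.runs_x.congr hB, h.runs_y.congr hB, by simp [BExp.cost, WExp.cost]⟩
    · simp only [BExp.val, WExp.val, h.pos, h₁₁, e₁] at hb
      obtain ⟨p, hp⟩ : ∃ p, j = p + k := ⟨j - k, by omega⟩
      refine Runs.seq ((Prog.wp.runs (Q := fun s' => s'.wvar 13 = p)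
        (by simp [h₁₁, e₁]; omega)).frame.mono ?_)
      rintro t₁ s₁ ⟨⟨ht₁, a₁⟩, hf₁⟩
      have hlt' : ∀ r' < r, s.warr 8 r' ≤ s.warr 8 (r - 1) :=
        fun r' hr' => h.mono' (by omega) (by omega)
      have hle' : s.warr 8 (r - 1) ≤ p + k := by
        rw [← hp, ← hj]; exact h.mono' (by omega) (by omega)
      have hgt' : ∀ r', r < r' → r' ≤ R → p + k < s.warr 8 r' := fun r' h₁ h₂ => by
        rw [← hp]; exact hlt.trans_le (h.mono' (by omega) (by omega))
      have f₁ : ∀ a, s₁.warr a = s.warr a := fun a => hf₁.warr a (by simp)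
      refine Runs.seq ((moveBoundary_runs hR.fits (m := n - k) (b := 30) (p := p) (i := i) (k := k)
        (r := r) (R := R) (a := s₀.warr 30) (by omega) ((hf₁.wvar 1 (by simp)).trans e₁)
        ((hf₁.wvar 10 (by simp)).trans h.pos) a₁ ((hf₁.wvar 15 (by simp)).trans h₁₅)
        (by rw [f₁, f₁, e₃₁, e₃₂]; exact hR.linked_x) (by rw [f₁, f₁, f₁]; exact h.runs_x)
        (by omega) (by omega) hr hn (by rw [f₁]; omega) (by rw [f₁]; exact hle')
        (by rw [f₁]; exact hlt') (by rw [f₁]; exact hgt') (by omega)).frame.mono ?_)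
      rintro t₂ s₂ ⟨⟨a₂, ht₂⟩, hf₂⟩
      have f₂ : ∀ a, a ≠ 35 → a ≠ 36 → s₂.warr a = s.warr a := fun a h₁ h₂ =>
        (hf₂.warr a (by simp [moveBoundary, splitPosition, mergePosition, h₁, h₂])).trans (f₁ a)
      have f₂' : ∀ a, a ≠ 13 → a ≠ 16 → a ≠ 17 → s₂.wvar a = s.wvar a := fun a h₁ h₂ h₃ =>
        (hf₂.wvar a (by simp [moveBoundary, splitPosition, mergePosition, h₂, h₃])).trans
          (hf₁.wvar a (by simp [h₁]))
      refine (moveBoundary_runs hR.fits (m := n - k) (b := 40) (p := p) (i := i) (k := k)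
        (r := r) (R := R) (a := s₀.warr 40) (by omega) ((f₂' 1 (by simp) (by simp) (by simp)).trans e₁)
        ((f₂' 10 (by simp) (by simp) (by simp)).trans h.pos)
        ((hf₂.wvar 13 (by simp [moveBoundary, splitPosition, mergePosition])).trans a₁)
        ((f₂' 15 (by simp) (by simp) (by simp)).trans h₁₅)
        (by rw [f₂ _ (by simp) (by simp), f₂ _ (by simp) (by simp), e₄₁, e₄₂]; exact hR.linked_y)
        (by rw [f₂ _ (by simp) (by simp), f₂ _ (by simp) (by simp), f₂ _ (by simp) (by simp)]
            exact h.runs_y)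
        (by omega) (by omega) hr hn (by rw [f₂ _ (by simp) (by simp)]; omega)
        (by rw [f₂ _ (by simp) (by simp)]; exact hle')
        (by rw [f₂ _ (by simp) (by simp)]; exact hlt')
        (by rw [f₂ _ (by simp) (by simp)]; exact hgt') (by omega)).frame.mono ?_
      rintro t₃ s₃ ⟨⟨a₃, ht₃⟩, hf₃⟩
      rw [f₁, ← hp] at a₂
      rw [f₂ _ (by simp) (by simp), ← hp] at a₃
      refine ⟨?_, a₃, ?_⟩
      · rw [hf₃.warr 35 (by simp [moveBoundary, splitPosition, mergePosition]),
          hf₃.warr 36 (by simp [moveBoundary, splitPosition, mergePosition])]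
        exact a₂
      · simp only [Prog.bound, WExp.cost, BExp.cost] at ht₁ ⊢
        omega
  refine Runs.seq (hmove.frame.mono ?_)
  rintro t₁ s₁ ⟨⟨a₁, a₂, ht₁⟩, hf₁⟩
  have f₁ : ∀ a ∈ [8, 9, 10, 30, 34, 40, 44], s₁.warr a = s.warr a := fun a ha => hf₁.warr a (by
    simp [moveBoundary, splitPosition, mergePosition] at ha ⊢; omega)
  have f₂ : ∀ a ∈ [10, 11, 12, 15], s₁.wvar a = s.wvar a := fun a ha => hf₁.wvar a (by
    simp [moveBoundary, splitPosition, mergePosition] at ha ⊢; omega)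
  have f₃ : ∀ a, s₁.rarr a = s.rarr a := fun a => hf₁.rarr a (by
    simp [moveBoundary, splitPosition, mergePosition])
  have f₄ := hf₁.rvar 5 (by simp [moveBoundary, splitPosition, mergePosition])
  refine (Prog.wp.runs (Q := fun s' => s'.warr 8 = Function.update (s.warr 8) r (j + 1) ∧
    s'.warr 9 = Function.update (s.warr 9) r (distinct (s₀.warr 20) i (j + 1)) ∧
    s'.rarr 2 = Function.update (s.rarr 2) r (s₀.windowCost adaptive k i (j + 1)))
    ?_).frame.mono ?_
  · simp [f₁, f₂, f₃, f₄, h₁₅, h₁₁, h₁₂, h₅]; omega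
  · rintro t₂ s₂ ⟨⟨ht₂, b₁, b₂, b₃⟩, hf₂⟩
    have g₁ : ∀ a ∈ [10, 30, 34, 40, 44], s₂.warr a = s.warr a := fun a ha =>
      (hf₂.warr a (by simp at ha ⊢; omega)).trans (f₁ a (by simp at ha ⊢; omega))
    have hagree : Agree Static s₀ s₂ := by
      refine (h.agree.frame hf₁ fun l hl => ?_).frame hf₂ fun l hl => ?_
      · rcases l with x | x | x | x <;>
          simp [Static, moveBoundary, splitPosition, mergePosition] at hl ⊢ <;> omega
      · rcases l with x | x | x | x <;> simp [Static] at hl ⊢ <;> omega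
    refine ⟨⟨hagree, ?_, fun v hv => ?_, fun v hv => ?_, ?_, fun r' hr' => ?_, fun r' hr' => ?_,
      fun r' hr' => ?_, fun r' hr' => ?_, fun r' hr' => ?_, ?_, ?_, ?_, ?_⟩, b₁, ?_⟩
    · rw [hf₂.wvar 10 (by simp), f₂ 10 (by simp), h.pos]
    · rw [g₁ 30 (by simp), g₁ (30 + 4) (by simp)]; exact h.base_x v hv
    · rw [g₁ 40 (by simp), g₁ (40 + 4) (by simp)]; exact h.base_y v hv
    · rw [b₁, Function.update_of_ne (by omega), h.top]
    · rw [b₁]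
      have := h.mono r' hr'
      rcases lt_trichotomy r' r with hlt' | rfl | hgt'
      · rw [Function.update_of_ne hlt'.ne]
        by_cases hrr : r' + 1 = r
        · rw [hrr, Function.update_self]; rw [hrr] at this; omega
        · rwa [Function.update_of_ne hrr]
      · rw [Function.update_self, Function.update_of_ne (by omega)]; omega
      · rwa [Function.update_of_ne (by omega), Function.update_of_ne (by omega)]
    · rw [b₁]
      by_cases hrr : r' = r
      · rw [hrr, Function.update_self]; omega
      · rw [Function.update_of_ne hrr]; exact h.ge r' hr'
    · rw [b₁]
      by_cases hrr : r' = r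
      · rw [hrr, Function.update_self]; exact Or.inr hc
      · rw [Function.update_of_ne hrr]; exact h.cost_le r' hr'
    · rw [b₁, b₃]
      by_cases hrr : r' = r
      · rw [hrr, Function.update_self, Function.update_self]
      · rw [Function.update_of_ne hrr, Function.update_of_ne hrr]; exact h.sum_eq r' hr'
    · rw [b₁, b₂]
      by_cases hrr : r' = r
      · rw [hrr, Function.update_self, Function.update_self]
      · rw [Function.update_of_ne hrr, Function.update_of_ne hrr]; exact h.dist_eq r' hr'
    · rw [b₁, hf₂.warr 35 (by simp), hf₂.warr 36 (by simp)]; exact a₁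
    · rw [b₁, hf₂.warr 45 (by simp), hf₂.warr 46 (by simp)]; exact a₂
    · rw [g₁ 10 (by simp), hf₂.rarr 3 (by simp), f₃]; exact h.bounds
    · rw [hf₂.rarr 3 (by simp), f₃]; exact h.covers
    · simp only [Prog.bound, WExp.cost, RExp.cost] at ht₂
      omega

end Levels

/-! ### Extending the windows of all levels -/

section Advance

variable {M : Machine} {adaptive : Bool} {n k R i : ℕ} {s₀ s : Store}

/-- Loads the window of the level below the word variable `15`. -/
def loadLevel : Prog :=
  .setW 11 (.arr 8 (.sub (.var 15) (.lit 1))) ;; .setW 12 (.arr 9 (.sub (.var 15) (.lit 1))) ;;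
  .setR 5 (.arr 2 (.sub (.var 15) (.lit 1)))

/-- Extends the window of a level, unless it ends with the window of the next level; then the real
variable `6` exceeds the threshold. -/
def tryLevel : Prog :=
  loadLevel ;;
  .ite (.wlt (.var 11) (.arr 8 (.var 15))) extendWindow
    (.setR 6 (.add (.arr 1 (.sub (.var 15) (.lit 1))) (.ofWord (.lit 1))))

/-- A window that ends with that of the next level is not tried any further. The value above the
threshold then sends the round to the relaxation; at the top level the sentinel `n` plays the part
of the next end. -/
theorem tryLevel_runs (hR : Ready M adaptive n k s₀) (hn : R ≤ n)
    (h : Levels M adaptive n k s₀ R i s) {r : ℕ} (hr : r ≤ R) (h₁₅ : s.wvar 15 = r + 1) :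
    Runs M tryLevel s fun t s' => t ≤ 200 ∧
      ((s.warr 8 r < s.warr 8 (r + 1) ∧ s'.wvar 11 = s.warr 8 r + 1 ∧
        s'.wvar 12 = distinct (s₀.warr 20) i (s.warr 8 r + 1) ∧
        s'.rvar 5 = s₀.windowCost adaptive k i (s.warr 8 r + 1) ∧
        s'.rvar 6 = s₀.cost M adaptive k i (s.warr 8 r + 1)) ∨
      (s.warr 8 r = s.warr 8 (r + 1) ∧ s₀.rarr 1 r < s'.rvar 6)) := by
  have hC := hR.fits.cells
  have hW := hR.fits.words
  have hjn := h.le (r := r + 1) (by omega)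
  have hmono := h.mono r hr
  refine Runs.seq ((Prog.wp.runs (Q := fun s' => s'.wvar 11 = s.warr 8 r ∧
    s'.wvar 12 = s.warr 9 r ∧ s'.rvar 5 = s.rarr 2 r)
    (by simp [loadLevel, h₁₅]; omega)).frame.mono ?_)
  rintro t₁ s₁ ⟨⟨ht₁, a₁, a₂, a₃⟩, hf₁⟩
  have e₁₅ := (hf₁.wvar 15 (by simp [loadLevel])).trans h₁₅
  have e₈ := hf₁.warr 8 (by simp [loadLevel])
  have h₁ : Levels M adaptive n k s₀ R i s₁ := h.congr (Agree.frame (fun l _ => by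
    cases l <;> rfl) hf₁ fun l hl => by
      rcases l with x | x | x | x <;> simp [LevelLoc, Static, loadLevel] at hl ⊢ <;> omega)
  have e₁ : s₁.rarr 1 = s₀.rarr 1 := h₁.agree (.rarr 1) (by simp [Static])
  simp only [loadLevel, Prog.bound, WExp.cost, RExp.cost] at ht₁
  refine Runs.ite (by simp [e₁₅]; omega) (fun hb => ?_) (fun hb => ?_)
  · simp only [BExp.val, WExp.val, a₁, e₁₅, e₈] at hb
    refine (extendWindow_runs hR h₁.agree (h.ge r hr) (hb.trans_le hjn) h₁.pos a₁ h₁.base_x h₁.base_y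
      (a₃.trans (h.sum_eq r hr)) (a₂.trans (h.dist_eq r hr))).mono ?_
    rintro t s' ⟨b₁, b₂, b₃, b₄, ht⟩
    refine ⟨?_, Or.inl ⟨hb, b₁, b₃, b₂, b₄⟩⟩
    simp only [BExp.cost, WExp.cost]
    omega
  · simp only [BExp.val, WExp.val, a₁, e₁₅, e₈] at hb
    refine (Prog.wp.runs (Q := fun s' => s'.rvar 6 = s₀.rarr 1 r + 1) ?_).mono ?_
    · simp [e₁₅, e₁]; omega
    · rintro t s' ⟨ht, b₁⟩
      refine ⟨?_, Or.inr ⟨by omega, by rw [b₁]; linarith⟩⟩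
      simp only [Prog.bound, BExp.cost, WExp.cost, RExp.cost] at ht ⊢
      omega

/-- Relaxes the edge of the level below the word variable `15`, and turns to the level below it. -/
def relaxLevel : Prog :=
  (.setW 16 (.arr 8 (.sub (.var 15) (.lit 1))) ;; .setR 7 (.arr 1 (.sub (.var 15) (.lit 1)))) ;;
  relax ;; .setW 15 (.sub (.var 15) (.lit 1))

/-- The edge is weighted by its threshold, not by its cost: this is an upper bound of the cost and
just what `Covers` asks for. -/
theorem relaxLevel_runs (hR : Ready M adaptive n k s₀) (hn : R ≤ n)
    (h : Levels M adaptive n k s₀ R i s) {r : ℕ} (hr : r ≤ R) (h₁₅ : s.wvar 15 = r + 1)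
    (hi : i < s.warr 8 r) :
    Runs M relaxLevel s fun t s' => Levels M adaptive n k s₀ R i s' ∧ s'.wvar 15 = r ∧
      s'.warr 8 = s.warr 8 ∧ (∀ x, s'.rarr 3 x ≤ s.rarr 3 x) ∧ s'.rarr 3 i = s.rarr 3 i ∧
      s'.rarr 3 (s.warr 8 r) ≤ s.rarr 3 i + s₀.rarr 1 r ∧ t ≤ 80 := by
  have hC := hR.fits.cells
  have hW := hR.fits.words
  have hjn := h.le (r := r) (by omega)
  have e₁ : s.rarr 1 = s₀.rarr 1 := h.agree (.rarr 1) (by simp [Static])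
  have hc := (h.cost_le r hr).resolve_left hi.ne'
  refine Runs.seq ((Prog.wp.runs (Q := fun s' => s'.wvar 16 = s.warr 8 r ∧
    s'.rvar 7 = s₀.rarr 1 r) (by simp [h₁₅, e₁]; omega)).frame.mono ?_)
  rintro t₁ s₁ ⟨⟨ht₁, a₁, a₂⟩, hf₁⟩
  have e₃ := hf₁.rarr 3 (by simp)
  refine Runs.seq ((relax_runs (c := s₀.cost M adaptive k) (u := M.f 1 1) hR.fits (i := i)
    ((hf₁.wvar 10 (by simp)).trans h.pos) a₁ hi hjn (by rw [a₂]; exact hc)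
    (by rw [e₃, hf₁.warr 10 (by simp)]; exact h.bounds)).frame.mono ?_)
  rintro t₂ s₂ ⟨⟨b₁, b₂, b₃, b₄, ht₂⟩, hf₂⟩
  refine (Prog.wp.runs (Q := fun s' => s'.wvar 15 = r) ?_).frame.mono ?_
  · simp [hf₂.wvar 15 (by simp [relax]), hf₁.wvar 15 (by simp), h₁₅]; omega
  · rintro t₃ s₃ ⟨⟨ht₃, c₁⟩, hf₃⟩
    have f₃ := hf₃.rarr 3 (by simp)
    rw [e₃] at b₂ b₃ b₄
    rw [a₂] at b₄
    refine ⟨h.relaxed (fun l hl => ((?_ : l.Same s s₁).trans (hf₂ l ?_)).trans (hf₃ l ?_)) ?_ ?_ ?_,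
      c₁, ?_, ?_, ?_, ?_, ?_⟩
    · refine hf₁ l ?_
      rcases l with x | x | x | x <;> simp [LevelLoc, Static] at hl ⊢ <;> omega
    · rcases l with x | x | x | x <;> simp [LevelLoc, Static, relax] at hl ⊢ <;> omega
    · rcases l with x | x | x | x <;> simp [LevelLoc, Static] at hl ⊢ <;> omega
    · rw [f₃, hf₃.warr 10 (by simp)]; exact b₁
    · rw [f₃]; exact b₂
    · rw [f₃]; exact fun x hx => b₃ x hx.le
    · rw [hf₃.warr 8 (by simp), hf₂.warr 8 (by simp [relax]), hf₁.warr 8 (by simp)]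
    · rw [f₃]; exact b₂
    · rw [f₃]; exact b₃ i le_rfl
    · rw [f₃]; exact b₄
    · simp only [Prog.bound, WExp.cost, RExp.cost] at ht₁ ht₃
      omega

/-- Extends the window of a level or relaxes its edge. -/
def advanceRound : Prog :=
  tryLevel ;; .ite (.rle (.var 6) (.arr 1 (.sub (.var 15) (.lit 1)))) commit relaxLevel

/-- Extends the windows of all levels as far as possible, and relaxes their edges. -/
def advance : Prog :=
  .setW 15 (.add (.var 9) (.lit 1)) ;; .loop (.wlt (.lit 0) (.var 15)) advanceRound

/-- The number of positions after the windows. -/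
def Store.slack (s : Store) (n R : ℕ) : ℕ := ∑ r ∈ Finset.range (R + 1), (n - s.warr 8 r)

theorem slack_update {s' : Store} {r : ℕ} (hr : r ≤ R) (hlt : s.warr 8 r < n)
    (h : s'.warr 8 = Function.update (s.warr 8) r (s.warr 8 r + 1)) :
    s'.slack n R < s.slack n R := by
  refine Finset.sum_lt_sum (fun r' _ => ?_) ⟨r, Finset.mem_range.2 (by omega), ?_⟩
  · rw [h]
    by_cases hrr : r' = r
    · rw [hrr, Function.update_self]; omega
    · rw [Function.update_of_ne hrr]
  · rw [h, Function.update_self]; omega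

/-- The levels are treated from the top down, so the next higher window is maximal already and a
window may stop at its end. Otherwise the first failing extension is conclusive, since costs are
monotone. Each round lengthens a window or finishes a level; the former is paid for by the slack. By
`hθ` each level admits the edge of a single symbol, so its edge is proper. -/
theorem advance_runs (hR : Ready M adaptive n k s₀) (hn : R ≤ n) (h₉ : s₀.wvar 9 = R)
    (hθ : ∀ r ≤ R, M.f 1 1 ≤ s₀.rarr 1 r) (hθ' : ∀ r < R, s₀.rarr 1 r ≤ s₀.rarr 1 (r + 1))
    (hi : i < n) (h : Levels M adaptive n k s₀ R i s) :
    Runs M advance s fun t s' => Levels M adaptive n k s₀ R i s' ∧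
      (∀ r ≤ R, i < s'.warr 8 r) ∧
      (∀ r ≤ R, Covers (s₀.cost M adaptive k) (s₀.rarr 1 r) n (s'.rarr 3) i) ∧
      t + 600 * s'.slack n R ≤ 600 * s.slack n R + 600 * (R + 2) := by
  have hC := hR.fits.cells
  have hW := hR.fits.words
  let c := s₀.cost M adaptive k
  -- The word variable `15` is one above the level in work, so that the count can go down to `0`;
  -- the levels from its value on are finished.
  let I : Store → Prop := fun s' => Levels M adaptive n k s₀ R i s' ∧ s'.wvar 15 ≤ R + 1 ∧
    ∀ r, s'.wvar 15 ≤ r → r ≤ R → (∀ j, i < j → j ≤ n → c i j ≤ s₀.rarr 1 r → j ≤ s'.warr 8 r) ∧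
      s'.rarr 3 (s'.warr 8 r) ≤ s'.rarr 3 i + s₀.rarr 1 r
  have hlong : ∀ s' : Store, ∀ r ≤ R,
      (∀ j, i < j → j ≤ n → c i j ≤ s₀.rarr 1 r → j ≤ s'.warr 8 r) → i < s'.warr 8 r := by
    intro s' r hr h'
    have := h' (i + 1) (by omega) hi (by rw [show c i (i + 1) = _ from s₀.cost_succ M adaptive k i]
                                         exact hθ r hr)
    omega
  have e₉ : s.wvar 9 = R := Eq.trans (b := s₀.wvar 9) (h.agree (.wvar 9) (by simp [Static])) h₉
  refine Runs.seq ((Prog.wp.runs (Q := fun s' => s'.wvar 15 = R + 1)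
    (by simp [e₉]; omega)).frame.mono ?_)
  rintro t₁ s₁ ⟨⟨ht₁, a₁⟩, hf₁⟩
  have h₁ : Levels M adaptive n k s₀ R i s₁ := h.congr (Agree.frame (fun l _ => by
    cases l <;> rfl) hf₁ fun l hl => by
      rcases l with x | x | x | x <;> simp [LevelLoc, Static] at hl ⊢ <;> omega)
  refine (Runs.loop I (fun s' => 600 * s'.slack n R + 600 * s'.wvar 15) ?_ ?_
    ⟨h₁, a₁.le, fun r h₁ h₂ => by omega⟩).mono ?_
  · rintro s' -
    simp; omega
  · rintro s' ⟨h₂, h₃, h₄⟩ hb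
    simp only [BExp.val, WExp.val] at hb
    obtain ⟨r, hr⟩ : ∃ r, s'.wvar 15 = r + 1 := ⟨s'.wvar 15 - 1, by omega⟩
    have hrR : r ≤ R := by omega
    refine Runs.seq ((tryLevel_runs hR hn h₂ hrR hr).frame.mono ?_)
    rintro t₂ s₂ ⟨⟨ht₂, b₁⟩, hf₂⟩
    have h₅ : Levels M adaptive n k s₀ R i s₂ := h₂.congr (Agree.frame (fun l _ => by
      cases l <;> rfl) hf₂ fun l hl => by
        rcases l with x | x | x | x <;>
          simp [LevelLoc, Static, tryLevel, loadLevel, extendWindow, addPosition] at hl ⊢ <;> omega)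
    have e₈ := hf₂.warr 8 (by simp [tryLevel, loadLevel, extendWindow, addPosition])
    have e₁₅ := (hf₂.wvar 15 (by simp [tryLevel, loadLevel, extendWindow, addPosition])).trans hr
    have e₃ := hf₂.rarr 3 (by simp [tryLevel, loadLevel, extendWindow, addPosition])
    have e₁ : s₂.rarr 1 = s₀.rarr 1 := h₅.agree (.rarr 1) (by simp [Static])
    rw [← e₈] at b₁
    have hsl : s₂.slack n R = s'.slack n R := by simp only [Store.slack, e₈]
    have hjn := h₅.le (r := r + 1) (by omega)
    refine Runs.ite (by simp [e₁₅]; omega) (fun hv => ?_) (fun hv => ?_)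
    · simp only [BExp.val, RExp.val, WExp.val, e₁₅, e₁, Nat.add_sub_cancel] at hv
      rcases b₁ with ⟨b₁, b₂, b₃, b₄, b₅⟩ | ⟨-, b₁⟩
      · refine (commit_runs hR hn h₅ hrR e₁₅ b₁ b₂ b₃ b₄ (by rw [← b₅]; exact hv)).frame.mono ?_
        rintro t₃ s₃ ⟨⟨c₁, c₂, ht₃⟩, hf₃⟩
        have f₁₅ := hf₃.wvar 15 (by simp [commit, moveBoundary, splitPosition, mergePosition])
        have f₃ := hf₃.rarr 3 (by simp [commit, moveBoundary, splitPosition, mergePosition])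
        have hdec := slack_update (n := n) hrR (by omega) c₂
        refine ⟨⟨c₁, by omega, fun r' h₁ h₂ => ?_⟩, ?_⟩
        · have hne : r' ≠ r := by omega
          rw [c₂, Function.update_of_ne hne, f₃, e₃, e₈]
          exact h₄ r' (by omega) h₂
        · simp only [BExp.cost, RExp.cost, WExp.cost]
          omega
      · exact absurd hv (not_le.2 b₁)
    · simp only [BExp.val, RExp.val, WExp.val, e₁₅, e₁, Nat.add_sub_cancel, not_le] at hv
      have hmax : ∀ j, i < j → j ≤ n → c i j ≤ s₀.rarr 1 r → j ≤ s₂.warr 8 r := by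
        intro j hij hj hc
        rcases b₁ with ⟨b₁, b₂, b₃, b₄, b₅⟩ | ⟨b₁, -⟩
        · by_contra hcon
          rw [b₅] at hv
          have := hR.cost_mono i (s₂.warr 8 r + 1) i j le_rfl
            (Nat.lt_succ_of_le (h₅.ge r hrR)) (by omega) hj
          exact absurd (this.trans hc) (not_le.2 hv)
        · rw [b₁]
          rcases hrR.lt_or_eq with hlt | rfl
          · rw [e₈]
            exact (h₄ (r + 1) (by omega) hlt).1 j hij hj (hc.trans (hθ' r hlt))
          · rw [h₅.top]; exact hj
      refine (relaxLevel_runs hR hn h₅ hrR e₁₅ (hlong s₂ r hrR hmax)).mono ?_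
      rintro t₃ s₃ ⟨c₁, c₂, c₃, c₄, c₅, c₆, ht₃⟩
      refine ⟨⟨c₁, by omega, fun r' h₁ h₂ => ?_⟩, ?_⟩
      · rw [c₃, c₅]
        rcases (show r ≤ r' by omega).eq_or_lt with rfl | hlt
        · exact ⟨hmax, c₆⟩
        · have := h₄ r' (by omega) h₂
          rw [← e₈, ← e₃] at this
          exact ⟨this.1, (c₄ _).trans this.2⟩
      · have : s₃.slack n R = s₂.slack n R := by simp only [Store.slack, c₃]
        simp only [BExp.cost, RExp.cost, WExp.cost]
        omega
  · rintro t s' ⟨⟨h₂, h₃, h₄⟩, hb, ht⟩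
    simp only [BExp.val, WExp.val, not_lt, Nat.le_zero] at hb
    have hsl : s₁.slack n R = s.slack n R := by
      simp only [Store.slack, hf₁.warr 8 (by simp)]
    refine ⟨h₂, fun r hr => hlong s' r hr (h₄ r (by omega) hr).1, fun r hr =>
      ⟨s'.warr 8 r, h₂.le (by omega), h₄ r (by omega) hr⟩, ?_⟩
    simp only [Prog.bound, BExp.cost, WExp.cost] at ht ht₁
    omega

end Advance

/-! ### Removing the left end from the windows -/

section DropPosition

/-- Turns to the boundary in the word variable `13`, for the names in the array `b`: the word
variable `b + 10` becomes the last position before the boundary with the value at the word variable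
`10`, and the word variable `b + 11` the next one. -/
def walkStep (b : ℕ) : Prog :=
  .ite (.wlt (.var (b + 11)) (.var 13))
    (.setW (b + 10) (.arr (b + 6) (.var (b + 11))) ;;
     .setW (b + 11) (.arr (b + 2) (.var (b + 10)))) .skip

/-- Constant time for any number of occurrences between `e` and `e'`: they form at most one run,
which `WalkAt.move` jumps over; if there is none, `WalkAt.stay` applies. -/
theorem walkStep_runs {M : Machine} {n m b i e e' : ℕ} (hM : Fits M n) (hm : m ≤ n) {s : Store}
    {a pv F : ℕ → ℕ} {B : ℕ → Prop} (h₁₃ : s.wvar 13 = e')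
    (hl : Linked a m pv (s.warr (b + 2))) (h : RunLinks a i m B F (s.warr (b + 6)))
    (hw : WalkAt a i m e (s.wvar (b + 10)) (s.wvar (b + 11))) (hi : i ≤ e) (him : i < m)
    (hee : e ≤ e') (he' : e' ≤ m) (hB : e = i ∨ B e) (hB' : e' = i ∨ B e')
    (hbetween : ∀ x, B x → e < x → e' ≤ x) :
    Runs M (walkStep b) s fun t s' =>
      WalkAt a i m e' (s'.wvar (b + 10)) (s'.wvar (b + 11)) ∧ t ≤ 20 := by
  have hC := hM.cells
  have hW := hM.words
  refine (Prog.wp.runs (Q := fun s' => WalkAt a i m e' (s'.wvar (b + 10)) (s'.wvar (b + 11)))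
    ?_).mono ?_
  · simp only [walkStep, Prog.wp, BExp.good, BExp.val, WExp.good, WExp.val, h₁₃]
    refine ⟨⟨trivial, trivial⟩, fun hf => ?_, fun hf => ?_⟩
    · have hmove := hw.move h hl hi hB hB' hbetween he' hf
      have h₁ := hw.le_fw
      have h₂ := hmove.cur_lt (by omega)
      simp
      exact ⟨by omega, by omega, hmove⟩
    · exact hw.stay hi him hee he' (by omega)
  · rintro t s' ⟨ht, h₁⟩
    refine ⟨h₁, ?_⟩
    simp only [walkStep, Prog.bound, BExp.cost, WExp.cost] at ht
    omega

/-- Drops the position in the word variable `10` from the window of the level in the word variable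
`15`, for the names in the array `b`: the entropy part changes by the increment of the weight, with
the sign `+` if `plus`. -/
def dropPosition (b : ℕ) (plus : Bool) : Prog :=
  .setW 14 (.sub (.arr (b + 3) (.var (b + 10))) (.arr (b + 3) (.var 10))) ;;
  .setR 7 (.sub (.arr 0 (.add (.var 14) (.lit 1))) (.arr 0 (.var 14))) ;;
  .storeR 2 (.var 15) (if plus then .add (.arr 2 (.var 15)) (.var 7)
    else .sub (.arr 2 (.var 15)) (.var 7))

/-- The count that remains in the window is the rank of the last occurrence minus the rank of `i`,
by `WalkAt.cnt_eq`; no counter of the level is needed. -/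
theorem dropPosition_runs {M : Machine} {n m b i e r : ℕ} (hM : Fits M n) (hm : m ≤ n) {s : Store}
    {a : ℕ → ℕ} {adaptive : Bool} (h₁₀ : s.wvar 10 = i) (h₁₅ : s.wvar 15 = r) (hr : r ≤ n)
    {fw : ℕ} (hw : WalkAt a i m e (s.wvar (b + 10)) fw) (hi : i < e) (he : e ≤ m)
    (hrank : ∀ p < m, s.warr (b + 3) p = cnt a 0 p (a p))
    (hg : ∀ t ≤ n, s.rarr 0 t = weight adaptive t) (plus : Bool) :
    Runs M (dropPosition b plus) s fun t s' => s'.rarr 2 = Function.update (s.rarr 2) r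
      (s.rarr 2 r + (if plus then 1 else -1) * (weight adaptive (cnt a (i + 1) e (a i) + 1) -
        weight adaptive (cnt a (i + 1) e (a i)))) ∧ t ≤ 40 := by
  have hC := hM.cells
  have hW := hM.words
  have hcur := hw.cur_lt hi
  have hcnt := hw.cnt_eq hi
  have hcle := cnt_le a (i + 1) e (a i)
  have h₁ := hrank (s.wvar (b + 10)) (by omega)
  have h₂ := hrank i (by omega)
  have hw₁ := hg (cnt a (i + 1) e (a i)) (by omega)
  have hw₂ := hg (cnt a (i + 1) e (a i) + 1) (by omega)
  rw [← h₁, ← h₂] at hcnt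
  rw [hcnt] at hw₁ hw₂ hcle ⊢
  refine (Prog.wp.runs (Q := fun s' => s'.rarr 2 = Function.update (s.rarr 2) r
      (s.rarr 2 r + (if plus then 1 else -1) * (weight adaptive (s.warr (b + 3) (s.wvar (b + 10)) -
        s.warr (b + 3) i + 1) - weight adaptive (s.warr (b + 3) (s.wvar (b + 10)) -
        s.warr (b + 3) i)))) ?_).mono fun t s' h => ⟨h.2, ?_⟩
  · cases plus
    · simp [dropPosition, h₁₀, h₁₅, hw₁, hw₂]
      and_intros
      any_goals omega
      congr 1
      ring
    · simp [dropPosition, h₁₀, h₁₅, hw₁, hw₂]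
      omega
  · have := h.1
    cases plus <;> simp [dropPosition, Prog.bound, WExp.cost, RExp.cost] at this <;> omega

end DropPosition

section Drop

variable {M : Machine} {adaptive : Bool} {n k R i : ℕ} {s₀ s : Store}

/-- Drops the position in the word variable `10` from the window of the level in the word variable
`15`. -/
def dropLevel : Prog :=
  .setW 11 (.arr 8 (.var 15)) ;;
  .ite (.wlt (.add (.var 10) (.var 1)) (.var 11))
    (.setW 13 (.sub (.var 11) (.var 1)) ;; walkStep 30 ;; walkStep 40 ;;
     dropPosition 30 false ;; dropPosition 40 true) .skip ;;
  .ite (.wlt (.arr 22 (.var 10)) (.var 11)) .skip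
    (.storeW 9 (.var 15) (.sub (.arr 9 (.var 15)) (.lit 1)))

/-- The walks over the positions with the names at `i` have passed the boundaries of the levels
below `r`. -/
def Walks (s₀ : Store) (n k i : ℕ) (J : ℕ → ℕ) (r : ℕ) (s : Store) : Prop :=
  ∃ e, i ≤ e ∧ (e = i ∨ ∃ r' < r, J r' = e + k) ∧ (∀ r' < r, J r' ≤ e + k) ∧
    WalkAt (s₀.warr 30) i (n - k) e (s.wvar 40) (s.wvar 41) ∧
    WalkAt (s₀.warr 40) i (n - k) e (s.wvar 50) (s.wvar 51)

theorem Levels.agree_of (h : Levels M adaptive n k s₀ R i s) {s' : Store} {K : Loc → Prop}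
    (hs : Agree K s s') (hK : ∀ l, Static l → K l) : Agree Static s₀ s' :=
  fun l hl => (h.agree l hl).trans (hs l (hK l hl))

/-- The parts of the memory that are fixed while a position is dropped. -/
def DropFixed (l : Loc) : Prop := LevelLoc l ∧ l ≠ .warr 9 ∧ l ≠ .rarr 2

theorem Static.dropFixed {l : Loc} (hl : Static l) : DropFixed l :=
  ⟨Or.inl hl, by rintro rfl; simp [Static] at hl, by rintro rfl; simp [Static] at hl⟩

theorem DropFixed.keeps {l : Loc} (hl : DropFixed l) : dropLevel.Keeps l := by
  rcases l with x | x | x | x <;>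
    simp [DropFixed, LevelLoc, Static, dropLevel, walkStep, dropPosition] at hl ⊢ <;> omega

/-- Levels come in increasing order, so the walk meets the boundaries from left to right, and
repeated ones do no harm. If the window contains no complete string of length `k + 1`, its sums are
empty and the walk does not move. -/
theorem dropLevel_runs (hR : Ready M adaptive n k s₀) (hn : R ≤ n)
    (h : Levels M adaptive n k s₀ R i s) (hlong : ∀ r ≤ R, i < s.warr 8 r) {s₁ : Store}
    (hs : Agree DropFixed s s₁) {r : ℕ} (hr : r ≤ R) (h₁₅ : s₁.wvar 15 = r)
    (hw : Walks s₀ n k i (s.warr 8) r s₁)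
    (hS : s₁.rarr 2 r = s₀.windowCost adaptive k i (s.warr 8 r))
    (hD : s₁.warr 9 r = distinct (s₀.warr 20) i (s.warr 8 r)) :
    Runs M dropLevel s₁ fun t s' => Walks s₀ n k i (s.warr 8) (r + 1) s' ∧
      s'.rarr 2 = Function.update (s₁.rarr 2) r (s₀.windowCost adaptive k (i + 1) (s.warr 8 r)) ∧
      s'.warr 9 = Function.update (s₁.warr 9) r (distinct (s₀.warr 20) (i + 1) (s.warr 8 r)) ∧
      t ≤ 250 := by
  have hC := hR.fits.cells
  have hW := hR.fits.words
  have hk := hR.k_le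
  have hagree := h.agree_of hs fun l hl => hl.dropFixed
  obtain ⟨e₀, e₁, e₃₀, e₄₀⟩ := hR.exprs hagree
  have e₂₂ : s₁.warr 22 = s₀.warr 22 := hagree (.warr 22) (by simp [Static])
  have e₈ : s₁.warr 8 = s.warr 8 := hs (.warr 8) (by simp [DropFixed, LevelLoc])
  have e₁₀ : s₁.wvar 10 = i := Eq.trans (b := s.wvar 10)
    (hs (.wvar 10) (by simp [DropFixed, LevelLoc])) h.pos
  have e₃₆ : s₁.warr 36 = s.warr 36 := hs (.warr 36) (by simp [DropFixed, LevelLoc])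
  have e₄₆ : s₁.warr 46 = s.warr 46 := hs (.warr 46) (by simp [DropFixed, LevelLoc])
  have hJ := h.le (r := r) (by omega)
  have hiJ := hlong r hr
  obtain ⟨J, hJr⟩ : ∃ J, s.warr 8 r = J := ⟨_, rfl⟩
  obtain ⟨e, he₁, he₂, he₃, hwx, hwy⟩ := hw
  rw [hJr] at hS hD hJ hiJ ⊢
  refine Runs.seq ((Prog.wp.runs (Q := fun s' => s'.wvar 11 = J)
    (by simp [h₁₅, e₈, hJr]; omega)).frame.mono ?_)
  rintro t₂ s₂ ⟨⟨ht₂, a₁⟩, hf₂⟩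
  have f₂ : ∀ x, x ≠ 11 → s₂.wvar x = s₁.wvar x := fun x hx => hf₂.wvar x (by simpa using hx)
  have g₂ : ∀ x, s₂.warr x = s₁.warr x := fun x => hf₂.warr x (by simp)
  have r₂ : ∀ x, s₂.rarr x = s₁.rarr x := fun x => hf₂.rarr x (by simp)
  have hfirst : Runs M (.ite (.wlt (.add (.var 10) (.var 1)) (.var 11))
      (.setW 13 (.sub (.var 11) (.var 1)) ;; walkStep 30 ;; walkStep 40 ;;
        dropPosition 30 false ;; dropPosition 40 true) .skip) s₂ fun t s' =>
      Walks s₀ n k i (s.warr 8) (r + 1) s' ∧ s'.rarr 2 = Function.update (s₁.rarr 2) r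
        (s₀.windowCost adaptive k (i + 1) J) ∧ t ≤ 200 := by
    refine Runs.ite (by simp [f₂, e₁, e₁₀]; omega) (fun hb => ?_) (fun hb => ?_)
    · simp only [BExp.val, WExp.val, a₁, f₂ 10 (by simp), f₂ 1 (by simp), e₁₀, e₁] at hb
      obtain ⟨e', he'⟩ : ∃ e', J = e' + k := ⟨J - k, by omega⟩
      have hee : e ≤ e' := by
        rcases he₂ with rfl | ⟨r', hr', he⟩
        · omega
        · have := h.mono' (r := r') (r' := r) hr'.le (by omega)
          omega
      have hB : e = i ∨ IsBoundary (s.warr 8) R k e :=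
        he₂.imp_right fun ⟨r', hr', he⟩ => ⟨r', by omega, he⟩
      have hB' : e' = i ∨ IsBoundary (s.warr 8) R k e' := Or.inr ⟨r, hr, by omega⟩
      -- Lower levels have been passed and higher ones end no earlier, so `e` and `e'` are
      -- neighbours or equal.
      have hbetween : ∀ x, IsBoundary (s.warr 8) R k x → e < x → e' ≤ x := by
        rintro x ⟨r', hr', hx⟩ hex
        rcases lt_or_ge r' r with hlt | hge
        · have := he₃ r' hlt; omega
        · have := h.mono' (r := r) (r' := r') hge (by omega)
          omega
      refine Runs.seq ((Prog.wp.runs (Q := fun s' => s'.wvar 13 = e')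
        (by simp [a₁, f₂, e₁]; omega)).frame.mono ?_)
      rintro t₃ s₃ ⟨⟨ht₃, b₁⟩, hf₃⟩
      have f₃ : ∀ x, x ≠ 11 → x ≠ 13 → s₃.wvar x = s₁.wvar x := fun x hx hx' =>
        (hf₃.wvar x (by simpa using hx')).trans (f₂ x hx)
      have g₃ : ∀ x, s₃.warr x = s₁.warr x := fun x => (hf₃.warr x (by simp)).trans (g₂ x)
      have r₃ : ∀ x, s₃.rarr x = s₁.rarr x := fun x => (hf₃.rarr x (by simp)).trans (r₂ x)
      refine Runs.seq ((walkStep_runs hR.fits (m := n - k) (b := 30) (pv := s₀.warr 31)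
        (F := s.warr 35) (by omega) b₁ (by rw [g₃, hagree (.warr 32) (by simp [Static])]; exact hR.linked_x)
        (by rw [g₃, e₃₆]; exact h.runs_x)
        (by rw [f₃ _ (by simp) (by simp), f₃ _ (by simp) (by simp)]; exact hwx) he₁ (by omega) hee
        (by omega) hB hB' hbetween).frame.mono ?_)
      rintro t₄ s₄ ⟨⟨c₁, ht₄⟩, hf₄⟩
      have f₄ : ∀ x, x ≠ 11 → x ≠ 13 → x ≠ 40 → x ≠ 41 → s₄.wvar x = s₁.wvar x :=
        fun x h₁ h₂ h₃ h₄ => (hf₄.wvar x (by simp [walkStep, h₃, h₄])).trans (f₃ x h₁ h₂)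
      have g₄ : ∀ x, s₄.warr x = s₁.warr x := fun x =>
        (hf₄.warr x (by simp [walkStep])).trans (g₃ x)
      have r₄ : ∀ x, s₄.rarr x = s₁.rarr x := fun x =>
        (hf₄.rarr x (by simp [walkStep])).trans (r₃ x)
      refine Runs.seq ((walkStep_runs hR.fits (m := n - k) (b := 40) (pv := s₀.warr 41)
        (F := s.warr 45) (by omega) ((hf₄.wvar 13 (by simp [walkStep])).trans b₁)
        (by rw [g₄, hagree (.warr 42) (by simp [Static])]; exact hR.linked_y)
        (by rw [g₄, e₄₆]; exact h.runs_y)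
        (by rw [f₄ _ (by simp) (by simp) (by simp) (by simp),
              f₄ _ (by simp) (by simp) (by simp) (by simp)]; exact hwy) he₁ (by omega) hee
        (by omega) hB hB' hbetween).frame.mono ?_)
      rintro t₅ s₅ ⟨⟨d₁, ht₅⟩, hf₅⟩
      have c₂ : WalkAt (s₀.warr 30) i (n - k) e' (s₅.wvar (30 + 10)) (s₅.wvar (30 + 11)) := by
        rw [hf₅.wvar (30 + 10) (by simp [walkStep]), hf₅.wvar (30 + 11) (by simp [walkStep])]
        exact c₁
      have g₅ : ∀ x, s₅.warr x = s₁.warr x := fun x =>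
        (hf₅.warr x (by simp [walkStep])).trans (g₄ x)
      have r₅ : ∀ x, s₅.rarr x = s₁.rarr x := fun x =>
        (hf₅.rarr x (by simp [walkStep])).trans (r₄ x)
      have hg : ∀ t ≤ n, s₁.rarr 0 t = weight adaptive t := by
        rw [hagree (.rarr 0) (by simp [Static])]; exact hR.weight_eq
      have p₁₀ : s₅.wvar 10 = i := by
        rw [hf₅.wvar 10 (by simp [walkStep]), f₄ 10 (by simp) (by simp) (by simp) (by simp), e₁₀]
      have p₁₅ : s₅.wvar 15 = r := by
        rw [hf₅.wvar 15 (by simp [walkStep]), f₄ 15 (by simp) (by simp) (by simp) (by simp), h₁₅]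
      refine Runs.seq ((dropPosition_runs hR.fits (m := n - k) (b := 30) (e := e') (i := i)
        (adaptive := adaptive) (by omega) p₁₀ p₁₅
        (by omega) c₂ (by omega) (by omega)
        (by rw [g₅, hagree (.warr 33) (by simp [Static])]; exact hR.rank_x)
        (by rw [r₅]; exact hg) false).frame.mono ?_)
      rintro t₆ s₆ ⟨⟨q₁, ht₆⟩, hf₆⟩
      have f₆ : ∀ x, x ≠ 14 → s₆.wvar x = s₅.wvar x := fun x hx => hf₆.wvar x (by
        simpa [dropPosition] using hx)
      refine (dropPosition_runs hR.fits (m := n - k) (b := 40) (e := e') (i := i)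
        (a := s₀.warr 40) (fw := s₅.wvar 51)
        (adaptive := adaptive) (by omega) ((f₆ 10 (by simp)).trans p₁₀) ((f₆ 15 (by simp)).trans p₁₅)
        (by omega) (by rw [f₆ _ (by simp)]; exact d₁) (by omega) (by omega)
        (by rw [hf₆.warr _ (by simp [dropPosition]), g₅, hagree (.warr 43) (by simp [Static])]
            exact hR.rank_y)
        (by rw [hf₆.rarr 0 (by simp [dropPosition]), r₅]; exact hg) true).frame.mono ?_
      rintro t₇ s₇ ⟨⟨q₂, ht₇⟩, hf₇⟩
      have f₇ : ∀ x, x ≠ 14 → s₇.wvar x = s₅.wvar x := fun x hx => (hf₇.wvar x (by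
        simpa [dropPosition] using hx)).trans (f₆ x hx)
      refine ⟨⟨e', by omega, Or.inr ⟨r, by omega, by omega⟩, fun r' hr' => ?_, ?_, ?_⟩, ?_, ?_⟩
      · have := h.mono' (r := r') (r' := r) (by omega) (by omega)
        omega
      · rw [f₇ 40 (by simp), f₇ 41 (by simp)]; exact c₂
      · rw [f₇ 50 (by simp), f₇ 51 (by simp)]; exact d₁
      · rw [q₂, q₁, r₅, Function.update_self, Function.update_idem, hS]
        congr 1
        simp only [Store.windowCost]
        rw [show J - k = e' by omega, windowSum_succ_left _ (s₀.warr 30) (l := i) (by omega),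
          windowSum_succ_left _ (s₀.warr 40) (l := i) (by omega)]
        simp
        ring
      · simp only [Prog.bound, BExp.cost, WExp.cost] at ht₃ ⊢
        omega
    · simp only [BExp.val, WExp.val, a₁, f₂ 10 (by simp), f₂ 1 (by simp), e₁₀, e₁] at hb
      refine ⟨_, _, .skip s₂, ⟨e, he₁, he₂.imp_right fun ⟨r', hr', he⟩ => ⟨r', by omega, he⟩,
        fun r' hr' => ?_, ?_, ?_⟩, ?_, by simp [BExp.cost, WExp.cost]⟩
      · have := h.mono' (r := r') (r' := r) (by omega) (by omega)
        omega
      · rw [f₂ 40 (by simp), f₂ 41 (by simp)]; exact hwx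
      · rw [f₂ 50 (by simp), f₂ 51 (by simp)]; exact hwy
      · rw [r₂, eq_comm]
        refine Function.update_eq_self_iff.2 ?_
        rw [hS]
        simp only [Store.windowCost]
        rw [windowSum_of_le _ _ (by omega), windowSum_of_le _ _ (by omega),
          windowSum_of_le _ _ (by omega), windowSum_of_le _ _ (by omega)]
  refine Runs.seq (hfirst.frame.mono ?_)
  rintro t₃ s₃ ⟨⟨b₁, b₂, ht₃⟩, hf₃⟩
  have f₃ : ∀ x ∈ [10, 11, 15], s₃.wvar x = s₂.wvar x := fun x hx => hf₃.wvar x (by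
    simp [walkStep, dropPosition] at hx ⊢; omega)
  have g₃ : ∀ x, s₃.warr x = s₁.warr x := fun x => (hf₃.warr x (by
    simp [walkStep, dropPosition])).trans (g₂ x)
  have hdist : distinct (s₀.warr 20) (i + 1) J = if s₀.warr 22 i < J then
      distinct (s₀.warr 20) i J else distinct (s₀.warr 20) i J - 1 := by
    rw [distinct_succ_left _ hiJ]
    simp only [hR.linked_z.cnt_eq_zero_iff_nx (i := i) (j := J) (by omega) hJ]
    split_ifs <;> omega
  refine (Prog.wp.runs (Q := fun s' => s'.warr 9 = Function.update (s₁.warr 9) r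
    (distinct (s₀.warr 20) (i + 1) J)) ?_).frame.mono ?_
  · simp [f₃, g₃, f₂, e₁₀, h₁₅, a₁, e₂₂, hD, hdist]
    refine ⟨by omega, fun hlt => ?_, fun hle => ?_⟩
    · intro hle; omega
    · rw [if_neg (by omega)]
      simp
      omega
  · rintro t₄ s₄ ⟨⟨ht₄, c₁⟩, hf₄⟩
    have f₄ : ∀ x, s₄.wvar x = s₃.wvar x := fun x => hf₄.wvar x (by simp)
    refine ⟨?_, ?_, c₁, ?_⟩
    · simpa only [Walks, f₄] using b₁
    · rw [hf₄.rarr 2 (by simp)]; exact b₂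
    · simp only [Prog.bound, BExp.cost, WExp.cost] at ht₂ ht₄
      omega

end Drop

/-! ### One step of the left end and the amortized time -/

section DropAll

variable {M : Machine} {adaptive : Bool} {n k R i : ℕ} {s₀ s : Store}

/-- Drops the position in the word variable `10` from the windows of all levels. -/
def dropAll : Prog :=
  (.setW 40 (.var 10) ;; .setW 41 (.var 10) ;; .setW 50 (.var 10) ;; .setW 51 (.var 10)) ;;
  .forUp 15 (.add (.var 9) (.lit 1)) dropLevel ;;
  .ite (.wlt (.var 10) (.var 8))
    (.setW 13 (.var 10) ;; splitPosition 30 ;; splitPosition 40) .skip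

theorem DropFixed.keeps_dropAll {l : Loc}
    (hl : DropFixed l ∧ l ∉ [.warr 35, .warr 36, .warr 45, .warr 46]) : dropAll.Keeps l := by
  have := hl.1.keeps
  rcases l with x | x | x | x <;>
    simp [DropFixed, LevelLoc, Static, dropAll, Prog.forUp, splitPosition] at hl ⊢ <;>
    simp [this] <;> omega

theorem RunLinks.of_le {a F L : ℕ → ℕ} {m : ℕ} {B : ℕ → Prop} (h : m ≤ i) :
    RunLinks a i m B F L := fun p q hr => by
  have h₁ := hr.le_fst
  have h₂ := hr.le
  have h₃ := hr.lt
  omega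

/-- The runs must still contain `i` while the walk of all levels uses them. Only afterwards is `i`
split off, and `RunLinks.drop` shifts the left end to `i + 1`. -/
theorem dropAll_runs (hR : Ready M adaptive n k s₀) (hn : R ≤ n) (h₉ : s₀.wvar 9 = R)
    (h : Levels M adaptive n k s₀ R i s) (hlong : ∀ r ≤ R, i < s.warr 8 r) :
    Runs M dropAll s fun t s' =>
      (∀ r ≤ R, s'.rarr 2 r = s₀.windowCost adaptive k (i + 1) (s.warr 8 r)) ∧
      (∀ r ≤ R, s'.warr 9 r = distinct (s₀.warr 20) (i + 1) (s.warr 8 r)) ∧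
      RunLinks (s₀.warr 30) (i + 1) (n - k) (IsBoundary (s.warr 8) R k) (s'.warr 35) (s'.warr 36) ∧
      RunLinks (s₀.warr 40) (i + 1) (n - k) (IsBoundary (s.warr 8) R k) (s'.warr 45) (s'.warr 46) ∧
      t ≤ 350 * (R + 2) := by
  have hC := hR.fits.cells
  have hW := hR.fits.words
  have e₉ : s.wvar 9 = R := Eq.trans (b := s₀.wvar 9) (h.agree (.wvar 9) (by simp [Static])) h₉
  have e₈ : s.wvar 8 = n - k := Eq.trans (b := s₀.wvar 8) (h.agree (.wvar 8) (by simp [Static]))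
    hR.m_eq
  refine Runs.seq ((Prog.wp.runs (Q := fun s' => s'.wvar 40 = i ∧ s'.wvar 41 = i ∧
    s'.wvar 50 = i ∧ s'.wvar 51 = i) (by simp [h.pos])).frame.mono ?_)
  rintro t₁ s₁ ⟨⟨ht₁, a₁, a₂, a₃, a₄⟩, hf₁⟩
  have hs₁ : Agree DropFixed s s₁ := fun l hl => hf₁ l (by
    rcases l with x | x | x | x <;> simp [DropFixed, LevelLoc, Static] at hl ⊢; omega)
  refine Runs.seq ((Runs.forUp (fun r s' => Agree DropFixed s s' ∧ s'.wvar 15 = r ∧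
    Walks s₀ n k i (s.warr 8) r s' ∧
    (∀ r' ≤ R, s'.rarr 2 r' =
      s₀.windowCost adaptive k (if r' < r then i + 1 else i) (s.warr 8 r')) ∧
    ∀ r' ≤ R, s'.warr 9 r' =
      distinct (s₀.warr 20) (if r' < r then i + 1 else i) (s.warr 8 r')) (R + 1) 250 (by omega)
    ⟨hs₁.setW (by simp [DropFixed, LevelLoc, Static]) 0, by simp,
      ⟨i, le_rfl, Or.inl rfl, by omega, ?_, ?_⟩, ?_, ?_⟩ ?_ ?_).frame.mono ?_)
  · simp only [a₁, a₂, ne_eq, Nat.reduceEqDiff, not_false_eq_true, Function.update_of_ne]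
    exact WalkAt.start i
  · simp only [a₃, a₄, ne_eq, Nat.reduceEqDiff, not_false_eq_true, Function.update_of_ne]
    exact WalkAt.start i
  · intro r hr
    simp only [hf₁.rarr 2 (by simp)]
    exact h.sum_eq r hr
  · intro r hr
    simp only [hf₁.warr 9 (by simp)]
    exact h.dist_eq r hr
  · rintro r s' hr ⟨h₁, h₂, -⟩
    have : s'.wvar 9 = R := Eq.trans (b := s.wvar 9)
      (h₁ (.wvar 9) (Static.dropFixed (by simp [Static]))) e₉
    simp [this, h₂]
    omega
  · rintro r s' hr ⟨h₁, h₂, h₃, h₄, h₅⟩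
    refine (dropLevel_runs hR hn h hlong h₁ (by omega) h₂ h₃
      (by rw [h₄ r (by omega), if_neg (lt_irrefl r)])
      (by rw [h₅ r (by omega), if_neg (lt_irrefl r)])).frame.mono ?_
    rintro t s'' ⟨⟨b₁, b₂, b₃, ht⟩, hf⟩
    refine ⟨ht, ?_, Agree.setW (h₁.frame hf fun l hl => hl.keeps)
      (by simp [DropFixed, LevelLoc, Static]) _, by simp, ?_, fun r' hr' => ?_, fun r' hr' => ?_⟩
    · rw [hf.wvar 15 (by simp [dropLevel, walkStep, dropPosition]), h₂]
    · simpa [Walks] using b₁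
    · simp only [b₂]
      by_cases hrr : r' = r
      · rw [hrr, Function.update_self, if_pos (Nat.lt_succ_self r)]
      · rw [Function.update_of_ne hrr, h₄ r' hr']
        simp only [show r' < r + 1 ↔ r' < r by omega]
    · simp only [b₃]
      by_cases hrr : r' = r
      · rw [hrr, Function.update_self, if_pos (Nat.lt_succ_self r)]
      · rw [Function.update_of_ne hrr, h₅ r' hr']
        simp only [show r' < r + 1 ↔ r' < r by omega]
  · rintro t₂ s₂ ⟨⟨⟨b₁, b₂, -, b₃, b₄⟩, ht₂⟩, hf₂⟩
    have hk : ∀ a ∈ [35, 36, 45, 46], s₂.warr a = s.warr a := fun a ha =>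
      b₁ (.warr a) (by simp [DropFixed, LevelLoc] at ha ⊢; omega)
    have hagree := h.agree_of b₁ fun l hl => hl.dropFixed
    have e₁₀ : s₂.wvar 10 = i := Eq.trans (b := s.wvar 10)
      (b₁ (.wvar 10) (by simp [DropFixed, LevelLoc])) h.pos
    have e₈' : s₂.wvar 8 = n - k := Eq.trans (b := s₀.wvar 8) (hagree (.wvar 8) (by simp [Static]))
      hR.m_eq
    have b₃' : ∀ r ≤ R, s₂.rarr 2 r = s₀.windowCost adaptive k (i + 1) (s.warr 8 r) :=
      fun r hr => by rw [b₃ r hr, if_pos (by omega)]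
    have b₄' : ∀ r ≤ R, s₂.warr 9 r = distinct (s₀.warr 20) (i + 1) (s.warr 8 r) :=
      fun r hr => by rw [b₄ r hr, if_pos (by omega)]
    simp only [Prog.bound, WExp.cost] at ht₁ ht₂
    refine Runs.ite (by simp) (fun hb => ?_) (fun hb => ?_)
    · simp only [BExp.val, WExp.val, e₁₀, e₈'] at hb
      refine Runs.seq ((Prog.wp.runs (Q := fun s' => s'.wvar 13 = i) (by simp [e₁₀])).frame.mono ?_)
      rintro t₃ s₃ ⟨⟨ht₃, c₁⟩, hf₃⟩
      have g₃ : ∀ a, s₃.warr a = s₂.warr a := fun a => hf₃.warr a (by simp)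
      refine Runs.seq ((splitPosition_runs hR.fits (m := n - k) (b := 30) (i := i)
        (B := IsBoundary (s.warr 8) R k) (by omega) c₁
        (by rw [g₃, hagree (.warr 32) (by simp [Static])]; exact hR.linked_x)
        (by rw [g₃, g₃, hk (30 + 5) (by simp), hk (30 + 6) (by simp)]; exact h.runs_x)
        le_rfl hb (Or.inr rfl)).frame.mono ?_)
      rintro t₄ s₄ ⟨⟨d₁, ht₄⟩, hf₄⟩
      have g₄ : ∀ a, a ≠ 35 → a ≠ 36 → s₄.warr a = s₂.warr a := fun a h₁ h₂ =>
        (hf₄.warr a (by simp [splitPosition, h₁, h₂])).trans (g₃ a)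
      refine (splitPosition_runs hR.fits (m := n - k) (b := 40) (i := i)
        (B := IsBoundary (s.warr 8) R k) (by omega)
        ((hf₄.wvar 13 (by simp [splitPosition])).trans c₁)
        (by rw [g₄ _ (by simp) (by simp), hagree (.warr 42) (by simp [Static])]; exact hR.linked_y)
        (by rw [g₄ _ (by simp) (by simp), g₄ _ (by simp) (by simp), hk (40 + 5) (by simp),
              hk (40 + 6) (by simp)]; exact h.runs_y)
        le_rfl hb (Or.inr rfl)).frame.mono ?_
      rintro t₅ s₅ ⟨⟨d₂, ht₅⟩, hf₅⟩
      refine ⟨?_, ?_, ?_, d₂.drop, ?_⟩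
      · rw [hf₅.rarr 2 (by simp [splitPosition]), hf₄.rarr 2 (by simp [splitPosition]),
          hf₃.rarr 2 (by simp)]
        exact b₃'
      · rw [hf₅.warr 9 (by simp [splitPosition]), g₄ 9 (by simp) (by simp)]
        exact b₄'
      · rw [hf₅.warr 35 (by simp [splitPosition]), hf₅.warr 36 (by simp [splitPosition])]
        exact d₁.drop
      · simp only [Prog.bound, BExp.cost, WExp.cost] at ht₃ ⊢
        omega
    · simp only [BExp.val, WExp.val, e₁₀, e₈'] at hb
      refine ⟨_, _, .skip s₂, b₃', b₄', RunLinks.of_le (by omega), RunLinks.of_le (by omega), ?_⟩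
      simp only [BExp.cost, WExp.cost]
      omega

/-- One step of the dynamic program over the levels. -/
def levelStep : Prog := advance ;; dropAll ;; stepBase

theorem levelStep_runs (hR : Ready M adaptive n k s₀) (hn : R ≤ n) (h₉ : s₀.wvar 9 = R)
    (hθ : ∀ r ≤ R, M.f 1 1 ≤ s₀.rarr 1 r) (hθ' : ∀ r < R, s₀.rarr 1 r ≤ s₀.rarr 1 (r + 1))
    (hi : i < n) (h : Levels M adaptive n k s₀ R i s) :
    Runs M levelStep s fun t s' => Levels M adaptive n k s₀ R (i + 1)
        { s' with wvar := Function.update s'.wvar 10 (i + 1) } ∧ s'.wvar 10 = i ∧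
      t + 600 * s'.slack n R ≤ 600 * s.slack n R + 1000 * (R + 2) := by
  have hC := hR.fits.cells
  have hW := hR.fits.words
  refine Runs.seq ((advance_runs hR hn h₉ hθ hθ' hi h).mono ?_)
  rintro t₁ s₁ ⟨h₁, hlong, hcov, ht₁⟩
  refine Runs.seq ((dropAll_runs hR hn h₉ h₁ hlong).frame.mono ?_)
  rintro t₂ s₂ ⟨⟨a₁, a₂, a₃, a₄, ht₂⟩, hf₂⟩
  have hs₂ : Agree (fun l => DropFixed l ∧ l ∉ [.warr 35, .warr 36, .warr 45, .warr 46]) s₁ s₂ :=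
    fun l hl => hf₂ l (DropFixed.keeps_dropAll hl)
  have hagree₂ := h₁.agree_of hs₂ fun l hl => ⟨hl.dropFixed, by
    simp only [List.mem_cons, not_or]
    refine ⟨?_, ?_, ?_, ?_, by simp⟩ <;> rintro rfl <;> simp [Static] at hl⟩
  have hw : ∀ a ∈ [8, 10, 30, 34, 40, 44], s₂.warr a = s₁.warr a := fun a ha =>
    hs₂ (.warr a) (by simp [DropFixed, LevelLoc, Static] at ha ⊢; omega)
  have hd : s₂.rarr 3 = s₁.rarr 3 := hs₂ (.rarr 3) (by simp [DropFixed, LevelLoc])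
  have e₁₀ : s₂.wvar 10 = i := Eq.trans (b := s₁.wvar 10)
    (hs₂ (.wvar 10) (by simp [DropFixed, LevelLoc])) h₁.pos
  refine (stepBase_runs hR hagree₂ hi e₁₀
    (fun v hv => by rw [hw 30 (by simp), hw (30 + 4) (by simp)]; exact h₁.base_x v hv)
    (fun v hv => by rw [hw 40 (by simp), hw (40 + 4) (by simp)]; exact h₁.base_y v hv)).frame.mono ?_
  rintro t₃ s₃ ⟨⟨b₁, b₂, ht₃⟩, hf₃⟩
  have g₃ : ∀ a, a ≠ 34 → a ≠ 44 → s₃.warr a = s₂.warr a := fun a h h' =>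
    hf₃.warr a (by simp [stepBase, h, h'])
  have r₃ : ∀ a, s₃.rarr a = s₂.rarr a := fun a => hf₃.rarr a (by simp [stepBase])
  have e₈ : s₃.warr 8 = s₁.warr 8 := (g₃ 8 (by simp) (by simp)).trans (hw 8 (by simp))
  refine ⟨⟨(hagree₂.frame hf₃ fun l hl => hl.keeps_stepBase).setW (by simp [Static]) _, by simp,
    b₁, b₂, ?_, ?_, ?_, ?_, ?_, ?_, ?_, ?_, ?_, ?_⟩, ?_, ?_⟩
  · simp only [e₈]; exact h₁.top
  · simp only [e₈]; exact h₁.mono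
  · simp only [e₈]; exact hlong
  · intro r hr
    simp only [e₈]
    have hlr := hlong r hr
    -- The window may have become empty; otherwise monotonicity keeps its cost below the threshold.
    rcases Nat.lt_or_ge (i + 1) (s₁.warr 8 r) with h' | h'
    swap
    · left; omega
    · right
      exact (hR.cost_mono (i + 1) _ i _ (by omega) h' le_rfl (h₁.le (by omega))).trans
        ((h₁.cost_le r hr).resolve_left (hlong r hr).ne')
  · simp only [e₈, r₃]; exact a₁
  · simp only [e₈, g₃ 9 (by simp) (by simp)]; exact a₂
  · simp only [e₈, g₃ 35 (by simp) (by simp), g₃ 36 (by simp) (by simp)]; exact a₃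
  · simp only [e₈, g₃ 45 (by simp) (by simp), g₃ 46 (by simp) (by simp)]; exact a₄
  · simp only [r₃, hd, g₃ 10 (by simp) (by simp), hw 10 (by simp)]; exact h₁.bounds
  · simp only [r₃, hd]
    intro i' hi' r hr
    rcases Nat.lt_succ_iff_lt_or_eq.1 hi' with hi' | rfl
    · exact h₁.covers i' hi' r hr
    · exact hcov r hr
  · rw [hf₃.wvar 10 (by simp [stepBase]), e₁₀]
  · have : s₃.slack n R = s₁.slack n R := by simp only [Store.slack, e₈]
    omega

/-- Initial windows of the levels. -/
def initLevels : Prog :=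
  .forUp 15 (.add (.var 9) (.lit 1)) (.storeW 8 (.var 15) (.lit 0) ;;
    .storeW 9 (.var 15) (.lit 0) ;; .storeR 2 (.var 15) (.ofWord (.lit 0))) ;;
  .storeW 8 (.add (.var 9) (.lit 1)) (.var 0)

/-- Approximate shortest paths. -/
def levelPaths : Prog :=
  clearBase ;; initLevels ;; .setW 10 (.lit 0) ;;
  .loop (.wlt (.var 10) (.var 0)) (levelStep ;; .setW 10 (.add (.var 10) (.lit 1)))

theorem initLevels_runs (hR : Ready M adaptive n k s₀) (hn : R ≤ n) (h₉ : s₀.wvar 9 = R)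
    (hs : Agree Static s₀ s) :
    Runs M initLevels s fun t s' => s'.warr 8 (R + 1) = n ∧
      (∀ r ≤ R, s'.warr 8 r = 0 ∧ s'.warr 9 r = 0 ∧ s'.rarr 2 r = 0) ∧ t ≤ 50 * (R + 2) := by
  have hC := hR.fits.cells
  have hW := hR.fits.words
  have e₉ : s.wvar 9 = R := Eq.trans (b := s₀.wvar 9) (hs (.wvar 9) (by simp [Static])) h₉
  obtain ⟨e₀, -⟩ := hR.exprs hs
  refine Runs.seq ((Runs.forUp_wp (fun r s' => s'.wvar 15 = r ∧ s'.wvar 9 = R ∧ s'.wvar 0 = n ∧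
    ∀ r' < r, s'.warr 8 r' = 0 ∧ s'.warr 9 r' = 0 ∧ s'.rarr 2 r' = 0) (R + 1) (by omega)
    (by simp [e₀, e₉]) ?_ ?_).mono ?_)
  · rintro p s' hp ⟨h₁, h₂, -⟩
    simp [h₁, h₂]; omega
  · rintro p s' hp ⟨h₁, h₂, h₃, h₄⟩
    simp [h₁, h₂, h₃]
    and_intros
    any_goals omega
    intro q hq
    rcases hq.lt_or_eq with hq | rfl
    · simp [hq.ne, h₄ q hq]
    · simp
  · rintro t₁ s₁ ⟨⟨-, h₂, h₃, h₄⟩, ht₁⟩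
    refine (Prog.wp.runs (Q := fun s' => s'.warr 8 (R + 1) = n ∧
      ∀ r ≤ R, s'.warr 8 r = 0 ∧ s'.warr 9 r = 0 ∧ s'.rarr 2 r = 0) ?_).mono ?_
    · simp [h₂, h₃]
      and_intros
      any_goals omega
      intro r hr
      simpa [show r ≠ R + 1 by omega] using h₄ r (by omega)
    · rintro t s' ⟨ht, h₅, h₆⟩
      refine ⟨h₅, h₆, ?_⟩
      simp only [Prog.bound, WExp.cost, RExp.cost] at ht ht₁
      omega

/-- Ends never move back, so the total slack, at most `(R + 1) n`, pays for all extensions. The rest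
of each of the `n` steps takes time proportional to the number of levels. -/
theorem levelPaths_runs (hR : Ready M adaptive n k s₀) (hn : R ≤ n) (h₉ : s₀.wvar 9 = R)
    (hθ : ∀ r ≤ R, M.f 1 1 ≤ s₀.rarr 1 r) (hθ' : ∀ r < R, s₀.rarr 1 r ≤ s₀.rarr 1 (r + 1))
    (hx : RunLinks (s₀.warr 30) 0 (n - k) (fun _ => False) (s₀.warr 35) (s₀.warr 36))
    (hy : RunLinks (s₀.warr 40) 0 (n - k) (fun _ => False) (s₀.warr 45) (s₀.warr 46))
    (hd : PathBounds (s₀.cost M adaptive k) n (M.f 1 1) (s₀.rarr 3) (s₀.warr 10)) :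
    Runs M levelPaths s₀ fun t s' =>
      PathBounds (s₀.cost M adaptive k) n (M.f 1 1) (s'.rarr 3) (s'.warr 10) ∧
      (∀ i < n, ∀ r ≤ R, Covers (s₀.cost M adaptive k) (s₀.rarr 1 r) n (s'.rarr 3) i) ∧
      t ≤ 2000 * ((n + 1) * (R + 2)) := by
  have hC := hR.fits.cells
  have hW := hR.fits.words
  have hs₀ : Agree Static s₀ s₀ := fun l _ => by cases l <;> rfl
  refine Runs.seq ((clearBase_runs hR hs₀).frame.mono ?_)
  rintro t₁ s₁ ⟨⟨a₁, a₂, ht₁⟩, hf₁⟩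
  have hs₁ := hs₀.frame hf₁ fun l hl => hl.keeps_clearBase
  refine Runs.seq ((initLevels_runs hR hn h₉ hs₁).frame.mono ?_)
  rintro t₂ s₂ ⟨⟨b₁, b₂, ht₂⟩, hf₂⟩
  have hs₂ : Agree Static s₀ s₂ := hs₁.frame hf₂ fun l hl => by
    rcases l with x | x | x | x <;> simp [Static, initLevels, Prog.forUp] at hl ⊢ <;> omega
  have g₂ : ∀ a ∈ [10, 35, 36, 45, 46], s₂.warr a = s₀.warr a := fun a ha =>
    (hf₂.warr a (by simp [initLevels, Prog.forUp] at ha ⊢; omega)).trans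
      (hf₁.warr a (by simp [clearBase, Prog.forUp] at ha ⊢; omega))
  have g₂' : ∀ a ∈ [30, 34, 40, 44], s₂.warr a = s₁.warr a := fun a ha =>
    hf₂.warr a (by simp [initLevels, Prog.forUp] at ha ⊢; omega)
  have r₂ : s₂.rarr 3 = s₀.rarr 3 := (hf₂.rarr 3 (by simp [initLevels, Prog.forUp])).trans
    (hf₁.rarr 3 (by simp [clearBase, Prog.forUp]))
  refine Runs.seq ((Prog.wp.runs (Q := fun s' => s'.wvar 10 = 0) (by simp; omega)).frame.mono ?_)
  rintro t₃ s₃ ⟨⟨ht₃, c₁⟩, hf₃⟩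
  have g₃ : ∀ a, s₃.warr a = s₂.warr a := fun a => hf₃.warr a (by simp)
  have r₃ : ∀ a, s₃.rarr a = s₂.rarr a := fun a => hf₃.rarr a (by simp)
  -- All ends start at `0`, so the links of the preprocessing, made without boundaries, fit.
  have hB : ∀ x, 0 < x → (IsBoundary (s₂.warr 8) R k x ↔ False) := by
    rintro x hx
    refine ⟨?_, False.elim⟩
    rintro ⟨r, hr, h⟩
    rw [(b₂ r hr).1] at h
    omega
  have h₃ : Levels M adaptive n k s₀ R 0 s₃ := by
    refine ⟨hs₂.frame hf₃ fun l hl => ?_, c₁, fun v hv => ?_, fun v hv => ?_, ?_, fun r hr => ?_,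
      fun r hr => Nat.zero_le _, fun r hr => Or.inl ?_, fun r hr => ?_, fun r hr => ?_, ?_, ?_, ?_,
      by omega⟩
    · rcases l with x | x | x | x <;> simp [Static] at hl ⊢; omega
    · rw [g₃, g₃, g₂' 30 (by simp), g₂' (30 + 4) (by simp)]; exact a₁ v hv
    · rw [g₃, g₃, g₂' 40 (by simp), g₂' (40 + 4) (by simp)]; exact a₂ v hv
    · rw [g₃]; exact b₁
    · rw [g₃, (b₂ r hr).1]; exact Nat.zero_le _
    · rw [g₃, (b₂ r hr).1]
    · rw [g₃, r₃, (b₂ r hr).1, (b₂ r hr).2.2, windowCost_self]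
    · rw [g₃, g₃, (b₂ r hr).1, (b₂ r hr).2.1, distinct_of_le _ le_rfl]
    · rw [g₃, g₃, g₃, g₂ 35 (by simp), g₂ 36 (by simp)]; exact hx.congr hB
    · rw [g₃, g₃, g₃, g₂ 45 (by simp), g₂ 46 (by simp)]; exact hy.congr hB
    · rw [g₃, r₃, r₂, g₂ 10 (by simp)]; exact hd
  refine (Runs.loop (fun s' => s'.wvar 10 ≤ n ∧ Levels M adaptive n k s₀ R (s'.wvar 10) s')
    (fun s' => 600 * s'.slack n R + 1010 * (R + 2) * (n - s'.wvar 10)) ?_ ?_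
    ⟨by omega, by rw [c₁]; exact h₃⟩).mono ?_
  · rintro s' -
    simp
  · rintro s' ⟨h₁, h₂⟩ hb
    simp only [BExp.val, WExp.val, (hR.exprs h₂.agree).1] at hb
    refine Runs.seq ((levelStep_runs hR hn h₉ hθ hθ' hb h₂).mono ?_)
    rintro t s'' ⟨d₁, d₂, ht⟩
    refine Runs.setW (by simp [d₂]; omega) ?_
    simp only [WExp.val, WExp.cost, BExp.cost, d₂, Function.update_self]
    refine ⟨⟨hb, d₁⟩, ?_⟩
    obtain ⟨q, hq⟩ : ∃ q, n - s'.wvar 10 = q + 1 := ⟨n - s'.wvar 10 - 1, by omega⟩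
    rw [hq, show n - (s'.wvar 10 + 1) = q by omega]
    have h₃ : 1010 * (R + 2) * (q + 1) = 1010 * (R + 2) * q + 1010 * (R + 2) := Nat.mul_succ _ _
    show 600 * s''.slack n R + _ + _ + _ ≤ _
    omega
  · rintro t s' ⟨⟨h₁, h₂⟩, hb, ht⟩
    simp only [BExp.val, WExp.val, (hR.exprs h₂.agree).1, not_lt] at hb
    have he : s'.wvar 10 = n := by omega
    rw [he] at h₂
    refine ⟨h₂.bounds, h₂.covers, ?_⟩
    have hsl : s₃.slack n R ≤ (R + 1) * n := by
      refine (Finset.sum_le_card_nsmul _ _ n fun r _ => Nat.sub_le _ _).trans ?_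
      simp
    simp only [Prog.bound, BExp.cost, WExp.cost, c₁, Nat.sub_zero] at ht ht₃
    have h₄ : (n + 1) * (R + 2) = (R + 1) * n + n + R + 2 := by ring
    have h₅ : 1010 * (R + 2) * n = 1010 * ((R + 1) * n) + 1010 * n := by ring
    have h₆ : n ≤ (R + 1) * n := Nat.le_mul_of_pos_left _ (by omega)
    omega

end DropAll

/-! ### Output of a partition -/

/-- The numbers of edges of the paths given by the predecessors, in the word array `11`. -/
def countHops : Prog :=
  .storeW 11 (.lit 0) (.lit 0) ;;
  .forUp 2 (.var 0)
    (.storeW 11 (.add (.var 2) (.lit 1)) (.add (.arr 11 (.arr 10 (.add (.var 2) (.lit 1)))) (.lit 1)))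

/-- Writes the lengths of the edges of the path to the end. -/
def writePartition : Prog :=
  countHops ;; .setW 13 (.var 0) ;;
  .loop (.wlt (.lit 0) (.var 13))
    (.setW 12 (.arr 10 (.var 13)) ;;
     .storeW 1 (.arr 11 (.var 12)) (.sub (.var 13) (.var 12)) ;; .setW 13 (.var 12)) ;;
  .setW 0 (.arr 11 (.var 0))

/-- The path is followed backwards; the number of edges before a vertex gives the index at which the
part starting there has to be written. -/
theorem countHops_runs {M : Machine} {n : ℕ} (hM : Fits M n) {s : Store} (hn : s.wvar 0 = n)
    (hpar : ∀ j, 0 < j → j ≤ n → s.warr 10 j < j) :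
    Runs M countHops s fun t s' => s'.warr 11 0 = 0 ∧ (∀ j ≤ n, s'.warr 11 j ≤ j) ∧
      (∀ j, 0 < j → j ≤ n → s'.warr 11 j = s'.warr 11 (s.warr 10 j) + 1) ∧ t ≤ 50 * (n + 2) := by
  have hC := hM.cells
  have hW := hM.words
  refine Runs.seq ((Prog.wp.runs (Q := fun s' => s'.wvar 0 = n ∧ s'.warr 10 = s.warr 10 ∧
    s'.warr 11 0 = 0) (by simp [hn]; omega)).mono ?_)
  rintro t₁ s₁ ⟨ht₁, a₁, a₂, a₃⟩
  simp only [Prog.bound, WExp.cost] at ht₁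
  refine (Runs.forUp_wp (fun p s' => s'.wvar 2 = p ∧ s'.wvar 0 = n ∧ s'.warr 10 = s.warr 10 ∧
    s'.warr 11 0 = 0 ∧ (∀ j ≤ p, s'.warr 11 j ≤ j) ∧
    ∀ j, 0 < j → j ≤ p → s'.warr 11 j = s'.warr 11 (s.warr 10 j) + 1) n (by omega)
    (by simp [a₁, a₂, a₃]; omega) ?_ ?_).mono ?_
  · rintro p s' hp ⟨h₁, h₂, -⟩
    simp [h₁, h₂]
  · rintro p s' hp ⟨h₁, h₂, h₃, h₄, h₅, h₆⟩
    have hp₁ := hpar (p + 1) (by omega) (by omega)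
    have hp₂ := h₅ (s.warr 10 (p + 1)) (by omega)
    simp [h₁, h₂, h₃, h₄]
    and_intros
    any_goals omega
    · intro j hj
      rcases hj.lt_or_eq with hj | rfl
      · rw [Function.update_of_ne hj.ne]; exact h₅ j (by omega)
      · rw [Function.update_self]; omega
    · intro j h0 hj
      have hlt := hpar j h0 (by omega)
      rw [Function.update_of_ne (by omega : s.warr 10 j ≠ p + 1)]
      rcases hj.lt_or_eq with hj | rfl
      · rw [Function.update_of_ne hj.ne]; exact h₆ j h0 (by omega)
      · rw [Function.update_self]
  · rintro t s' ⟨⟨-, -, -, h₁, h₂, h₃⟩, ht⟩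
    refine ⟨h₁, h₂, h₃, ?_⟩
    simp only [Prog.bound, WExp.cost] at ht
    omega

/-- Along the predecessors the inequalities `d (par j) + c (par j) j ≤ d j` telescope, so the true
cost of the partition is at most `d n`, even though the edges were relaxed with larger weights. -/
theorem writePartition_runs {α : Type*} [Fintype α] [DecidableEq α] {adaptive : Bool} {k n : ℕ}
    {lam u : ℝ} {f : ℕ → ℕ → ℝ} {T : List α} {c : ℕ → ℕ → ℝ} {M : Machine} (hM : Fits M n)
    (hT : T.length = n) {s : Store} (hn : s.wvar 0 = n)
    (hc : ∀ i j, i < j → j ≤ n → compressedSize adaptive k lam f (piece T i j) = c i j)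
    (hd : PathBounds c n u (s.rarr 3) (s.warr 10)) :
    Runs M writePartition s fun t s' => (∃ Q : List (List α), Q.map List.length = s'.output ∧
      Q.flatten = T ∧ (∀ v ∈ Q, v ≠ []) ∧
      partitionCost adaptive k lam f Q ≤ s.rarr 3 n) ∧ t ≤ 100 * (n + 2) := by
  have hC := hM.cells
  have hW := hM.words
  refine Runs.seq ((countHops_runs hM hn hd.par_lt).frame.mono ?_)
  rintro t₁ s₁ ⟨⟨a₁, a₂, a₃, ht₁⟩, hf₁⟩
  have e₁ := hf₁.warr 10 (by simp [countHops, Prog.forUp])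
  have e₂ := (hf₁.wvar 0 (by simp [countHops, Prog.forUp])).trans hn
  refine Runs.seq ((Prog.wp.runs (Q := fun s' => s'.wvar 13 = n) (by simp [e₂])).frame.mono ?_)
  rintro t₂ s₂ ⟨⟨ht₂, b₁⟩, hf₂⟩
  simp only [Prog.bound, WExp.cost] at ht₂
  let H := s₁.warr 11
  -- `Q` partitions the text from the current vertex on, and its lengths stand in the output from
  -- the index `H` of that vertex on.
  let I : Store → Prop := fun s' => s'.wvar 0 = n ∧ s'.warr 10 = s.warr 10 ∧ s'.warr 11 = H ∧
    s'.wvar 13 ≤ n ∧ ∃ Q : List (List α), Q.flatten = T.drop (s'.wvar 13) ∧ (∀ v ∈ Q, v ≠ []) ∧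
      partitionCost adaptive k lam f Q + s.rarr 3 (s'.wvar 13) ≤ s.rarr 3 n ∧
      H (s'.wvar 13) + Q.length = H n ∧ Q.map List.length =
        (List.range Q.length).map fun t => s'.warr 1 (H (s'.wvar 13) + t)
  have hI₂ : I s₂ := by
    refine ⟨(hf₂.wvar 0 (by simp)).trans e₂, (hf₂.warr 10 (by simp)).trans e₁, hf₂.warr 11 (by simp),
      b₁.le, [], ?_, by simp, ?_, ?_, by simp⟩
    · rw [b₁, ← hT]; simp
    · rw [b₁]; simp [partitionCost]
    · rw [b₁]; simp
  refine Runs.seq ((Runs.loop I (fun s' => 20 * s'.wvar 13) ?_ ?_ hI₂).mono ?_)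
  · rintro s' -
    simp; omega
  · rintro s' ⟨h₁, h₂, h₃, h₄, Q, h₅, h₆, h₇, h₈, h₉⟩ hb
    simp only [BExp.val, WExp.val] at hb
    obtain ⟨j, hj⟩ : ∃ j, s'.wvar 13 = j := ⟨_, rfl⟩
    rw [hj] at h₄ h₅ h₇ h₈ h₉ hb
    have hi := hd.par_lt j hb h₄
    have hle := hd.le j hb h₄
    have hH := a₃ j hb h₄
    have hHi := a₂ (s.warr 10 j) (by omega)
    refine (Prog.wp.runs (Q := fun s'' => I s'' ∧ s''.wvar 13 = s.warr 10 j) ?_).mono ?_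
    · simp [I, h₁, h₂, h₃, hj, H]
      and_intros
      any_goals omega
      refine ⟨piece T (s.warr 10 j) j :: Q, ?_, ?_, ?_, ?_, ?_⟩
      · rw [List.flatten_cons, h₅, piece_append_drop hi.le]
      · intro v hv
        rcases List.mem_cons.1 hv with rfl | hv
        · rw [piece_cons hi (by omega)]; simp
        · exact h₆ v hv
      · have : partitionCost adaptive k lam f (piece T (s.warr 10 j) j :: Q) =
            c (s.warr 10 j) j + partitionCost adaptive k lam f Q := by
          simp [partitionCost, hc _ _ hi h₄]
        linarith
      · simp only [List.length_cons]
        simp only [H] at h₈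
        omega
      · rw [List.map_cons, h₉, List.length_cons, List.range_succ_eq_map, List.map_cons,
          List.map_map, piece_length (by omega)]
        congr 1
        · simp
        · refine List.map_congr_left fun t _ => ?_
          simp only [Function.comp, H]
          rw [Function.update_of_ne (by omega)]
          congr 1
          omega
    · rintro t s'' ⟨ht, h₁₀, h₁₁⟩
      refine ⟨h₁₀, ?_⟩
      simp only [Prog.bound, BExp.cost, WExp.cost] at ht ⊢
      omega
  · rintro t₃ s₃ ⟨⟨h₁, h₂, h₃, h₄, Q, h₅, h₆, h₇, h₈, h₉⟩, hb, ht₃⟩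
    simp only [BExp.val, WExp.val, not_lt, Nat.le_zero] at hb
    rw [hb] at h₅ h₇ h₈ h₉
    have hH0 : H 0 = 0 := a₁
    refine (Prog.wp.runs (Q := fun s' => s'.wvar 0 = H n ∧ s'.warr 1 = s₃.warr 1)
      (by simp [h₁, h₃]; omega)).mono ?_
    rintro t₄ s₄ ⟨ht₄, d₁, d₂⟩
    refine ⟨⟨Q, ?_, by simpa using h₅, h₆, ?_⟩, ?_⟩
    · rw [h₉, Store.output, d₁, d₂, ← h₈, hH0, Nat.zero_add]
      simp
    · rw [hd.zero] at h₇; linarith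
    · simp only [Prog.bound, BExp.cost, WExp.cost, b₁] at ht₃ ht₄
      omega

/-! ### The program -/

/-- Preprocessing of the text. -/
def setup (adaptive : Bool) (D : ℕ) : Prog :=
  nameSubstrings D ;; .setW 8 (.sub (.var 0) (.var 1)) ;;
  prepare 20 0 ;; prepare 30 8 ;; prepare 40 8 ;; weightTable adaptive ;; initDist ;; thresholds

/-- For an order of at least `n` no context has a follower inside the text, so all sums are empty
and the order may be cut down to `n`. -/
theorem edgeCost_min {α : Type*} [DecidableEq α] {g : ℕ → ℝ} {lam : ℝ} {f : ℕ → ℕ → ℝ}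
    (T : List α) {n k i j : ℕ} (hj : j ≤ n) :
    edgeCost g k lam f (fun p => (T.drop p).take k) (fun p => (T.drop p).take (k + 1))
        (fun p => (T.drop p).take 1) i j =
      edgeCost g (min k n) lam f (fun p => (T.drop p).take (min k n))
        (fun p => (T.drop p).take (min k n + 1)) (fun p => (T.drop p).take 1) i j := by
  rcases le_total k n with h | h
  · rw [min_eq_left h]
  · rw [min_eq_right h]
    unfold edgeCost
    rw [windowSum_of_le _ _ (by omega), windowSum_of_le _ _ (by omega),
      windowSum_of_le _ _ (by omega), windowSum_of_le _ _ (by omega)]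

theorem IsNaming.edgeCost_eq {α : Type*} [DecidableEq α] {g : ℕ → ℝ} {lam : ℝ} {f : ℕ → ℕ → ℝ}
    {T : List α} {n k : ℕ} {x y z : ℕ → ℕ} (hx : IsNaming T n k x) (hy : IsNaming T n (k + 1) y)
    (hz : IsNaming T n 1 z) {i j : ℕ} (hj : j ≤ n) :
    edgeCost g k lam f x y z i j = edgeCost g k lam f (fun p => (T.drop p).take k)
      (fun p => (T.drop p).take (k + 1)) (fun p => (T.drop p).take 1) i j :=
  edgeCost_congr (fun p q _ _ => hx.2 p (by omega) q (by omega))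
    (fun p q _ _ => hy.2 p (by omega) q (by omega))
    (fun p q _ _ => hz.2 p (by omega) q (by omega)) hj

/-- The thresholds `c * (1 + ε) ^ r`, up to one of at least `n * c`, but at most `n` of them. -/
structure Thresholds (n : ℕ) (c ε : ℝ) (R : ℕ) (s : Store) : Prop where
  num : s.wvar 9 = R
  le : R ≤ n
  eq : ∀ r ≤ R, s.rarr 1 r = c * (1 + ε) ^ r
  last : s.rvar 3 = c * (1 + ε) ^ R
  total : s.rvar 4 = n * c
  lt : ∀ r < R, c * (1 + ε) ^ r < n * c
  reaches : R = n ∨ n * c ≤ c * (1 + ε) ^ R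

theorem setup_runs {M : Machine} {n σ k D : ℕ} (hM : Fits M n) (h1 : 1 ≤ n) {T : List (Fin σ)}
    (hT : T.length = n) (hσ : σ ≤ (n + 1) ^ D) (adaptive : Bool) {lam ε : ℝ} (hlam : 0 ≤ lam)
    (hf : IsOverhead M.f) :
    Runs M (setup adaptive D) (inputStore T k lam ε) fun t s => ∃ R,
      Ready M adaptive n (min k n) s ∧
      (∀ i j, i < j → j ≤ n →
        compressedSize adaptive k lam M.f (piece T i j) = s.cost M adaptive (min k n) i j) ∧
      RunLinks (s.warr 30) 0 (n - min k n) (fun _ => False) (s.warr 35) (s.warr 36) ∧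
      RunLinks (s.warr 40) 0 (n - min k n) (fun _ => False) (s.warr 45) (s.warr 46) ∧
      PathBounds (s.cost M adaptive (min k n)) n (M.f 1 1) (s.rarr 3) (s.warr 10) ∧
      Thresholds n (M.f 1 1) ε R s ∧
      t ≤ (Nat.log 2 n + D + 10) * (600 * (n + 2)) + 60 * (R + 1) := by
  have hC := hM.cells
  have hW := hM.words
  have hkn : min k n ≤ n := min_le_right k n
  refine Runs.seq ((nameSubstrings_runs hM h1 hT (k := k) (by simp [inputStore, hT])
    (by simp [inputStore]) hσ (by simp [inputStore]) (by simp [inputStore])).frame.mono ?_)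
  rintro t₁ s₁ ⟨⟨a₁, a₂, a₃, a₄, ht₁⟩, hf₁⟩
  have hname : ∀ l, l ∉ [.wvar 1, .wvar 2, .wvar 3, .wvar 4, .wvar 5, .wvar 6, .wvar 7] →
      l ∉ [.warr 0, .warr 1, .warr 2, .warr 3, .warr 4, .warr 5, .warr 6, .warr 7, .warr 20,
        .warr 30, .warr 40] → (nameSubstrings D).Keeps l := by
    intro l hl hl'
    simp only [List.mem_cons, not_or] at hl hl'
    simp [nameSubstrings, copyNames, gramNames, doubleNames, shiftNames, pairNames, clearChains,
      linkChains, walkChains, walkChainsBody, Prog.forUp, hl, hl']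
    exact symbolNames_keeps (by simp [digitRound, pairNames, clearChains,
      linkChains, walkChains, walkChainsBody, Prog.forUp, hl, hl']) D
  have b₀ : s₁.wvar 0 = n := (hf₁.wvar 0 (hname _ (by simp) (by simp))).trans
    (by simp [inputStore, hT])
  have b₁ : ∀ x, s₁.rvar x = (inputStore T k lam ε).rvar x := fun x =>
    hf₁.rvar x (hname _ (by simp) (by simp))
  have b₂ : ∀ a ∈ [27, 37, 47], ∀ v, s₁.warr a v = 0 := by
    intro a ha v
    rw [hf₁.warr a (hname _ (by simp) (by simp at ha ⊢; omega))]
    simp at ha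
    simp [inputStore]; omega
  refine Runs.seq (Runs.setW ⟨trivial, trivial⟩ ?_)
  simp only [WExp.cost, WExp.val, b₀, a₁]
  set s₂ : Store := { s₁ with wvar := Function.update s₁.wvar 8 (n - min k n) } with hs₂
  refine Runs.seq ((prepare_runs hM (s := s₂) (b := 20) (y := 0) (m := n) (by simp [hs₂, b₀])
    (by simp) (by simp) (by simp [hs₂, b₀]) le_rfl a₂.1 (b₂ 27 (by simp))).frame.mono ?_)
  rintro t₃ s₃ ⟨⟨c₁, ht₃⟩, hf₃⟩
  have w₃ : ∀ x, x ≠ 2 → x ≠ 3 → s₃.wvar x = s₂.wvar x := fun x h h' =>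
    hf₃.wvar x (by simp [prepare, Prog.forUp, h, h'])
  have g₃ : ∀ a, a ∉ [21, 22, 23, 25, 26, 27] → s₃.warr a = s₁.warr a := fun a h =>
    hf₃.warr a (by simp [prepare, Prog.forUp] at h ⊢; omega)
  have e₀ : s₃.wvar 0 = n := (w₃ 0 (by simp) (by simp)).trans (by simp [hs₂, b₀])
  have e₈ : s₃.wvar 8 = n - min k n := (w₃ 8 (by simp) (by simp)).trans (by simp [hs₂])
  refine Runs.seq ((prepare_runs hM (s := s₃) (b := 30) (y := 8) (m := n - min k n) e₀
    (by simp) (by simp) e₈ (by omega) (by rw [g₃ 30 (by simp)]; exact a₃.1)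
    (by rw [g₃ (30 + 7) (by simp)]; exact b₂ 37 (by simp))).frame.mono ?_)
  rintro t₄ s₄ ⟨⟨c₂, ht₄⟩, hf₄⟩
  have w₄ : ∀ x, x ≠ 2 → x ≠ 3 → s₄.wvar x = s₂.wvar x := fun x h h' =>
    (hf₄.wvar x (by simp [prepare, Prog.forUp, h, h'])).trans (w₃ x h h')
  have g₄ : ∀ a, a ∉ [31, 32, 33, 35, 36, 37] → s₄.warr a = s₃.warr a := fun a h =>
    hf₄.warr a (by simp [prepare, Prog.forUp] at h ⊢; omega)
  refine Runs.seq ((prepare_runs hM (s := s₄) (b := 40) (y := 8) (m := n - min k n)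
    ((w₄ 0 (by simp) (by simp)).trans (by simp [hs₂, b₀]))
    (by simp) (by simp) ((w₄ 8 (by simp) (by simp)).trans (by simp [hs₂])) (by omega)
    (by rw [g₄ 40 (by simp), g₃ 40 (by simp)]; exact a₄.1)
    (by rw [g₄ (40 + 7) (by simp), g₃ (40 + 7) (by simp)]; exact b₂ 47 (by simp))).frame.mono ?_)
  rintro t₅ s₅ ⟨⟨c₃, ht₅⟩, hf₅⟩
  have w₅ : ∀ x, x ≠ 2 → x ≠ 3 → s₅.wvar x = s₂.wvar x := fun x h h' =>
    (hf₅.wvar x (by simp [prepare, Prog.forUp, h, h'])).trans (w₄ x h h')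
  have g₅ : ∀ a, a ∉ [41, 42, 43, 45, 46, 47] → s₅.warr a = s₄.warr a := fun a h =>
    hf₅.warr a (by simp [prepare, Prog.forUp] at h ⊢; omega)
  have r₅ : ∀ x, s₅.rvar x = s₁.rvar x := fun x => (hf₅.rvar x (by simp [prepare, Prog.forUp])).trans
    ((hf₄.rvar x (by simp [prepare, Prog.forUp])).trans
      (hf₃.rvar x (by simp [prepare, Prog.forUp])))
  refine Runs.seq ((weightTable_runs hM (s := s₅) ((w₅ 0 (by simp) (by simp)).trans
    (by simp [hs₂, b₀])) adaptive).frame.mono ?_)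
  rintro t₆ s₆ ⟨⟨d₁, ht₆⟩, hf₆⟩
  have kw : ∀ l, l ≠ .wvar 2 → l ≠ .rarr 0 → (weightTable adaptive).Keeps l := by
    intro l h h'
    cases adaptive <;> simp [weightTable, Prog.forUp, h, h']
  refine Runs.seq ((initDist_runs hM (s := s₆) (((hf₆.wvar 0 (kw _ (by simp) (by simp))).trans
    (w₅ 0 (by simp) (by simp))).trans (by simp [hs₂, b₀]))).frame.mono ?_)
  rintro t₇ s₇ ⟨⟨d₂, d₃, ht₇⟩, hf₇⟩
  have w₇ : ∀ x, x ≠ 2 → x ≠ 3 → s₇.wvar x = s₂.wvar x := fun x h h' =>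
    (hf₇.wvar x (by simp [initDist, Prog.forUp, h])).trans
      ((hf₆.wvar x (kw _ (by simp [h]) (by simp))).trans (w₅ x h h'))
  refine (thresholds_runs hM (s := s₇) (c := M.f 1 1) (ε := ε)
    ((w₇ 0 (by simp) (by simp)).trans (by simp [hs₂, b₀])) d₂ ?_).frame.mono ?_
  · rw [hf₇.rvar 1 (by simp [initDist, Prog.forUp]), hf₆.rvar 1 (kw _ (by simp) (by simp)), r₅, b₁]
    simp [inputStore]
  rintro t₈ s₈ ⟨⟨R, p₁, p₂, p₃, p₄, p₅, p₆, p₇, ht₈⟩, hf₈⟩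
  have w₈ : ∀ x ∈ [0, 1, 8], s₈.wvar x = s₂.wvar x := fun x h =>
    (hf₈.wvar x (by simp [thresholds, nextThreshold] at h ⊢; omega)).trans
      (w₇ x (by simp at h; omega) (by simp at h; omega))
  have g₈ : ∀ a, a ≠ 10 → s₈.warr a = s₅.warr a := fun a h =>
    (hf₈.warr a (by simp [thresholds, nextThreshold])).trans
      ((hf₇.warr a (by simp [initDist, Prog.forUp, h])).trans
        (hf₆.warr a (kw _ (by simp) (by simp))))
  have m₁₀ : s₈.warr 10 = s₇.warr 10 := hf₈.warr 10 (by simp [thresholds, nextThreshold])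
  have m₃ : s₈.rarr 3 = s₇.rarr 3 := hf₈.rarr 3 (by simp [thresholds, nextThreshold])
  have m₀ : s₈.rarr 0 = s₆.rarr 0 := (hf₈.rarr 0 (by simp [thresholds, nextThreshold])).trans
    (hf₇.rarr 0 (by simp [initDist, Prog.forUp]))
  have m₀' : s₈.rvar 0 = lam := by
    rw [hf₈.rvar 0 (by simp [thresholds, nextThreshold]),
      hf₇.rvar 0 (by simp [initDist, Prog.forUp]), hf₆.rvar 0 (kw _ (by simp) (by simp)), r₅, b₁]
    simp [inputStore]
  have z₂₀ : s₈.warr 20 = s₁.warr 20 := by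
    rw [g₈ _ (by simp), g₅ _ (by simp), g₄ _ (by simp), g₃ _ (by simp)]
  have z₃₀ : s₈.warr 30 = s₁.warr 30 := by
    rw [g₈ _ (by simp), g₅ _ (by simp), g₄ _ (by simp), g₃ _ (by simp)]
  have z₄₀ : s₈.warr 40 = s₁.warr 40 := by
    rw [g₈ _ (by simp), g₅ _ (by simp), g₄ _ (by simp), g₃ _ (by simp)]
  have z₂ : ∀ a ∈ [21, 22], s₈.warr a = s₃.warr a := fun a h => by
    simp at h
    rw [g₈ _ (by omega), g₅ _ (by simp; omega), g₄ _ (by simp; omega)]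
  have z₃ : ∀ a ∈ [31, 32, 33, 35, 36], s₈.warr a = s₄.warr a := fun a h => by
    simp at h
    rw [g₈ _ (by omega), g₅ _ (by simp; omega)]
  have y₃₀ : s₃.warr 30 = s₁.warr 30 := g₃ 30 (by simp)
  have y₄₀ : s₄.warr 40 = s₁.warr 40 := by rw [g₄ 40 (by simp), g₃ 40 (by simp)]
  rw [y₃₀] at c₂
  rw [y₄₀] at c₃
  have hcost : ∀ i j, j ≤ n → s₈.cost M adaptive (min k n) i j =
      edgeCost (weight adaptive) (min k n) lam M.f (fun p => (T.drop p).take (min k n))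
        (fun p => (T.drop p).take (min k n + 1)) (fun p => (T.drop p).take 1) i j := by
    intro i j hj
    rw [Store.cost, m₀', z₂₀, z₃₀, z₄₀]
    exact a₃.edgeCost_eq a₄ a₂ hj
  refine ⟨R, ⟨hM, ?_, ?_, ?_, hkn, ?_, ?_, ?_, ?_, ?_, ?_, ?_, ?_, ?_, ?_⟩, ?_, ?_, ?_, ?_,
    ⟨p₁, p₂, p₃, p₄, p₅, p₆, p₇⟩, ?_⟩
  · rw [w₈ 0 (by simp)]; simp [hs₂, b₀]
  · rw [w₈ 1 (by simp)]; simp [hs₂, a₁]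
  · rw [w₈ 8 (by simp)]; simp [hs₂]
  · rw [z₃₀]; exact a₃.1
  · rw [z₄₀]; exact a₄.1
  · rw [z₂₀, z₂ 21 (by simp), z₂ 22 (by simp)]; exact c₁.linked
  · rw [z₃₀, z₃ 31 (by simp), z₃ 32 (by simp)]; exact c₂.linked
  · rw [z₄₀, g₈ 41 (by simp), g₈ 42 (by simp)]; exact c₃.linked
  · rw [z₃₀, z₃ 33 (by simp)]; exact c₂.rank_eq
  · rw [z₄₀, g₈ 43 (by simp)]; exact c₃.rank_eq
  · rw [m₀]; exact d₁
  · intro i j i' j' hi hij hj hj'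
    rw [hcost i j (by omega), hcost i' j' hj']
    refine edgeCost_mono (weight_increment_mono adaptive) hlam hf (fun p q h => ?_) hi hij hj
    -- Equal strings of length `min k n + 1` have equal prefixes, which is the refinement required
    -- for monotonicity.
    have := congrArg (List.take (min k n)) h
    simpa [List.take_take] using this
  · exact hf.1 1 1 le_rfl le_rfl
  · intro i j hij hj
    rw [compressedSize_piece adaptive k lam M.f T hij (by omega), hcost i j hj,
      edgeCost_min T hj]
  · rw [z₃₀, z₃ 35 (by simp), z₃ 36 (by simp)]; exact c₂.runs
  · rw [z₄₀, g₈ 45 (by simp), g₈ 46 (by simp)]; exact c₃.runs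
  · rw [m₃, m₁₀]
    refine ⟨by simp [d₃ 0 (Nat.zero_le n)], fun j h0 hj => ?_, fun j h0 hj => ?_, fun j hj => ?_⟩
    · rw [(d₃ j hj).2]; omega
    · obtain ⟨q, rfl⟩ : ∃ q, j = q + 1 := ⟨j - 1, by omega⟩
      rw [(d₃ _ hj).2, (d₃ _ hj).1, Nat.add_sub_cancel, (d₃ q (by omega)).1, Store.cost_succ]
      push_cast
      exact (by ring : _ = _).le
    · rw [(d₃ j hj).1]
  · have h₁ : (Nat.log 2 n + D + 5) * (500 * (n + 2)) ≤ (Nat.log 2 n + D + 5) * (600 * (n + 2)) :=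
      Nat.mul_le_mul_left _ (by omega)
    have h₂ : (Nat.log 2 n + D + 10) * (600 * (n + 2)) =
      (Nat.log 2 n + D + 5) * (600 * (n + 2)) + 3000 * (n + 2) := by ring
    omega

/-- The program that computes an approximately optimal partition of a text over an alphabet of size
at most `(n + 1) ^ D`. -/
def partitionText (adaptive : Bool) (D : ℕ) : Prog :=
  setup adaptive D ;; .ite (.rle (.var 4) (.var 3)) levelPaths allEdges ;; writePartition

/-- If the thresholds reach `n f(1, 1)`, the levels are used; otherwise there are exactly `n` of
them below that cost and all edges are relaxed exactly. Both give the covering property that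
`isApproxOptimal_of_dist` requires. -/
theorem partitionText_runs {M : Machine} {n σ k D : ℕ} (hM : Fits M n) (h1 : 1 ≤ n)
    {T : List (Fin σ)} (hT : T.length = n) (hσ : σ ≤ (n + 1) ^ D) (adaptive : Bool) {lam ε : ℝ}
    (hlam : 0 ≤ lam) (hf : IsOverhead M.f) (hε : 0 ≤ ε) :
    Runs M (partitionText adaptive D) (inputStore T k lam ε) fun t s =>
      (∃ Q : List (List (Fin σ)), Q.map List.length = s.output ∧
        IsApproxOptimal adaptive k lam M.f ε T Q) ∧
      ∃ R, (∀ r < R, M.f 1 1 * (1 + ε) ^ r < n * M.f 1 1) ∧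
        (t ≤ (Nat.log 2 n + D + 11) * (600 * (n + 2)) + 60 * (R + 1) + 2000 * ((n + 1) * (R + 2)) ∨
          M.f 1 1 * (1 + ε) ^ n < n * M.f 1 1 ∧
          t ≤ (Nat.log 2 n + D + 11) * (600 * (n + 2)) + 60 * (R + 1) +
            400 * ((n + 1) * (n + 1))) := by
  refine Runs.seq ((setup_runs hM h1 hT hσ adaptive hlam hf).mono ?_)
  rintro t₁ s₁ ⟨R, hR, hc, hx, hy, hd, hth, ht₁⟩
  have hf0 := hR.unit_nonneg
  have hmono : ∀ i j i', i' ≤ i → i < j → j ≤ T.length →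
      s₁.cost M adaptive (min k n) i j ≤ s₁.cost M adaptive (min k n) i' j :=
    fun i j i' h₁ h₂ h₃ => hR.cost_mono i j i' j h₁ h₂ le_rfl (by omega)
  have hunit : ∀ i j, i < j → j ≤ T.length → M.f 1 1 ≤ s₁.cost M adaptive (min k n) i j :=
    fun i j h₁ h₂ => (s₁.cost_succ M adaptive (min k n) i).symm.trans_le
      (hR.cost_mono i (i + 1) i j le_rfl (Nat.lt_succ_self i) h₁ (by omega))
  have hfinal : ∀ {d : ℕ → ℝ} {par : ℕ → ℕ},
      PathBounds (s₁.cost M adaptive (min k n)) n (M.f 1 1) d par →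
      (∀ i j, i < j → j ≤ T.length → s₁.cost M adaptive (min k n) i j ≤ n * M.f 1 1 →
        ∃ j', j ≤ j' ∧ j' ≤ T.length ∧
          d j' ≤ d i + (1 + ε) * s₁.cost M adaptive (min k n) i j) →
      ∀ Q : List (List (Fin σ)), Q.flatten = T → (∀ u ∈ Q, u ≠ []) →
        partitionCost adaptive k lam M.f Q ≤ d n → IsApproxOptimal adaptive k lam M.f ε T Q := by
    intro d par hd hcov Q h₁ h₂ h₃
    refine isApproxOptimal_of_dist (fun i j h h' => hc i j h (by omega)) hmono
      (fun i j h h' => hf0.trans (hunit i j h h')) hε hcov hd.zero ?_ h₁ h₂ (by rw [hT]; exact h₃)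
    rw [hT]
    exact hd.le_mul n le_rfl
  have hwrite : ∀ {t : ℕ} {s : Store}, s.wvar 0 = n →
      PathBounds (s₁.cost M adaptive (min k n)) n (M.f 1 1) (s.rarr 3) (s.warr 10) →
      (∀ i j, i < j → j ≤ T.length → s₁.cost M adaptive (min k n) i j ≤ n * M.f 1 1 →
        ∃ j', j ≤ j' ∧ j' ≤ T.length ∧
          s.rarr 3 j' ≤ s.rarr 3 i + (1 + ε) * s₁.cost M adaptive (min k n) i j) →
      Runs M writePartition s fun t s' => (∃ Q : List (List (Fin σ)),
        Q.map List.length = s'.output ∧ IsApproxOptimal adaptive k lam M.f ε T Q) ∧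
        t ≤ 100 * (n + 2) := by
    intro t s hn hd hcov
    refine (writePartition_runs hM hT hn hc hd).mono ?_
    rintro t s' ⟨⟨Q, h₁, h₂, h₃, h₄⟩, ht⟩
    exact ⟨⟨Q, h₁, hfinal hd hcov Q h₂ h₃ h₄⟩, ht⟩
  have hsum : (Nat.log 2 n + D + 11) * (600 * (n + 2)) =
      (Nat.log 2 n + D + 10) * (600 * (n + 2)) + 600 * (n + 2) := by ring
  refine Runs.seq (Runs.ite ⟨trivial, trivial⟩ (fun hb => ?_) (fun hb => ?_))
  · simp only [BExp.val, RExp.val, hth.last, hth.total] at hb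
    have hpow : ∀ r, M.f 1 1 * (1 + ε) ^ r ≤ M.f 1 1 * (1 + ε) ^ (r + 1) := fun r =>
      mul_le_mul_of_nonneg_left (pow_le_pow_right₀ (by linarith) (Nat.le_succ r)) hf0
    have hpow₁ : ∀ r, M.f 1 1 ≤ M.f 1 1 * (1 + ε) ^ r := fun r =>
      le_mul_of_one_le_right hf0 (one_le_pow₀ (by linarith))
    refine (levelPaths_runs hR hth.le hth.num (fun r hr => by rw [hth.eq r hr]; exact hpow₁ r)
      (fun r hr => by rw [hth.eq r hr.le, hth.eq (r + 1) hr]; exact hpow r)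
      hx hy hd).frame.mono ?_
    rintro t₂ s₂ ⟨⟨a₁, a₂, ht₂⟩, hf₂⟩
    refine (hwrite (t := 0) ?_ a₁ ?_).mono ?_
    · rw [hf₂.wvar 0 (by simp [levelPaths, clearBase, initLevels, levelStep, advance, advanceRound,
        tryLevel, loadLevel, extendWindow, addPosition, commit, moveBoundary, splitPosition,
        mergePosition, relaxLevel, relax, dropAll, dropLevel, walkStep, dropPosition, stepBase,
        Prog.forUp])]
      exact hR.n_eq
    · intro i j hij hj hcb
      have hex : ∃ r, s₁.cost M adaptive (min k n) i j ≤ M.f 1 1 * (1 + ε) ^ r :=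
        ⟨R, hcb.trans hb⟩
      classical
      -- The least threshold that admits the edge is at most `1 + ε` times its cost, as the
      -- preceding threshold is below the cost; for the first threshold this holds because every
      -- edge costs at least `f 1 1`.
      have hle : Nat.find hex ≤ R := Nat.find_min' hex (hcb.trans hb)
      obtain ⟨j', h₁, h₂, h₃⟩ := a₂ i (by omega) _ hle
      rw [hth.eq _ hle] at h₂ h₃
      refine ⟨j', h₂ j hij (by omega) (Nat.find_spec hex), by omega, h₃.trans ?_⟩
      have hc0 := hunit i j hij hj
      refine add_le_add_right ?_ _
      rcases Nat.eq_zero_or_pos (Nat.find hex) with h0 | h0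
      · rw [h0, pow_zero, mul_one]
        have : 0 ≤ ε * s₁.cost M adaptive (min k n) i j := mul_nonneg hε (hf0.trans hc0)
        linarith
      · have hmin := Nat.find_min hex (m := Nat.find hex - 1) (by omega)
        obtain ⟨q, hq⟩ : ∃ q, Nat.find hex = q + 1 := ⟨Nat.find hex - 1, by omega⟩
        rw [hq, Nat.add_sub_cancel, not_le] at hmin
        rw [hq, pow_succ, ← mul_assoc, mul_comm]
        exact mul_le_mul_of_nonneg_left hmin.le (by linarith)
    · rintro t₃ s₃ ⟨h₁, ht₃⟩
      refine ⟨h₁, R, hth.lt, Or.inl ?_⟩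
      simp only [BExp.cost, RExp.cost]
      omega
  · simp only [BExp.val, RExp.val, hth.last, hth.total, not_le] at hb
    have hRn : R = n := hth.reaches.resolve_right (not_le.2 hb)
    refine (allEdges_runs hR (fun l _ => by cases l <;> rfl) hd).frame.mono ?_
    rintro t₂ s₂ ⟨⟨a₁, a₂, ht₂⟩, hf₂⟩
    refine (hwrite (t := 0) ?_ a₁ ?_).mono ?_
    · rw [hf₂.wvar 0 (by simp [allEdges, edgeRow, edgeRound, clearBase, stepBase, extendWindow,
        addPosition, relax, Prog.forUp])]
      exact hR.n_eq
    · intro i j hij hj _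
      refine ⟨j, le_rfl, hj, (a₂ i j hij (by omega)).trans ?_⟩
      have : 0 ≤ ε * s₁.cost M adaptive (min k n) i j :=
        mul_nonneg hε (hf0.trans (hunit i j hij hj))
      linarith
    · rintro t₃ s₃ ⟨h₁, ht₃⟩
      refine ⟨h₁, R, hth.lt, Or.inr ⟨by rwa [hRn] at hb, ?_⟩⟩
      simp only [BExp.cost, RExp.cost]
      omega

/-! ### The bound on the time -/

/-- Since `2 ≤ n + 1`, a coefficient `a ≤ 2 ^ a` costs `a` further exponents, and a sum of two
powers costs one. -/
theorem exists_eval_le_pow (p : Polynomial ℕ) : ∃ D : ℕ, ∀ n, 1 ≤ n → p.eval n ≤ (n + 1) ^ D := by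
  have two : ∀ n m : ℕ, 1 ≤ n → 2 ^ m ≤ (n + 1) ^ m := fun n m hn =>
    Nat.pow_le_pow_left (by omega) m
  induction p using Polynomial.induction_on' with
  | add p q hp hq =>
    obtain ⟨D, hD⟩ := hp
    obtain ⟨E, hE⟩ := hq
    refine ⟨max D E + 1, fun n hn => ?_⟩
    have h₁ := (hD n hn).trans (Nat.pow_le_pow_right (by omega) (le_max_left D E))
    have h₂ := (hE n hn).trans (Nat.pow_le_pow_right (by omega) (le_max_right D E))
    rw [Polynomial.eval_add, pow_succ]
    nlinarith
  | monomial i a =>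
    refine ⟨a + i, fun n hn => ?_⟩
    rw [Polynomial.eval_monomial, pow_add]
    exact Nat.mul_le_mul (a.lt_two_pow_self.le.trans (two n a hn))
      (Nat.pow_le_pow_left (by omega) i)

/-- The strict inequality excludes `c = 0`, so `c` cancels. No positivity of `f 1 1` has to be
assumed. -/
theorem lt_logb_of_mul_pow_lt {c ε x : ℝ} {r : ℕ} (hc : 0 ≤ c) (hε : 0 < ε)
    (h : c * (1 + ε) ^ r < x * c) : (r : ℝ) < Real.logb (1 + ε) x := by
  have hc' : 0 < c := by
    rcases hc.lt_or_eq with h' | h'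
    · exact h'
    · rw [← h'] at h; simp at h
  have hx : (1 + ε) ^ r < x := by
    rw [mul_comm] at h
    exact lt_of_mul_lt_mul_right h hc
  have hpos : (0 : ℝ) < (1 + ε) ^ r := by positivity
  rw [Real.lt_logb_iff_rpow_lt (by linarith) (hpos.trans hx), Real.rpow_natCast]
  exact hx

/-- Change of base, with `log₂ (1 + ε) ≤ log₂ (1 + ε₀)`. This is why the constant depends on `ε₀`:
the naming takes `n log₂ n` time even if `ε` is large. -/
theorem log_two_le_mul_logb {n : ℕ} (hn : 2 ≤ n) {ε ε₀ : ℝ} (hε : 0 < ε) (hε₀ : ε ≤ ε₀) :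
    Real.logb 2 n ≤ (⌈Real.logb 2 (1 + ε₀)⌉₊ + 1 : ℕ) * Real.logb (1 + ε) n := by
  have hn' : (1 : ℝ) < n := by exact_mod_cast hn
  have h₁ : 0 < Real.logb (1 + ε) n := Real.logb_pos (by linarith) hn'
  have h₂ : Real.logb 2 n = Real.logb 2 (1 + ε) * Real.logb (1 + ε) n := by
    rw [Real.mul_logb (by linarith) (by linarith) (by linarith)]
  rw [h₂]
  refine mul_le_mul_of_nonneg_right ?_ h₁.le
  have h₃ : Real.logb 2 (1 + ε) ≤ Real.logb 2 (1 + ε₀) :=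
    Real.logb_le_logb_of_le (by norm_num) (by linarith) (by linarith)
  have h₄ := Nat.le_ceil (Real.logb 2 (1 + ε₀))
  push_cast
  linarith

theorem theorem4 (adaptive : Bool) (p : Polynomial ℕ) :
    ∃ P : Prog, ∀ ε₀ : ℝ, 0 < ε₀ → ∃ C : ℕ,
      ∀ (n σ k w : ℕ) (T : List (Fin σ)) (lam ε : ℝ) (f : ℕ → ℕ → ℝ),
        2 ≤ n → T.length = n → σ ≤ p.eval n →
        C * n ^ C ≤ 2 ^ w → k < 2 ^ w →
        0 < lam → IsOverhead f → 0 < ε → ε ≤ ε₀ →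
        ∃ (t : ℕ) (s : Store),
          Exec { wordBits := w, cells := C * n, f := f } P (inputStore T k lam ε) t s ∧
          (t : ℝ) ≤ (C : ℝ) * ((n : ℝ) * Real.logb (1 + ε) (n : ℝ)) ∧
          ∃ Q : List (List (Fin σ)),
            Q.map List.length = s.output ∧ IsApproxOptimal adaptive k lam f ε T Q := by
  obtain ⟨D, hD⟩ := exists_eval_le_pow p
  refine ⟨partitionText adaptive D, fun ε₀ hε₀ => ?_⟩
  obtain ⟨K, hK⟩ : ∃ K, K = ⌈Real.logb 2 (1 + ε₀)⌉₊ + 1 := ⟨_, rfl⟩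
  -- `K` pays for the change of base and `1200 * D` for the digits of the symbols; `40000` exceeds
  -- the sum of the other constants and also ensures the sizes in `Fits`.
  refine ⟨K * (1200 * D + 40000), fun n σ k w T lam ε f hn hT hσ hw hk hlam hf hε hεε => ?_⟩
  obtain ⟨C, hC⟩ : ∃ C, C = K * (1200 * D + 40000) := ⟨_, rfl⟩
  rw [← hC] at hw ⊢
  have hC₀ : 40000 ≤ C := by
    rw [hC, ← Nat.one_mul 40000]
    exact Nat.mul_le_mul (by omega) (by omega)
  have hCn : 40000 * n ≤ C * n := Nat.mul_le_mul_right n hC₀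
  have hM : Fits { wordBits := w, cells := C * n, f := f } n := by
    refine ⟨?_, ?_⟩
    · show 4 * n + 20 ≤ C * n
      omega
    · show 4 * n + 20 < 2 ^ w
      have : C * n ≤ C * n ^ C := Nat.mul_le_mul_left C (Nat.le_self_pow (by omega) n)
      omega
  obtain ⟨t, s, hexec, ⟨Q, hQ₁, hQ₂⟩, R, hRlt, ht⟩ :=
    partitionText_runs hM (by omega) hT (hσ.trans (hD n (by omega))) adaptive hlam.le hf hε.le
      (k := k)
  refine ⟨t, s, hexec, ?_, Q, hQ₁, hQ₂⟩
  have hf0 : 0 ≤ f 1 1 := hf.1 1 1 le_rfl le_rfl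
  obtain ⟨l, hl⟩ : ∃ l, l = Real.logb (1 + ε) n := ⟨_, rfl⟩
  have hn₂ : (2 : ℝ) ≤ n := by exact_mod_cast hn
  have hl0 : 0 < l := by rw [hl]; exact Real.logb_pos (by linarith) (by linarith)
  have hlog := log_two_le_mul_logb hn hε hεε
  rw [← hK, ← hl] at hlog
  have hone : 1 ≤ Real.logb 2 n := by
    rw [Real.le_logb_iff_rpow_le (by norm_num) (by linarith), Real.rpow_one]
    exact hn₂
  have hnat : (Nat.log 2 n : ℝ) ≤ Real.logb 2 n := Real.natLog_le_logb n 2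
  have hK₁ : (1 : ℝ) ≤ K := by rw [hK]; push_cast; linarith [Nat.cast_nonneg (α := ℝ) ⌈Real.logb 2 (1 + ε₀)⌉₊]
  -- The last threshold but one is still below `n f(1, 1)`.
  have hR : (R : ℝ) ≤ l + 1 := by
    rcases Nat.eq_zero_or_pos R with h | h
    · rw [h]; push_cast; linarith
    · have h₁ := lt_logb_of_mul_pow_lt hf0 hε (hRlt (R - 1) (by omega))
      rw [← hl, Nat.cast_sub h] at h₁
      push_cast at h₁
      linarith
  -- All parts of the time are multiples of `n * (K * l)`.
  have hnl : (n : ℝ) ≤ n * (K * l) := le_mul_of_one_le_right (by linarith) (by linarith)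
  have hKl : l ≤ K * l := le_mul_of_one_le_left hl0.le hK₁
  have hnl' : (n : ℝ) * l ≤ n * (K * l) := mul_le_mul_of_nonneg_left hKl (by linarith)
  have hl₂ : l ≤ n * (K * l) := by
    have : 1 * (K * l) ≤ n * (K * l) := mul_le_mul_of_nonneg_right (by linarith) (by linarith)
    linarith
  have hX : (1 : ℝ) ≤ n * (K * l) := by linarith
  have hsetup : ((Nat.log 2 n + D + 11 : ℕ) : ℝ) * (600 * (n + 2)) ≤
      (1200 * D + 14400) * (n * (K * l)) := by
    have h₁ : ((Nat.log 2 n + D + 11 : ℕ) : ℝ) ≤ (D + 12) * (K * l) := by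
      push_cast
      have : (D + 11 : ℝ) * 1 ≤ (D + 11) * (K * l) :=
        mul_le_mul_of_nonneg_left (by linarith) (by positivity)
      linarith
    have h₂ : (600 * (n + 2) : ℝ) ≤ 1200 * n := by linarith
    calc _ ≤ ((D + 12) * (K * l)) * (1200 * n) := mul_le_mul h₁ h₂ (by positivity) (by positivity)
      _ = _ := by ring
  have hthr : (60 * (R + 1) : ℝ) ≤ 180 * (n * (K * l)) := by linarith
  have hgoal : (C : ℝ) * (n * l) = (1200 * D + 40000) * (n * (K * l)) := by
    rw [hC]; push_cast; ring
  rw [← hl, hgoal]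
  rcases ht with ht | ⟨hlt, ht⟩
  · have ht' : (t : ℝ) ≤ ((Nat.log 2 n + D + 11 : ℕ) : ℝ) * (600 * (n + 2)) + 60 * (R + 1) +
        2000 * ((n + 1) * (R + 2)) := by exact_mod_cast ht
    have h₁ : ((n : ℝ) + 1) * (R + 2) ≤ (3 / 2 * n) * (l + 3) :=
      mul_le_mul (by linarith) (by linarith) (by positivity) (by positivity)
    have h₂ : (3 / 2 * (n : ℝ)) * (l + 3) ≤ 6 * (n * (K * l)) := by linarith
    linarith
  · have ht' : (t : ℝ) ≤ ((Nat.log 2 n + D + 11 : ℕ) : ℝ) * (600 * (n + 2)) + 60 * (R + 1) +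
        400 * ((n + 1) * (n + 1)) := by exact_mod_cast ht
    -- Here `n < l`, so the quadratic time of the exact algorithm is `O(n l)`.
    have h₀ := lt_logb_of_mul_pow_lt hf0 hε hlt
    rw [← hl] at h₀
    have h₁ : ((n : ℝ) + 1) * (n + 1) ≤ (2 * n) * (2 * l) :=
      mul_le_mul (by linarith) (by linarith) (by positivity) (by positivity)
    linarith
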